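/- Let $d,m\ge 1$. Write $|x|_*=\max_{i,j}|x_i-x_j|$ for $x=(x_1,\dots,x_{m+1})\in(\mathbb R^d)^{m+1}$. Let $0<\varepsilon\le 1$, $A_\varepsilon\ge 0$, and let $K$ be a kernel with $|K(x)|\le A_\varepsilon |x|_*^{-md}$ off the diagonal $x_1=\dots=x_{m+1}$ and $$|K(x_1,x_2,\dots,x_{m+1})-K(x',x_2,\dots,x_{m+1})|\le \frac{A_\varepsilon|x_1-x'|^{\varepsilon}}{|x|_*^{md+\varepsilon}}\quad\text{whenever } |x_1-x'|\le\tfrac1{m+1}\sum_{k}|x_k-x_1|,$$ together with the symmetric estimates in each of the variables $x_2,\dots,x_{m+1}$. Let $1\le r_1,\dots,r_m,\alpha<\infty$ with $\frac1{r_1}+\dots+\frac1{r_m}=\frac1\alpha$, and let $T$ be a bounded $m$-linear operator $L^{r_1}(\mathbb R^d)\times\dots\times L^{r_m}(\mathbb R^d)\to L^\alpha(\mathbb R^d)$ given by integration against $K$ away from the diagonal: for bounded compactly supported $f_i$, $T(f_1,\dots,f_m)(x)=\int K(y_1,\dots,y_m,x)\prod_i f_i(y_i)\,dy$ for a.e.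 $x\notin\bigcap_i\operatorname{supp}f_i$. Let $\Lambda(f_1,\dots,f_{m+1})=\int T(f_1,\dots,f_m)f_{m+1}$. Fix a smooth function $\varphi$ on $(\mathbb R^d)^{m+1}$, invariant under $x\mapsto(x_1+v,\dots,x_{m+1}+v)$, supported in $\{\delta\le|x|_*\le1\}$ for some $\delta>0$, with $\sum_{s\in\mathbb Z}\varphi(2^{-s}x)=1$ off the diagonal. Put $K_s(x)=\varphi(2^{-s}x)K(x)$, $$\Lambda_\mu^\nu(f_1,\dots,f_{m+1})=\int_{(\mathbb R^{d})^{m+1}}\sum_{\mu<s<\nu}K_s(x)\prod_i f_i(x_i)\,dx\quad(\mu,\nu\in\mathbb Z),$$ and assume $C_T:=\sup_{\mu,\nu}\|\Lambda_\mu^\nu\|_{L^{r_1}\times\dots\times L^{r_m}\times L^{\alpha'}\to\mathbb C}<\infty$, where $\frac1\alpha+\frac1{\alpha'}=1$. A collection $\mathcal S$ of axis-parallel cubes is $\eta$-sparse if there are pairwise disjoint measurable $E_Q\subset Q$ with $|E_Q|\ge\eta|Q|$ ($Q\in\mathcal S$). Let $(f)_{q,Q}=|Q|^{-1/q}\|f\mathbf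 1_Q\|_q$ and $\mathrm{PSF}_{\mathcal S}^{\vec p}(f_1,\dots,f_{m+1})=\sum_{Q\in\mathcal S}|Q|\prod_{i}(f_i)_{p_i,Q}$. Then there are a sparsity constant $\eta\in(0,1)$ depending only on $d,m$, and a constant $c$ depending only on $d,m,\varepsilon$ and $\varphi$, such that for every $1<p\le\infty$, $f_1\in L^1(\mathbb R^d)$ and $f_2,\dots,f_{m+1}\in L^p(\mathbb R^d)$ the following hold, with suprema over all $\eta$-sparse collections $\mathcal S$. (i) For all $\mu,\nu$ the integral defining $\Lambda_\mu^\nu(f_1,\dots,f_{m+1})$ converges absolutely and $$|\Lambda_\mu^\nu(f_1,\dots,f_{m+1})|\le c\,[C_T+A_\varepsilon]\,\sup_{\mathcal S}\mathrm{PSF}_{\mathcal S}^{(1,p,\dots,p)}(f_1,\dots,f_{m+1}).$$ (ii) If moreover $f_i\in L^{r_i}$ for $i\le m$ and $f_{m+1}\in L^{\alpha'}$, then $$|\Lambda(f_1,\dots,f_{m+1})|\le c\,[C_T+\|T\|+A_\varepsilon]\,\sup_{\mathcal S}\mathrm{PSF}_{\mathcal S}^{(1,p,\dots,p)}(f_1,\dots,f_{m+1}),$$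 where $\|T\|$ is the norm of $T:L^{r_1}\times\dots\times L^{r_m}\to L^\alpha$. (iii) For general $f_1\in L^1$, $f_2,\dots,f_{m+1}\in L^p$, the bound in (ii) holds for $\Lambda(f_1,\dots,f_{m+1})$ whenever it is defined as a limit: if $f_i^{(n)}\to f_i$ a.e., $|f_i^{(n)}|\le|f_i|$ a.e., $f_i^{(n)}\in L^{r_i}$ for $i\le m$, $f_{m+1}^{(n)}\in L^{\alpha'}$, and $\Lambda(f_1^{(n)},\dots,f_{m+1}^{(n)})\to z$, then $|z|$ is bounded by the right-hand side of (ii). -/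

import Mathlib

open MeasureTheory Filter Topology
open scoped ENNReal NNReal

noncomputable section

namespace MultiCZ

/-- The Euclidean space `ℝ^d`. -/
abbrev Space (d : ℕ) := EuclideanSpace ℝ (Fin d)

/-! ### Cubes, sparse collections, positive sparse forms -/

/-- A (nondegenerate, half-open, axis-parallel) cube of `ℝ^d`, given by a corner and a side length. -/
structure Cube (d : ℕ) where
  corner : Space d
  side : ℝ
  side_pos : 0 < side

/-- The set of points of a cube. -/
def Cube.toSet {d : ℕ} (Q : Cube d) : Set (Space d) :=
  {x | ∀ i, Q.corner i ≤ x i ∧ x i < Q.corner i + Q.side}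

/-- A collection of cubes is `η`-sparse if its members `Q` have pairwise disjoint measurable subsets
`E Q ⊆ Q` with `|E Q| ≥ η |Q|`. -/
def IsSparse {d : ℕ} (η : ℝ) (S : Set (Cube d)) : Prop :=
  ∃ E : Cube d → Set (Space d),
    (∀ Q ∈ S, MeasurableSet (E Q) ∧ E Q ⊆ Q.toSet ∧
      ENNReal.ofReal η * volume Q.toSet ≤ volume (E Q)) ∧
    ∀ Q ∈ S, ∀ Q' ∈ S, Q ≠ Q' → Disjoint (E Q) (E Q')

/-- The average `(f)_{p,Q} = |Q|^{-1/p} ‖f 1_Q‖_p`; for `p = ∞` the factor is `1`. -/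
def cubeAverage {d : ℕ} (p : ℝ≥0∞) (Q : Cube d) (f : Space d → ℂ) : ℝ≥0∞ :=
  volume Q.toSet ^ (-(p⁻¹).toReal) * eLpNorm (Q.toSet.indicator f) p volume

/-- The positive sparse form `∑_{Q ∈ S} |Q| ∏_i (f_i)_{p_i,Q}`. -/
def PSF {d n : ℕ} (S : Set (Cube d)) (p : Fin n → ℝ≥0∞) (f : Fin n → Space d → ℂ) : ℝ≥0∞ :=
  ∑' Q : S, volume (Q : Cube d).toSet * ∏ i, cubeAverage (p i) (Q : Cube d) (f i)

/-- The supremum of the positive sparse forms over all `η`-sparse collections of cubes. -/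
def supPSF {d n : ℕ} (η : ℝ) (p : Fin n → ℝ≥0∞) (f : Fin n → Space d → ℂ) : ℝ≥0∞ :=
  ⨆ (S : Set (Cube d)) (_ : IsSparse η S), PSF S p f

/-- The exponents `(1, p, …, p)`. -/
def onePExponents (m : ℕ) (p : ℝ≥0∞) : Fin (m + 1) → ℝ≥0∞ :=
  Fin.cons 1 fun _ => p

/-! ### Multilinear Calderón–Zygmund kernels and operators -/

/-- `max_{i,j} |x_i - x_j|`. It vanishes exactly on the diagonal `x_1 = ⋯ = x_n`. -/
def spread {d n : ℕ} (x : Fin n → Space d) : ℝ :=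
  ⨆ ij : Fin n × Fin n, ‖x ij.1 - x ij.2‖

/-- `m`-linear Calderón–Zygmund kernels with the size estimate and the `ε`-smoothness estimate in
each of the `m + 1` variables, both with the constant `A`. Nothing is asked on the diagonal. -/
structure IsCZKernel {d m : ℕ} (ε : ℝ) (A : ℝ≥0) (K : (Fin (m + 1) → Space d) → ℂ) : Prop where
  size : ∀ x, spread x ≠ 0 → ‖K x‖ ≤ A / spread x ^ (m * d)
  smooth : ∀ (j : Fin (m + 1)) (x : Fin (m + 1) → Space d) (x' : Space d),
    ‖x j - x'‖ ≤ 1 / ((m : ℝ) + 1) * ∑ k, ‖x k - x j‖ →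
    ‖K x - K (Function.update x j x')‖ ≤
      A * ‖x j - x'‖ ^ ε / spread x ^ ((m : ℝ) * (d : ℝ) + ε)

/-- The bounded `m`-linear operator `T : L^{r_1} × ⋯ × L^{r_m} → L^α` is given by integration against
`K` away from the diagonal: if `f_1, …, f_m` are bounded with compact support, then
`T(f_1, …, f_m)(x) = ∫ K(y_1, …, y_m, x) f_1(y_1) ⋯ f_m(y_m) dy` for almost every `x` outside
`⋂ supp f_i`. -/
def HasKernel {d m : ℕ} {r : Fin m → ℝ≥0∞} {α : ℝ≥0∞} [∀ i, Fact (1 ≤ r i)] [Fact (1 ≤ α)]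
    (T : ContinuousMultilinearMap ℂ
      (fun i : Fin m => Lp ℂ (r i) (volume : Measure (Space d)))
      (Lp ℂ α (volume : Measure (Space d))))
    (K : (Fin (m + 1) → Space d) → ℂ) : Prop :=
  ∀ (f : Fin m → Space d → ℂ) (hf : ∀ i, MemLp (f i) (r i) volume),
    (∀ i, MemLp (f i) ∞ volume) → (∀ i, HasCompactSupport (f i)) →
    ∀ᵐ x, x ∉ ⋂ i, tsupport (f i) →
      T (fun i => (hf i).toLp (f i)) x =
        ∫ y : Fin m → Space d,
          K (Fin.snoc (α := fun _ => Space d) y x) * ∏ i, f i (y i)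

/-- The `(m+1)`-linear form `Λ(f_1, …, f_{m+1}) = ∫ T(f_1, …, f_m) f_{m+1}`, on
`L^{r_1} × ⋯ × L^{r_m}` and functions `f_{m+1}` in the dual space of `L^α`. -/
def form {d m : ℕ} {r : Fin m → ℝ≥0∞} {α : ℝ≥0∞} [∀ i, Fact (1 ≤ r i)] [Fact (1 ≤ α)]
    (T : ContinuousMultilinearMap ℂ
      (fun i : Fin m => Lp ℂ (r i) (volume : Measure (Space d)))
      (Lp ℂ α (volume : Measure (Space d))))
    (f : Fin (m + 1) → Space d → ℂ)
    (hf : ∀ i : Fin m, MemLp (f i.castSucc) (r i) volume) : ℂ :=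
  ∫ x, T (fun i => (hf i).toLp (f i.castSucc)) x * f (Fin.last m) x

/-! ### Truncations -/

/-- The smooth cutoff functions `φ` that cut a kernel into scales: `φ` is a smooth function of the
differences `x_i - x_j`, supported where `max |x_i - x_j|` is at most `1` and bounded below, and
`∑_{s ∈ ℤ} φ(2^{-s} x) = 1` off the diagonal. -/
structure IsScaleCutoff {d m : ℕ} (φ : (Fin (m + 1) → Space d) → ℝ) : Prop where
  smooth : ContDiff ℝ ((⊤ : ℕ∞) : WithTop ℕ∞) φ
  translation : ∀ (x : Fin (m + 1) → Space d) (v : Space d), φ (fun i => x i + v) = φ x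
  support : ∃ δ : ℝ, 0 < δ ∧ ∀ x, φ x ≠ 0 → δ ≤ spread x ∧ spread x ≤ 1
  partition : ∀ x, spread x ≠ 0 → HasSum (fun s : ℤ => φ ((2 : ℝ) ^ (-s) • x)) 1

/-- The piece `K_s(x) = φ(2^{-s} x) K(x)` of the kernel `K` at scale `2^s`. -/
def kernelPiece {d m : ℕ} (φ : (Fin (m + 1) → Space d) → ℝ) (K : (Fin (m + 1) → Space d) → ℂ)
    (s : ℤ) (x : Fin (m + 1) → Space d) : ℂ :=
  (φ ((2 : ℝ) ^ (-s) • x) : ℂ) * K x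

/-- The truncated form
`Λ_μ^ν(f_1, …, f_{m+1}) = ∫ ∑_{μ < s < ν} K_s(x) f_1(x_1) ⋯ f_{m+1}(x_{m+1}) dx`. -/
def truncForm {d m : ℕ} (φ : (Fin (m + 1) → Space d) → ℝ) (K : (Fin (m + 1) → Space d) → ℂ)
    (μ ν : ℤ) (f : Fin (m + 1) → Space d → ℂ) : ℂ :=
  ∫ x : Fin (m + 1) → Space d,
    (∑ s ∈ Finset.Ioo μ ν, kernelPiece φ K s x) * ∏ i, f i (x i)

/-- The exponents `(r_1, …, r_m, α')`, with `α'` the conjugate exponent of `α`. -/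
def formExponents {m : ℕ} (r : Fin m → ℝ≥0∞) (α : ℝ≥0∞) : Fin (m + 1) → ℝ≥0∞ :=
  Fin.snoc (α := fun _ => ℝ≥0∞) r (ENNReal.conjExponent α)

/-- The truncation constant `C_T(r_1, …, r_m, α)`: the supremum over all finite truncations of the
norm of `Λ_μ^ν` on `L^{r_1} × ⋯ × L^{r_m} × L^{α'}`. -/
def truncConst {d m : ℕ} (φ : (Fin (m + 1) → Space d) → ℝ) (K : (Fin (m + 1) → Space d) → ℂ)
    (r : Fin m → ℝ≥0∞) (α : ℝ≥0∞) : ℝ≥0∞ :=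
  ⨆ (μ : ℤ) (ν : ℤ) (f : Fin (m + 1) → Space d → ℂ)
    (_ : ∀ i, MemLp (f i) (formExponents r α i) volume ∧
      eLpNorm (f i) (formExponents r α i) volume ≤ 1),
    ‖truncForm φ K μ ν f‖ₑ

end MultiCZ

end

open MultiCZ

/-! The sparse bound is proved with all exponents equal to 1. By Hölder, raising an exponent only
enlarges a cube average, so the exponents `(1, p, …, p)` follow.

Both kinds of forms are placed in a family `Λ s` (`FormFamily`). The increment `Λ (s+1) - Λ s` is
integration against the scale `2^s` kernel. `Λ s` vanishes when the first function and some other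
one are separated at level `s`. On bounded functions living on a tripled cube `P` it is at most `B
|P|` times the product of the sup bounds. For truncations one takes `Λ_μ^{min(s,ν)}`
(`formFamily_trunc`). For `T` one takes `Λ - Λ_{s-1}^ν` with `ν` large (`formFamily_op`); its
locality is the kernel representation of `T`, and its size is controlled by `‖T‖ + C_T`.

One step (`exists_stopping_step`). Fix a grid cube `Q` and functions on its triple with normalized
masses `t_i`. The cubes carrying too much mass have dilates of total volume at most `|Q|/2`; the
Whitney cubes `L` of the union of these dilates are the stopping cubes (`exists_isStopping`). The
remainder, that is the form at the level of `Q` minus the sum over `L` of the forms at the level of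
`L` with first function restricted to `L`, is at most a constant times `(A+B) |Q| ∏ t_i`. To see
this, split all `m+1` functions into good and bad parts and expand.

If all entries are good, the sup bound suffices (`norm_remainder_le_of_bounded`). If one entry has
mean zero on a stopping cube `L'` (`norm_remainder_le_of_mean_zero`), the scales from `L'` up to `Q`
sum geometrically by kernel smoothness. At the level of `L'`, split the first function over the
stopping cubes `L`. When `L` is close to `L'`, the Whitney property makes their levels differ by at
most one, so moving from the level of `L'` to that of `L` costs at most one kernel term. When `L` is
far, both forms vanish. No cancellation is needed here, so it does no harm that cutting the first
function may destroy its mean zero.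

Iteration (`FormFamily.enorm_le_supPSF`). By locality the subtracted forms are again forms of
localized functions, so the step repeats on each `L`. The total volume halves with each generation,
and a crude a priori bound removes what is left (`le_tsum_descendants`). The triples of all cubes
that occur form a sparse family, witnessed by the part of each cube outside its children.

General functions are reached through dominated approximation by bounded functions with bounded
support, because sparse forms are monotone in the absolute values. -/

noncomputable section

namespace MultiCZ

section

/-! ### Dyadic grids -/

/-- The index of the cube of side `2^k` that contains `x`, in the dyadic grid with origin `v`. -/
def gridIndex {d : ℕ} (v : Space d) (k : ℤ) (x : Space d) : Fin d → ℤ :=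
  fun i => ⌊(x i - v i) / (2 : ℝ) ^ k⌋

/-- A cube of a dyadic grid, given by its level and its index. -/
abbrev GridCube (d : ℕ) := ℤ × (Fin d → ℤ)

/-- The union of the grid cubes of the level of `P` whose indices are within `a` of that of `P`. -/
def box {d : ℕ} (v : Space d) (a : ℤ) (P : GridCube d) : Set (Space d) :=
  {x | ∀ i, |gridIndex v P.1 x i - P.2 i| ≤ a}

/-- The grid indices of `x` and `y` at level `k` are within `a` of each other. -/
def Near {d : ℕ} (v : Space d) (a k : ℤ) (x y : Space d) : Prop :=
  ∀ i, |gridIndex v k x i - gridIndex v k y i| ≤ a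

/-- The grid cube of level `k` that contains `x`. -/
def cubeAt {d : ℕ} (v : Space d) (k : ℤ) (x : Space d) : GridCube d := (k, gridIndex v k x)

/-- The grid cube `j` levels above `P` that contains `P`. -/
def ancestor {d : ℕ} (j : ℕ) (P : GridCube d) : GridCube d := (P.1 + j, fun i => P.2 i / 2 ^ j)

/-- The volume of a grid cube of level `k`. -/
def vol (d : ℕ) (k : ℤ) : ℝ := ((2 : ℝ) ^ k) ^ d

variable {d : ℕ} {v : Space d}

lemma vol_pos (d : ℕ) (k : ℤ) : 0 < vol d k := by unfold vol; positivity

lemma vol_mono {k k' : ℤ} (h : k ≤ k') : vol d k ≤ vol d k' := by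
  unfold vol
  have : (2 : ℝ) ^ k ≤ 2 ^ k' := zpow_le_zpow_right₀ (by norm_num) h
  gcongr

lemma vol_add (k : ℤ) (j : ℕ) : vol d (k + j) = (2 ^ j) ^ d * vol d k := by
  unfold vol
  rw [zpow_add₀ (by norm_num), zpow_natCast, mul_pow, mul_comm]

lemma lt_of_vol_lt {k k' : ℤ} (h : vol d k < vol d k') : k < k' := by
  by_contra! hk
  exact absurd (vol_mono (d := d) hk) (not_le.2 h)

lemma gridIndex_add (k : ℤ) (j : ℕ) (x : Space d) (i : Fin d) :
    gridIndex v (k + j) x i = gridIndex v k x i / 2 ^ j := by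
  unfold gridIndex
  have h := Int.floor_div_natCast ((x i - v i) / (2 : ℝ) ^ k) (2 ^ j)
  push_cast at h
  rw [← h, zpow_add₀ (by norm_num), zpow_natCast, div_div]

lemma gridIndex_succ (k : ℤ) (x : Space d) (i : Fin d) :
    gridIndex v (k + 1) x i = gridIndex v k x i / 2 := by
  simpa using gridIndex_add (v := v) k 1 x i

lemma mem_box_zero {P : GridCube d} {x : Space d} : x ∈ box v 0 P ↔ gridIndex v P.1 x = P.2 := by
  simp only [box, Set.mem_ofPred_eq, funext_iff]
  refine forall_congr' fun i => ?_
  rw [abs_nonpos_iff, sub_eq_zero]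

lemma mem_box_iff_near {a : ℤ} {P : GridCube d} {x y : Space d} (hy : y ∈ box v 0 P) :
    x ∈ box v a P ↔ Near v a P.1 x y := by
  rw [mem_box_zero] at hy
  simp [box, Near, hy]

lemma cubeAt_eq {P : GridCube d} {x : Space d} (h : x ∈ box v 0 P) : cubeAt v P.1 x = P := by
  rw [mem_box_zero] at h
  simp [cubeAt, h]

lemma mem_cubeAt (k : ℤ) (x : Space d) : x ∈ box v 0 (cubeAt v k x) := by
  simp [mem_box_zero, cubeAt]

lemma box_mono {a b : ℤ} (h : a ≤ b) (P : GridCube d) : box v a P ⊆ box v b P :=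
  fun _ hx i => (hx i).trans h

lemma Near.symm {a k : ℤ} {x y : Space d} (h : Near v a k x y) : Near v a k y x := fun i => by
  rw [abs_sub_comm]; exact h i

lemma Near.mono {a b k : ℤ} {x y : Space d} (h : Near v a k x y) (hab : a ≤ b) : Near v b k x y :=
  fun i => (h i).trans hab

lemma Near.trans {a b k : ℤ} {x y z : Space d} (h : Near v a k x y) (h' : Near v b k y z) :
    Near v (a + b) k x z := fun i => by
  have := h i; have := h' i
  rw [abs_le] at *; constructor <;> omega

/-- Floor division by 2 turns an index difference of at most 2 into one of at most 1. A double
neighbourhood at one level is thus absorbed by a single neighbourhood one level up, and this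
supplies all the room in the Whitney arguments. -/
lemma Near.succ {k : ℤ} {x y : Space d} (h : Near v 2 k x y) : Near v 1 (k + 1) x y := fun i => by
  have := h i
  rw [gridIndex_succ, gridIndex_succ]
  rw [abs_le] at *; constructor <;> omega

lemma Near.le_level {k k' : ℤ} {x y : Space d} (h : Near v 1 k x y) (hk : k ≤ k') :
    Near v 1 k' x y := by
  induction k', hk using Int.leInduction with
  | base => exact h
  | succ k' _ ih => exact (ih.mono (by norm_num)).succ

lemma Near.lt_level {k k' : ℤ} {x y : Space d} (h : Near v 2 k x y) (hk : k < k') :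
    Near v 1 k' x y := h.succ.le_level (by omega)

lemma mem_ancestor {P : GridCube d} {x : Space d} (hx : x ∈ box v 0 P) (j : ℕ) :
    x ∈ box v 0 (ancestor j P) := by
  rw [mem_box_zero] at *
  ext i
  simp [ancestor, gridIndex_add, ← hx]

lemma ancestor_eq_of_mem {P P' : GridCube d} {x : Space d} (hx : x ∈ box v 0 P)
    (hx' : x ∈ box v 0 P') {j : ℕ} (h : P'.1 = P.1 + j) : P' = ancestor j P := by
  have h1 := mem_ancestor hx j
  rw [mem_box_zero] at h1 hx'
  have h2 : P'.1 = (ancestor j P).1 := h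
  rw [← h2] at h1
  exact Prod.ext h2 (hx'.symm.trans h1)

lemma box_zero_subset_ancestor (P : GridCube d) (j : ℕ) : box v 0 P ⊆ box v 0 (ancestor j P) :=
  fun _ hx => mem_ancestor hx j

lemma near_zero_of_mem {P : GridCube d} {x y : Space d} (hx : x ∈ box v 0 P) (hy : y ∈ box v 0 P) :
    Near v 0 P.1 x y := (mem_box_iff_near hy).1 hx

lemma Near.zero_le_level {k k' : ℤ} {x y : Space d} (h : Near v 0 k x y) (hk : k ≤ k') :
    Near v 0 k' x y := by
  obtain ⟨j, rfl⟩ := Int.le.dest hk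
  have := mem_ancestor (v := v) (P := cubeAt v k y) (x := x) h j
  have h2 := mem_ancestor (mem_cubeAt (v := v) k y) j
  exact (mem_box_iff_near (P := ancestor j (cubeAt v k y)) h2).1 this

/-- Grid cubes are nested or disjoint. -/
lemma box_zero_subset {P P' : GridCube d} {x : Space d} (hx : x ∈ box v 0 P)
    (hx' : x ∈ box v 0 P') (h : P.1 ≤ P'.1) : box v 0 P ⊆ box v 0 P' := by
  obtain ⟨j, hj⟩ := Int.le.dest h
  rw [ancestor_eq_of_mem hx hx' hj.symm]
  exact box_zero_subset_ancestor P j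

lemma eq_of_mem_box_zero {P P' : GridCube d} {x : Space d} (hx : x ∈ box v 0 P)
    (hx' : x ∈ box v 0 P') (h : P.1 = P'.1) : P = P' := by
  rw [← cubeAt_eq hx, ← cubeAt_eq hx', h]

/-! ### Grid boxes as cubes: measurability, volume and Euclidean size -/

/-- The grid box as a cube. -/
def boxCube (v : Space d) (a : ℕ) (P : GridCube d) : Cube d where
  corner := WithLp.toLp 2 fun i => v i + (P.2 i - a) * (2 : ℝ) ^ P.1
  side := (2 * a + 1) * (2 : ℝ) ^ P.1
  side_pos := by positivity

lemma boxCube_toSet (a : ℕ) (P : GridCube d) : (boxCube v a P).toSet = box v a P := by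
  ext x
  simp only [Cube.toSet, boxCube, box, Set.mem_ofPred_eq, gridIndex]
  refine forall_congr' fun i => ?_
  have h2 : (0 : ℝ) < 2 ^ P.1 := by positivity
  rw [abs_le, neg_le_sub_iff_le_add, sub_le_iff_le_add, ← sub_le_iff_le_add, Int.le_floor,
    ← Int.lt_add_one_iff, Int.floor_lt, le_div_iff₀ h2, div_lt_iff₀ h2]
  push_cast
  constructor <;> rintro ⟨h, h'⟩ <;> constructor <;> nlinarith

lemma Cube.volume_toSet (Q : Cube d) : volume Q.toSet = ENNReal.ofReal (Q.side ^ d) := by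
  have h1 : Q.toSet = (WithLp.ofLp) ⁻¹' (Set.univ.pi fun i => Set.Ico (Q.corner i) (Q.corner i + Q.side)) := by
    ext x
    simp [Cube.toSet, Set.mem_pi]
  rw [h1, (PiLp.volume_preserving_ofLp (Fin d)).measure_preimage
    (MeasurableSet.univ_pi fun i => measurableSet_Ico).nullMeasurableSet, Real.volume_pi_Ico]
  simp [ENNReal.ofReal_pow Q.side_pos.le]

lemma Cube.measurableSet_toSet (Q : Cube d) : MeasurableSet Q.toSet := by
  have h1 : Q.toSet = (WithLp.ofLp) ⁻¹' (Set.univ.pi fun i => Set.Ico (Q.corner i) (Q.corner i + Q.side)) := by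
    ext x
    simp [Cube.toSet, Set.mem_pi]
  rw [h1]
  exact (PiLp.volume_preserving_ofLp (Fin d)).measurable
    (MeasurableSet.univ_pi fun i => measurableSet_Ico)

lemma measurableSet_box (a : ℕ) (P : GridCube d) : MeasurableSet (box v a P) := by
  rw [← boxCube_toSet]; exact Cube.measurableSet_toSet _

lemma measurableSet_box_zero (P : GridCube d) : MeasurableSet (box v 0 P) := measurableSet_box 0 P

lemma measurableSet_box_one (P : GridCube d) : MeasurableSet (box v 1 P) := measurableSet_box 1 P

lemma volume_box (a : ℕ) (P : GridCube d) :
    volume (box v a P) = ENNReal.ofReal ((2 * a + 1) ^ d * vol d P.1) := by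
  rw [← boxCube_toSet, Cube.volume_toSet, boxCube, vol, mul_pow]

lemma volume_box_zero (P : GridCube d) : volume (box v 0 P) = ENNReal.ofReal (vol d P.1) := by
  simpa using volume_box (v := v) 0 P

lemma volume_box_one (P : GridCube d) :
    volume (box v 1 P) = ENNReal.ofReal (3 ^ d * vol d P.1) := by
  have := volume_box (v := v) 1 P
  norm_num at this ⊢
  exact this

lemma box_zero_nonempty (P : GridCube d) : (box v 0 P).Nonempty := by
  by_contra! h
  have := volume_box_zero (v := v) P
  rw [h, measure_empty, eq_comm, ENNReal.ofReal_eq_zero] at this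
  exact absurd (vol_pos d P.1) (not_lt.2 this)

lemma near_of_norm_sub_le {k : ℤ} {x y : Space d} (h : ‖x - y‖ ≤ (2 : ℝ) ^ k) :
    Near v 1 k x y := fun i => by
  have h2 : (0 : ℝ) < 2 ^ k := by positivity
  have h1 : |x i - y i| ≤ 2 ^ k := by
    have := (PiLp.norm_apply_le (x - y) i).trans h
    simpa [Real.norm_eq_abs] using this
  rw [abs_le] at h1
  unfold gridIndex
  have e1 : (x i - v i) / (2 : ℝ) ^ k ≤ (y i - v i) / 2 ^ k + 1 := by
    rw [div_add_one h2.ne']; gcongr; linarith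
  have e2 : (y i - v i) / (2 : ℝ) ^ k ≤ (x i - v i) / 2 ^ k + 1 := by
    rw [div_add_one h2.ne']; gcongr; linarith
  have f1 := Int.floor_le_floor e1
  have f2 := Int.floor_le_floor e2
  rw [Int.floor_add_one] at f1 f2
  rw [abs_le]; constructor <;> omega

lemma norm_sub_le_of_near_zero {k : ℤ} {x y : Space d} (h : Near v 0 k x y) :
    ‖x - y‖ ≤ d * (2 : ℝ) ^ k := by
  have h2 : (0 : ℝ) < 2 ^ k := by positivity
  have hc : ∀ i, ‖(x - y) i‖ ≤ 2 ^ k := fun i => by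
    have hi := h i
    rw [abs_nonpos_iff, sub_eq_zero] at hi
    have := (Int.abs_sub_lt_one_of_floor_eq_floor hi).le
    rw [← sub_div, abs_div, abs_of_pos h2, div_le_one h2] at this
    simpa [Real.norm_eq_abs] using this
  have : ‖x - y‖ ≤ ∑ i, ‖(x - y) i‖ := by
    rw [EuclideanSpace.norm_eq, Real.sqrt_le_left (Finset.sum_nonneg fun i _ => norm_nonneg _)]
    exact Finset.sum_sq_le_sq_sum_of_nonneg fun i _ => norm_nonneg _
  calc ‖x - y‖ ≤ ∑ i, ‖(x - y) i‖ := this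
    _ ≤ ∑ _i : Fin d, (2 : ℝ) ^ k := Finset.sum_le_sum fun i _ => hc i
    _ = d * 2 ^ k := by simp

lemma box_one_subset {P P' : GridCube d} (h : box v 0 P ⊆ box v 0 P') (hl : P.1 ≤ P'.1) :
    box v 1 P ⊆ box v 1 P' := by
  obtain ⟨y, hy⟩ := box_zero_nonempty (v := v) P
  intro x hx
  rw [mem_box_iff_near hy] at hx
  rw [mem_box_iff_near (h hy)]
  exact hx.le_level hl

end

section

variable {d : ℕ} {v : Space d}

/-! ### Maximal grid cubes and the stopping collection -/

/-- `P` has the property `G` and no strict ancestor of `P` has it. -/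
def IsMaximalCube (G : GridCube d → Prop) (P : GridCube d) : Prop :=
  G P ∧ ∀ j : ℕ, 0 < j → ¬ G (ancestor j P)

lemma ancestor_ancestor (i j : ℕ) (P : GridCube d) :
    ancestor i (ancestor j P) = ancestor (j + i) P := by
  ext l
  · simp [ancestor, add_assoc]
  · simp only [ancestor]
    rw [Int.ediv_ediv_of_nonneg (by positivity), pow_add]

lemma ancestor_zero (P : GridCube d) : ancestor 0 P = P := by
  ext l <;> simp [ancestor]

/-- The `j`-th ancestor lies `j` levels higher, so the level bound leaves only finitely many
ancestors with the property. -/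
lemma exists_isMaximalCube {G : GridCube d → Prop} {K : ℤ} (hK : ∀ P, G P → P.1 < K)
    {P : GridCube d} (hP : G P) : ∃ j, IsMaximalCube G (ancestor j P) := by
  classical
  set N := (K - P.1).toNat
  have hb : ∀ j, G (ancestor j P) → j ≤ N := fun j hj => by
    have := hK _ hj
    simp only [ancestor] at this
    omega
  have h0 : G (ancestor 0 P) := by rwa [ancestor_zero]
  refine ⟨Nat.findGreatest (fun j => G (ancestor j P)) N,
    Nat.findGreatest_spec (P := fun j => G (ancestor j P)) (Nat.zero_le N) h0, fun j hj hG => ?_⟩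
  rw [ancestor_ancestor] at hG
  have := Nat.le_findGreatest (P := fun j => G (ancestor j P)) (hb _ hG) hG
  omega

lemma IsMaximalCube.eq {G : GridCube d → Prop} {P P' : GridCube d} (h : IsMaximalCube G P)
    (h' : IsMaximalCube G P') {x : Space d} (hx : x ∈ box v 0 P) (hx' : x ∈ box v 0 P') :
    P = P' := by
  rcases lt_trichotomy P.1 P'.1 with hl | hl | hl
  · obtain ⟨j, hj⟩ := Int.le.dest hl.le
    refine absurd h'.1 ?_
    rw [ancestor_eq_of_mem hx hx' hj.symm]
    exact h.2 j (by omega)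
  · exact eq_of_mem_box_zero hx hx' hl
  · obtain ⟨j, hj⟩ := Int.le.dest hl.le
    refine absurd h.1 ?_
    rw [ancestor_eq_of_mem hx' hx hj.symm]
    exact h'.2 j (by omega)

lemma IsMaximalCube.pairwise_disjoint {G : GridCube d → Prop} :
    Pairwise (Function.onFun Disjoint fun P : {P // IsMaximalCube G P} => box v 0 P.1) := by
  intro P P' hne
  refine Set.disjoint_left.2 fun x hx hx' => hne ?_
  exact Subtype.ext (P.2.eq P'.2 hx hx')

lemma box_one_eq_biUnion (P : GridCube d) :
    box v 1 P = ⋃ n ∈ Finset.Icc (P.2 - 1) (P.2 + 1), box v 0 (P.1, n) := by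
  ext x
  simp only [Set.mem_iUnion, mem_box_zero, Finset.mem_Icc, exists_prop, Pi.le_def]
  constructor
  · intro h
    refine ⟨_, ⟨fun i => ?_, fun i => ?_⟩, rfl⟩ <;>
    · have := h i
      rw [abs_le] at this
      simp
      omega
  · rintro ⟨n, ⟨h1, h2⟩, rfl⟩ i
    have := h1 i
    have := h2 i
    simp at *
    rw [abs_le]
    omega

lemma card_Icc_index (n : Fin d → ℤ) : (Finset.Icc (n - 1) (n + 1)).card = 3 ^ d := by
  rw [Pi.card_Icc]
  have : ∀ i, (Finset.Icc ((n - 1) i) ((n + 1) i)).card = 3 := fun i => by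
    simp only [Pi.sub_apply, Pi.add_apply, Pi.one_apply, Int.card_Icc]
    omega
  rw [Finset.prod_congr rfl fun i _ => this i]
  simp

/-- The constant in the stopping condition. -/
def heavyConst (d N : ℕ) : ℝ := 2 * (N + 1) * 7 ^ d

lemma heavyConst_pos (d N : ℕ) : 0 < heavyConst d N := by unfold heavyConst; positivity

/-! ### Heavy cubes and the Whitney cubes of their dilated union -/

section Stopping

variable {ι : Type} [Fintype ι] (v) (ν : ι → Measure (Space d)) (t : ι → ℝ)

/-- One of the measures is large on `P`. -/
def IsHeavy (P : GridCube d) : Prop :=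
  ∃ i, ENNReal.ofReal (heavyConst d (Fintype.card ι) * t i * vol d P.1) < ν i (box v 0 P)

/-- The union of the dilates of the heavy cubes. -/
def heavySet : Set (Space d) := ⋃ (P : GridCube d) (_ : IsHeavy v ν t P), box v 3 P

/-- The stopping cubes: a Whitney decomposition of the heavy set. -/
def stoppingCubes : Set (GridCube d) :=
  {P | IsMaximalCube (fun P => box v 2 P ⊆ heavySet v ν t) P}

variable {v ν t} {K : ℤ}

lemma IsHeavy.level_lt (ht : ∀ i, 0 < t i)
    (hν : ∀ i, ν i Set.univ ≤ ENNReal.ofReal (t i * vol d K)) {P : GridCube d}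
    (h : IsHeavy v ν t P) : P.1 < K := by
  obtain ⟨i, hi⟩ := h
  have h1 := hi.trans_le ((measure_mono (Set.subset_univ _)).trans (hν i))
  rw [ENNReal.ofReal_lt_ofReal_iff_of_nonneg (by
    have := vol_pos d P.1; have := ht i; have := heavyConst_pos d (Fintype.card ι); positivity)] at h1
  have hC : 1 ≤ heavyConst d (Fintype.card ι) := by
    unfold heavyConst
    have : (1 : ℝ) ≤ 7 ^ d := one_le_pow₀ (by norm_num)
    have h0 : (0 : ℝ) ≤ Fintype.card ι := by positivity
    nlinarith
  refine lt_of_vol_lt (d := d) ?_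
  have h3 : t i * vol d P.1 ≤ heavyConst d (Fintype.card ι) * t i * vol d P.1 := by
    have := mul_pos (ht i) (vol_pos d P.1)
    nlinarith
  exact lt_of_mul_lt_mul_left (h3.trans_lt h1) (ht i).le

lemma box_three_subset_ancestor (P : GridCube d) (j : ℕ) : box v 3 P ⊆ box v 3 (ancestor j P) := by
  intro x hx
  induction j with
  | zero => rwa [ancestor_zero]
  | succ j ih =>
    rw [← ancestor_ancestor]
    intro i
    have := ih i
    simp only [ancestor, Nat.cast_one, pow_one] at *
    rw [gridIndex_succ]
    rw [abs_le] at *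
    constructor <;> omega

/-- This is the weak-type estimate for the maximal function. Every heavy cube lies in a maximal one,
and dilates of nested cubes are nested. The maximal cubes are disjoint, so their masses add up to at
most the total mass, and the dilate by 3 costs a factor `7^d`. -/
lemma volume_heavySet_le (ht : ∀ i, 0 < t i)
    (hν : ∀ i, ν i Set.univ ≤ ENNReal.ofReal (t i * vol d K)) :
    volume (heavySet v ν t) ≤ ENNReal.ofReal (vol d K / 2) := by
  classical
  have hmax : heavySet v ν t ⊆
      ⋃ P : {P : GridCube d // IsMaximalCube (IsHeavy v ν t) P}, box v 3 P.1 := by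
    refine Set.iUnion₂_subset fun P hP => ?_
    obtain ⟨j, hj⟩ := exists_isMaximalCube (fun P hP => hP.level_lt ht hν) hP
    exact (box_three_subset_ancestor P j).trans
      (Set.subset_iUnion (fun P : {P : GridCube d // IsMaximalCube (IsHeavy v ν t) P} => box v 3 P.1) ⟨_, hj⟩)
  set C := heavyConst d (Fintype.card ι) with hC
  have hCpos : 0 < C := heavyConst_pos _ _
  have h1 : ∀ P : {P : GridCube d // IsMaximalCube (IsHeavy v ν t) P},
      volume (box v 3 P.1) ≤ ∑ i, ENNReal.ofReal (7 ^ d / (C * t i)) * ν i (box v 0 P.1) := by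
    rintro ⟨P, hP⟩
    obtain ⟨i, hi⟩ := hP.1
    refine le_trans ?_ (Finset.single_le_sum (f := fun i => ENNReal.ofReal (7 ^ d / (C * t i)) *
      ν i (box v 0 P)) (fun _ _ => zero_le) (Finset.mem_univ i))
    refine le_trans ?_ (mul_le_mul_right hi.le _)
    rw [← ENNReal.ofReal_mul (by have := ht i; positivity)]
    have := volume_box (v := v) 3 P
    rw [Nat.cast_ofNat] at this
    rw [this]
    refine ENNReal.ofReal_le_ofReal (le_of_eq ?_)
    have := ht i
    push_cast
    field_simp
    norm_num
    rw [hC]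
    ring
  calc volume (heavySet v ν t)
      ≤ ∑' P : {P : GridCube d // IsMaximalCube (IsHeavy v ν t) P}, volume (box v 3 P.1) :=
        (measure_mono hmax).trans (measure_iUnion_le _)
    _ ≤ ∑' P : {P : GridCube d // IsMaximalCube (IsHeavy v ν t) P},
          ∑ i, ENNReal.ofReal (7 ^ d / (C * t i)) * ν i (box v 0 P.1) := ENNReal.tsum_le_tsum h1
    _ = ∑ i, ENNReal.ofReal (7 ^ d / (C * t i)) *
          ∑' P : {P : GridCube d // IsMaximalCube (IsHeavy v ν t) P}, ν i (box v 0 P.1) := by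
        rw [Summable.tsum_finsetSum (fun _ _ => ENNReal.summable)]
        simp_rw [ENNReal.tsum_mul_left]
    _ ≤ ∑ i, ENNReal.ofReal (7 ^ d / (C * t i)) * ENNReal.ofReal (t i * vol d K) := by
        refine Finset.sum_le_sum fun i _ => mul_le_mul_right ?_ _
        rw [← measure_iUnion IsMaximalCube.pairwise_disjoint (fun P => measurableSet_box_zero _)]
        exact (measure_mono (Set.subset_univ _)).trans (hν i)
    _ = ∑ _i : ι, ENNReal.ofReal (7 ^ d / C * vol d K) := by
        refine Finset.sum_congr rfl fun i _ => ?_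
        have := ht i
        rw [← ENNReal.ofReal_mul (by positivity)]
        congr 1
        field_simp
    _ ≤ ENNReal.ofReal (vol d K / 2) := by
        have := vol_pos d K
        rw [Finset.sum_const, Finset.card_univ, nsmul_eq_mul, ← ENNReal.ofReal_natCast,
          ← ENNReal.ofReal_mul (by positivity)]
        refine ENNReal.ofReal_le_ofReal ?_
        -- With `N` measures and the constant `2(N+1)7^d` the total is `N/(N+1)` times half the
        -- volume. Using `N+1` keeps the constant positive when `N = 0`.
        have e : (Fintype.card ι : ℝ) * (7 ^ d / C * vol d K)
            = (Fintype.card ι / (Fintype.card ι + 1)) * (vol d K / 2) := by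
          rw [hC, heavyConst]; field_simp
        rw [e]
        have : (Fintype.card ι / (Fintype.card ι + 1) : ℝ) ≤ 1 := by
          rw [div_le_one (by positivity)]; linarith
        nlinarith

/-- The doubling constant of the stopping collection. -/
def stopConst (d N : ℕ) : ℝ := 3 ^ d * heavyConst d N

lemma stopConst_pos (d N : ℕ) : 0 < stopConst d N :=
  mul_pos (by positivity) (heavyConst_pos _ _)

lemma measure_box_one_le {P : GridCube d}
    (hy : ∀ n ∈ Finset.Icc (P.2 - 1) (P.2 + 1), ¬ IsHeavy v ν t (P.1, n)) (i : ι) :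
    ν i (box v 1 P) ≤ ENNReal.ofReal (stopConst d (Fintype.card ι) * t i * vol d P.1) := by
  rw [box_one_eq_biUnion]
  refine (measure_biUnion_finset_le _ _).trans ?_
  refine (Finset.sum_le_sum (g := fun _ => ENNReal.ofReal (heavyConst d (Fintype.card ι) * t i * vol d P.1))
    fun n hn => ?_).trans (le_of_eq ?_)
  · by_contra! h
    exact hy n hn ⟨i, h⟩
  · rw [Finset.sum_const, card_Icc_index, nsmul_eq_mul, ← ENNReal.ofReal_natCast,
      ← ENNReal.ofReal_mul (by positivity), stopConst]
    push_cast
    congr 1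
    ring

/-- A grid cube inside a set of volume at most `vol d K / 2` is smaller than a cube of level `K`. -/
lemma stoppingCubes_level_lt (ht : ∀ i, 0 < t i)
    (hν : ∀ i, ν i Set.univ ≤ ENNReal.ofReal (t i * vol d K)) {P : GridCube d}
    (hP : box v 2 P ⊆ heavySet v ν t) : P.1 < K := by
  have h1 := (measure_mono ((box_mono (a := 0) (b := 2) (by norm_num) P).trans hP)).trans (volume_heavySet_le ht hν)
  rw [volume_box_zero, ENNReal.ofReal_le_ofReal_iff (by have := vol_pos d K; positivity)] at h1
  have := vol_pos d K
  exact lt_of_vol_lt (d := d) (by linarith)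

lemma exists_stoppingCube (ht : ∀ i, 0 < t i)
    (hν : ∀ i, ν i Set.univ ≤ ENNReal.ofReal (t i * vol d K)) {P : GridCube d} {x : Space d}
    (hP : box v 2 P ⊆ heavySet v ν t) (hx : x ∈ box v 0 P) :
    ∃ P' ∈ stoppingCubes v ν t, x ∈ box v 0 P' := by
  obtain ⟨j, hj⟩ := exists_isMaximalCube (G := fun P => box v 2 P ⊆ heavySet v ν t)
    (fun P hP => stoppingCubes_level_lt ht hν hP) hP
  exact ⟨_, hj, mem_ancestor hx j⟩

/-- The cube one level below `P` that contains `y` is itself a candidate: its double neighbourhood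
is a single neighbourhood of `y` at the level of `P`, hence lies in the double neighbourhood of `P`.
-/
lemma stoppingCubes_cover (ht : ∀ i, 0 < t i)
    (hν : ∀ i, ν i Set.univ ≤ ENNReal.ofReal (t i * vol d K)) {P : GridCube d}
    (hP : P ∈ stoppingCubes v ν t) {x y : Space d} (hx : x ∈ box v 0 P) (h : Near v 1 P.1 x y) :
    ∃ P' ∈ stoppingCubes v ν t, y ∈ box v 0 P' := by
  refine exists_stoppingCube ht hν (P := cubeAt v (P.1 - 1) y) (fun z hz => hP.1 ?_) (mem_cubeAt _ _)
  rw [mem_box_iff_near hx]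
  exact (Near.lt_level hz (by simp [cubeAt])).trans h.symm

/-- If `P'` were two or more levels below `P`, the double neighbourhood of its parent would still
fit inside that of `P`, against the maximality of `P'`. -/
lemma stoppingCubes_comparable {P P' : GridCube d} (hP : P ∈ stoppingCubes v ν t)
    (hP' : P' ∈ stoppingCubes v ν t) {x y : Space d} (hx : x ∈ box v 0 P) (hy : y ∈ box v 0 P')
    (h : Near v 1 P.1 x y) : P.1 ≤ P'.1 + 1 := by
  by_contra! hlt
  refine hP'.2 1 one_pos fun z hz => hP.1 ?_
  rw [mem_box_iff_near hx]
  rw [mem_box_iff_near (mem_ancestor hy 1)] at hz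
  exact (Near.lt_level hz (by simpa [ancestor] using hlt)).trans h.symm

/-- The parent of a stopping cube fails the inclusion, so its double neighbourhood contains a point
outside the heavy set. At each level above `P` this point is within 2 of `x`, hence within 3 = 2 + 1
of every neighbour of the cube at `x`. None of these neighbours can then be heavy; this is why the
heavy set uses dilates by 3. -/
lemma measure_box_one_le_of_mem_stoppingCubes {P : GridCube d}
    (hP : P ∈ stoppingCubes v ν t) {x : Space d} (hx : x ∈ box v 0 P) {s : ℤ} (hs : P.1 + 1 ≤ s)
    (i : ι) :
    ν i (box v 1 (cubeAt v s x)) ≤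
      ENNReal.ofReal (stopConst d (Fintype.card ι) * t i * vol d s) := by
  have hnot := hP.2 1 one_pos
  obtain ⟨y, hy, hyE⟩ := Set.not_subset.1 hnot
  rw [mem_box_iff_near (mem_ancestor hx 1)] at hy
  have hy' : Near v 2 s y x := by
    rcases hs.eq_or_lt with rfl | hlt
    · exact hy
    · exact (Near.lt_level hy hlt).mono (by norm_num)
  refine measure_box_one_le (P := cubeAt v s x) (fun n hn hheavy => hyE ?_) i
  refine Set.mem_iUnion₂.2 ⟨_, hheavy, fun l => ?_⟩
  rw [Finset.mem_Icc, Pi.le_def, Pi.le_def] at hn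
  have h1 := hn.1 l
  have h2 := hn.2 l
  have h3 := hy' l
  simp [cubeAt] at h1 h2
  rw [abs_le] at *
  constructor <;> simp only [cubeAt] <;> omega

/-- A heavy neighbour of the cube at `x` would have a dilate that contains the double neighbourhood
of the cube at `x` one level down, and `x` would be covered by a stopping cube. In contrast to
points of stopping cubes, the bound holds here at every scale, which lets the Lebesgue
differentiation theorem act. -/
lemma measure_box_one_le_of_notMem (ht : ∀ i, 0 < t i)
    (hν : ∀ i, ν i Set.univ ≤ ENNReal.ofReal (t i * vol d K)) {x : Space d}
    (hx : ∀ P ∈ stoppingCubes v ν t, x ∉ box v 0 P) (s : ℤ) (i : ι) :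
    ν i (box v 1 (cubeAt v s x)) ≤
      ENNReal.ofReal (stopConst d (Fintype.card ι) * t i * vol d s) := by
  refine measure_box_one_le (P := cubeAt v s x) (fun n hn hheavy => ?_) i
  have key : box v 2 (cubeAt v (s - 1) x) ⊆ heavySet v ν t := by
    intro z hz
    refine Set.mem_iUnion₂.2 ⟨_, hheavy, fun l => ?_⟩
    have hz' : Near v 1 s z x := Near.lt_level hz (by simp [cubeAt])
    rw [Finset.mem_Icc, Pi.le_def, Pi.le_def] at hn
    have h1 := hn.1 l
    have h2 := hn.2 l
    have h3 := hz' l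
    simp [cubeAt] at h1 h2
    rw [abs_le] at *
    constructor <;> simp only [cubeAt] <;> omega
  obtain ⟨P, hP, hxP⟩ := exists_stoppingCube ht hν key (mem_cubeAt _ _)
  exact hx P hP hxP

lemma tsum_volume_stoppingCubes_le (ht : ∀ i, 0 < t i)
    (hν : ∀ i, ν i Set.univ ≤ ENNReal.ofReal (t i * vol d K)) :
    ∑' P : stoppingCubes v ν t, volume (box v 0 P.1) ≤ ENNReal.ofReal (vol d K / 2) := by
  have := measure_iUnion (μ := volume) (IsMaximalCube.pairwise_disjoint (v := v)
    (G := fun P => box v 2 P ⊆ heavySet v ν t)) (fun P => measurableSet_box_zero _)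
  refine this.symm.le.trans ?_
  refine (measure_mono (Set.iUnion_subset fun P => ?_)).trans (volume_heavySet_le (v := v) ht hν)
  exact (box_mono (a := 0) (b := 2) (by norm_num) _).trans P.2.1

end Stopping

/-! ### Lebesgue differentiation along grid boxes -/

/-- The volume of the unit ball of `ℝ^d`. -/
def ballVol (d : ℕ) : ℝ := (volume (Metric.closedBall (0 : Space d) 1)).toReal

lemma ballVol_pos (d : ℕ) : 0 < ballVol d :=
  ENNReal.toReal_pos (Metric.measure_closedBall_pos _ _ one_pos).ne' measure_closedBall_lt_top.ne

/-- A bound for the averages of `f` over all neighbourhoods of `x` bounds `f x`. -/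
lemma ae_norm_le_of_average_le {f : Space d → ℂ} (hf : Integrable f) {c : ℝ} (hc : 0 ≤ c) :
    ∀ᵐ x, (∀ k : ℤ, ∫⁻ y in box v 1 (cubeAt v k x), ‖f y‖ₑ ≤ ENNReal.ofReal (c * vol d k)) →
      ‖f x‖ ≤ c / ballVol d := by
  have h := IsUnifLocDoublingMeasure.ae_tendsto_average (μ := (volume : Measure (Space d)))
    hf.norm.locallyIntegrable 1
  filter_upwards [h] with x hx hk
  have hlim := hx (l := atTop) (fun _ : ℕ => x) (fun n => (2 : ℝ) ^ (-(n : ℤ))) (by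
    rw [tendsto_nhdsWithin_iff]
    refine ⟨?_, Eventually.of_forall fun n => by simp⟩
    have := tendsto_pow_atTop_nhds_zero_of_lt_one (r := (1 / 2 : ℝ)) (by norm_num) (by norm_num)
    refine this.congr fun n => ?_
    simp) (Eventually.of_forall fun n => by
      refine Metric.mem_closedBall_self ?_; positivity)
  refine le_of_tendsto hlim (Eventually.of_forall fun n => ?_)
  set k : ℤ := -(n : ℤ)
  -- The ball of radius `2^k` lies in the tripled grid cube at `x`, and its volume is `ballVol d`
  -- times that of one grid cube; hence the quotient in the conclusion.
  have hsub : Metric.closedBall x ((2 : ℝ) ^ k) ⊆ box v 1 (cubeAt v k x) := fun y hy =>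
    near_of_norm_sub_le (by rwa [← dist_eq_norm])
  have hvolball : (volume (Metric.closedBall x ((2 : ℝ) ^ k))).toReal = vol d k * ballVol d := by
    rw [Measure.addHaar_closedBall' _ _ (by positivity), ENNReal.toReal_mul,
      ENNReal.toReal_ofReal (by positivity)]
    simp [vol, ballVol]
  have hle : ∫⁻ y in Metric.closedBall x ((2 : ℝ) ^ k), ‖f y‖ₑ ≤ ENNReal.ofReal (c * vol d k) :=
    (lintegral_mono_set hsub).trans (hk k)
  have hpos : 0 < vol d k * ballVol d := mul_pos (vol_pos _ _) (ballVol_pos _)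
  rw [setAverage_eq, Measure.real, hvolball, integral_norm_eq_lintegral_enorm hf.1.restrict,
    smul_eq_mul]
  have hcc := ENNReal.toReal_le_of_le_ofReal (mul_nonneg hc (vol_pos d k).le) hle
  rw [inv_mul_le_iff₀ hpos]
  refine hcc.trans (le_of_eq ?_)
  have := ballVol_pos d
  field_simp

end

section

variable {d m : ℕ} {v : Space d}

/-! ### Families of multilinear forms with truncated kernels -/

/-- Bounded measurable functions that vanish outside `Ω`. -/
structure Adm (Ω : Set (Space d)) (h : Space d → ℂ) : Prop where
  meas : Measurable h
  bdd : ∃ M : ℝ, ∀ x, ‖h x‖ ≤ M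
  supp : ∀ x, x ∉ Ω → h x = 0

/-- Kernels `κ s` at scale `2^s`. -/
structure ScaleKernel (v : Space d) (ε A : ℝ) (κ : ℤ → (Fin (m + 1) → Space d) → ℂ) : Prop where
  size : ∀ s x, ‖κ s x‖ ≤ A / vol d s ^ m
  holder : ∀ s j x y, ‖κ s x - κ s (Function.update x j y)‖ ≤
    A / vol d s ^ m * (‖x j - y‖ / (2 : ℝ) ^ s) ^ ε
  near : ∀ s x, κ s x ≠ 0 → ∀ i j, Near v 1 s (x i) (x j)

/-- A family of multilinear forms `Λ s` whose increments are given by the kernels `κ s` and such that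
`Λ s` is bounded and only sees points at mutual distance at most `2^s`. -/
structure FormFamily (v : Space d) (Ω : Set (Space d)) (B : ℝ)
    (κ : ℤ → (Fin (m + 1) → Space d) → ℂ) (Λ : ℤ → (Fin (m + 1) → Space d → ℂ) → ℂ) : Prop where
  map_add : ∀ s h j u w, (∀ i, Adm Ω (h i)) → Adm Ω u → Adm Ω w →
    Λ s (Function.update h j (u + w)) =
      Λ s (Function.update h j u) + Λ s (Function.update h j w)
  bound : ∀ s h (P : GridCube d) (N : Fin (m + 1) → ℝ), (∀ i, Adm Ω (h i)) →
    (∀ i, ∀ x, x ∉ box v 1 P → h i x = 0) → (∀ i, 0 ≤ N i) → (∀ i, ∀ᵐ x, ‖h i x‖ ≤ N i) →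
    ‖Λ s h‖ ≤ B * vol d P.1 * ∏ i, N i
  map_local : ∀ s h j, (∀ i, Adm Ω (h i)) →
    (∀ x y, h 0 x ≠ 0 → h j y ≠ 0 → ¬ Near v 1 s x y) → Λ s h = 0
  cont : ∀ s (ι : Type) (l : Filter ι) [l.IsCountablyGenerated]
    (H : ι → Fin (m + 1) → Space d → ℂ) (h : Fin (m + 1) → Space d → ℂ) (M : ℝ),
    (∀ n i, Adm Ω (H n i)) → (∀ i, Adm Ω (h i)) → (∀ n i x, ‖H n i x‖ ≤ M) →
    (∀ i x, Tendsto (fun n => H n i x) l (𝓝 (h i x))) → Tendsto (fun n => Λ s (H n)) l (𝓝 (Λ s h))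
  diff : ∀ s h, (∀ i, Adm Ω (h i)) →
    Λ (s + 1) h - Λ s h = ∫ x : Fin (m + 1) → Space d, κ s x * ∏ i, h i (x i)

/-! ### Bounded measurable functions supported in a fixed set -/

section Adm

variable {Ω : Set (Space d)} {h u w : Space d → ℂ}

lemma Adm.zero : Adm Ω (0 : Space d → ℂ) :=
  ⟨measurable_const, ⟨0, fun _ => by simp⟩, fun _ _ => rfl⟩

lemma Adm.add (hu : Adm Ω u) (hw : Adm Ω w) : Adm Ω (u + w) := by
  obtain ⟨M, hM⟩ := hu.bdd
  obtain ⟨M', hM'⟩ := hw.bdd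
  exact ⟨hu.meas.add hw.meas,
    ⟨M + M', fun x => (norm_add_le _ _).trans (add_le_add (hM x) (hM' x))⟩,
    fun x hx => by simp [hu.supp x hx, hw.supp x hx]⟩

lemma Adm.neg (hu : Adm Ω u) : Adm Ω (-u) := by
  obtain ⟨M, hM⟩ := hu.bdd
  exact ⟨hu.meas.neg, ⟨M, fun x => by simpa using hM x⟩, fun x hx => by simp [hu.supp x hx]⟩

lemma Adm.sub (hu : Adm Ω u) (hw : Adm Ω w) : Adm Ω (u - w) := by
  rw [sub_eq_add_neg]; exact hu.add hw.neg

lemma Adm.sum {ι : Type*} (F : Finset ι) {b : ι → Space d → ℂ} (hb : ∀ i, Adm Ω (b i)) :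
    Adm Ω (∑ i ∈ F, b i) := by
  classical
  induction F using Finset.induction_on with
  | empty => simpa using Adm.zero
  | insert i F hi ih => rw [Finset.sum_insert hi]; exact (hb i).add ih

lemma Adm.indicator (hu : Adm Ω u) {Z : Set (Space d)} (hZ : MeasurableSet Z) :
    Adm Ω (Z.indicator u) := by
  obtain ⟨M, hM⟩ := hu.bdd
  exact ⟨hu.meas.indicator hZ, ⟨M, fun x => (norm_indicator_le_norm_self u x).trans (hM x)⟩,
    fun x hx => Set.indicator_apply_eq_zero.2 fun _ => hu.supp x hx⟩

lemma Adm.integrable (hu : Adm Ω u) (hΩ : volume Ω ≠ ∞) : Integrable u := by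
  obtain ⟨M, hM⟩ := hu.bdd
  have hs : Function.support u ⊆ toMeasurable volume Ω := fun x hx =>
    subset_toMeasurable _ _ (by by_contra hx'; exact hx (hu.supp x hx'))
  rw [← integrableOn_iff_integrable_of_support_subset hs]
  exact Measure.integrableOn_of_bounded (M := M) (by rwa [measure_toMeasurable])
    hu.meas.aestronglyMeasurable (Eventually.of_forall hM)

lemma adm_update {h : Fin (m + 1) → Space d → ℂ} (hh : ∀ i, Adm Ω (h i)) (j : Fin (m + 1))
    (hu : Adm Ω u) (i : Fin (m + 1)) : Adm Ω (Function.update h j u i) := by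
  rcases eq_or_ne i j with rfl | hij
  · simpa using hu
  · simpa [hij] using hh i

lemma map_sum_of_map_add {Y : (Space d → ℂ) → ℂ}
    (hY : ∀ u w, Adm Ω u → Adm Ω w → Y (u + w) = Y u + Y w) {ι : Type*} (F : Finset ι)
    {b : ι → Space d → ℂ} (hb : ∀ i, Adm Ω (b i)) : Y (∑ i ∈ F, b i) = ∑ i ∈ F, Y (b i) := by
  classical
  induction F using Finset.induction_on with
  | empty =>
    have := hY 0 0 Adm.zero Adm.zero
    simpa using this
  | insert i F hi ih =>
    rw [Finset.sum_insert hi, Finset.sum_insert hi, hY _ _ (hb i) (Adm.sum F hb), ih]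

end Adm

/-! ### Continuity of the scale kernels and integrals against them -/

section Kernel

variable {ε A : ℝ} {κ : ℤ → (Fin (m + 1) → Space d) → ℂ}

/-- The variables are exchanged one at a time, so separate moduli of continuity add up to a joint
one. -/
lemma norm_sub_piecewise_le {n : ℕ} {F : (Fin n → Space d) → ℂ} {ω : Space d → Space d → ℝ}
    (hF : ∀ j x y, ‖F x - F (Function.update x j y)‖ ≤ ω (x j) y) (x y : Fin n → Space d)
    (S : Finset (Fin n)) : ‖F x - F (S.piecewise y x)‖ ≤ ∑ j ∈ S, ω (x j) (y j) := by
  induction S using Finset.induction_on with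
  | empty => simp
  | insert j S hj ih =>
    rw [Finset.sum_insert hj, Finset.piecewise_insert, add_comm]
    refine (norm_sub_le_norm_sub_add_norm_sub _ (F (S.piecewise y x)) _).trans (add_le_add ih ?_)
    have := hF j (S.piecewise y x) (y j)
    rwa [Finset.piecewise_eq_of_notMem _ _ _ hj] at this

lemma ScaleKernel.continuous (hκ : ScaleKernel v ε A κ) (hε : 0 < ε) (s : ℤ) :
    Continuous (κ s) := by
  rw [continuous_iff_continuousAt]
  intro x
  rw [ContinuousAt, tendsto_iff_norm_sub_tendsto_zero]
  have hlim : Tendsto (fun y : Fin (m + 1) → Space d =>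
      ∑ j, A / vol d s ^ m * (‖x j - y j‖ / (2 : ℝ) ^ s) ^ ε) (𝓝 x) (𝓝 0) := by
    have : Continuous (fun y : Fin (m + 1) → Space d =>
      ∑ j, A / vol d s ^ m * (‖x j - y j‖ / (2 : ℝ) ^ s) ^ ε) := by
      refine continuous_finsetSum _ fun j _ => continuous_const.mul ?_
      refine Continuous.rpow_const (by fun_prop) fun _ => Or.inr hε.le
    refine (this.tendsto x).trans (le_of_eq ?_)
    simp [Real.zero_rpow hε.ne']
  refine squeeze_zero (fun _ => norm_nonneg _) (fun y => ?_) hlim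
  have := norm_sub_piecewise_le (F := κ s)
    (ω := fun a b => A / vol d s ^ m * (‖a - b‖ / (2 : ℝ) ^ s) ^ ε)
    (fun j x y => hκ.holder s j x y) x y Finset.univ
  rwa [Finset.piecewise_univ, norm_sub_rev] at this

lemma ScaleKernel.nonneg (hκ : ScaleKernel v ε A κ) : 0 ≤ A := by
  have h := (norm_nonneg _).trans (hκ.size 0 0)
  have hv := pow_pos (vol_pos d 0) m
  by_contra! hA
  exact absurd h (not_le.2 (div_neg_of_neg_of_pos hA hv))

/-- The estimate of an integral against a product by the product of the integrals. -/
lemma norm_integral_mul_prod_le {κ : (Fin (m + 1) → Space d) → ℂ} {u : Fin (m + 1) → Space d → ℂ}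
    {Z L : Set (Space d)} (hZ : MeasurableSet Z) (hu : ∀ i, Integrable (u i)) {a : ℝ} (ha : 0 ≤ a)
    {j : Fin (m + 1)} (huj : ∀ x, x ∉ L → u j x = 0) (hsize : ∀ x, x j ∈ L → ‖κ x‖ ≤ a)
    (hsupp : ∀ x, x j ∈ L → κ x ≠ 0 → ∀ i, x i ∈ Z) :
    ‖∫ x : Fin (m + 1) → Space d, κ x * ∏ i, u i (x i)‖ ≤ a * ∏ i, ∫ x in Z, ‖u i x‖ := by
  have h1 : ∏ i, ∫ x in Z, ‖u i x‖ =
      ∫ x : Fin (m + 1) → Space d, ∏ i, Z.indicator (fun y => ‖u i y‖) (x i) := by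
    rw [integral_fintype_prod_volume_eq_prod (fun i => Z.indicator (fun y => ‖u i y‖))]
    exact Finset.prod_congr rfl fun i _ => (integral_indicator hZ).symm
  rw [h1, ← integral_const_mul]
  refine norm_integral_le_of_norm_le ?_ (Eventually.of_forall fun x => ?_)
  · refine Integrable.const_mul ?_ _
    exact Integrable.fintype_prod (μ := fun _ => volume) (f := fun i => Z.indicator (fun y => ‖u i y‖))
      fun i => (hu i).norm.indicator hZ
  · have hnn : 0 ≤ a * ∏ i, Z.indicator (fun y => ‖u i y‖) (x i) :=
      mul_nonneg ha (Finset.prod_nonneg fun i _ => Set.indicator_nonneg (fun _ _ => norm_nonneg _) _)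
    by_cases hj : x j ∈ L
    · by_cases hk : κ x = 0
      · simpa [hk] using hnn
      · rw [norm_mul, norm_prod]
        have := hsupp x hj hk
        refine mul_le_mul (hsize x hj) (le_of_eq ?_) (Finset.prod_nonneg fun _ _ => norm_nonneg _) ha
        exact Finset.prod_congr rfl fun i _ => by rw [Set.indicator_of_mem (this i)]
    · rw [Finset.prod_eq_zero (Finset.mem_univ j) (huj _ hj)]
      simpa using hnn

lemma integrable_mul_prod {κ : (Fin (m + 1) → Space d) → ℂ} (hκ : AEStronglyMeasurable κ) {a : ℝ}
    (ha : ∀ x, ‖κ x‖ ≤ a) {u : Fin (m + 1) → Space d → ℂ} (hu : ∀ i, Integrable (u i)) :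
    Integrable fun x : Fin (m + 1) → Space d => κ x * ∏ i, u i (x i) := by
  refine Integrable.bdd_mul (c := a) ?_ hκ (Eventually.of_forall ha)
  exact Integrable.fintype_prod (μ := fun _ => volume) (f := u) hu

/-- Integrals against a kernel that does not depend on the `j`-th variable. -/
lemma integral_update_mul_prod_eq_zero (κ : (Fin (m + 1) → Space d) → ℂ)
    (u : Fin (m + 1) → Space d → ℂ) (j : Fin (m + 1)) (c : Space d) (hu : ∫ x, u j x = 0) :
    ∫ x : Fin (m + 1) → Space d, κ (Function.update x j c) * ∏ i, u i (x i) = 0 := by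
  -- With the `j`-th variable split off, the kernel depends only on the others, so Fubini factors
  -- out the integral of `u j`.
  have hmp := volume_preserving_piFinSuccAbove (fun _ : Fin (m + 1) => Space d) j
  rw [← hmp.symm.integral_comp (MeasurableEquiv.measurableEmbedding _)]
  have : ∀ z : Space d × (Fin m → Space d),
      κ (Function.update ((MeasurableEquiv.piFinSuccAbove (fun _ : Fin (m + 1) => Space d) j).symm z) j c) *
        ∏ i, u i ((MeasurableEquiv.piFinSuccAbove (fun _ : Fin (m + 1) => Space d) j).symm z i) =
      u j z.1 * (κ (j.insertNth c z.2) * ∏ i, u (j.succAbove i) (z.2 i)) := by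
    rintro ⟨a, y⟩
    have e : (MeasurableEquiv.piFinSuccAbove (fun _ : Fin (m + 1) => Space d) j).symm (a, y)
        = j.insertNth a y := rfl
    rw [e, Fin.prod_univ_succAbove _ j]
    simp only [Fin.insertNth_apply_same, Fin.insertNth_apply_succAbove, Fin.update_insertNth]
    ring
  simp_rw [this]
  rw [Measure.volume_eq_prod, integral_prod_mul (fun x => u j x)
    (fun y : Fin m → Space d => κ (j.insertNth c y) * ∏ i, u (j.succAbove i) (y i)), hu, zero_mul]

end Kernel

/-! ### Consequences of locality -/

section Form

variable {Ω : Set (Space d)} {B ε A : ℝ} {κ : ℤ → (Fin (m + 1) → Space d) → ℂ}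
  {Λ : ℤ → (Fin (m + 1) → Space d → ℂ) → ℂ}

/-- A form that only sees nearby points does not change when the other functions are cut off near the
support of the first one. -/
lemma FormFamily.restrict (hΛ : FormFamily v Ω B κ Λ) {s : ℤ} {h : Fin (m + 1) → Space d → ℂ}
    (hh : ∀ i, Adm Ω (h i)) {Z : Set (Space d)} (hZ : MeasurableSet Z)
    (hnear : ∀ x y, h 0 x ≠ 0 → y ∉ Z → ¬ Near v 1 s x y) :
    Λ s h = Λ s (fun i => if i = 0 then h 0 else Z.indicator (h i)) := by
  -- The slots are cut off one after the other. Slot 0 stays untouched because locality compares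
  -- every other slot with it.
  have key : ∀ S : Finset (Fin (m + 1)), 0 ∉ S →
      Λ s h = Λ s (S.piecewise (fun i => Z.indicator (h i)) h) := by
    intro S
    induction S using Finset.induction_on with
    | empty => simp
    | insert j S hj ih =>
      intro h0
      rw [Finset.mem_insert, not_or] at h0
      rw [ih h0.2, Finset.piecewise_insert]
      set h' := S.piecewise (fun i => Z.indicator (h i)) h with hh'
      have hadm : ∀ i, Adm Ω (h' i) := fun i => by
        by_cases hi : i ∈ S
        · rw [hh', Finset.piecewise_eq_of_mem _ _ _ hi]; exact (hh i).indicator hZ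
        · rw [hh', Finset.piecewise_eq_of_notMem _ _ _ hi]; exact hh i
      have e0 : h' 0 = h 0 := Finset.piecewise_eq_of_notMem _ _ _ h0.2
      have ej : h' j = h j := Finset.piecewise_eq_of_notMem _ _ _ hj
      have e1 : h' = Function.update h' j (Z.indicator (h j) + Zᶜ.indicator (h j)) := by
        rw [Set.indicator_self_add_compl, ← ej, Function.update_eq_self]
      conv_lhs => rw [e1]
      rw [hΛ.map_add s h' j _ _ hadm ((hh j).indicator hZ) ((hh j).indicator hZ.compl)]
      rw [hΛ.map_local s (Function.update h' j (Zᶜ.indicator (h j))) j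
        (adm_update hadm j ((hh j).indicator hZ.compl)), add_zero]
      intro x y hx hy
      rw [Function.update_of_ne h0.1, e0] at hx
      rw [Function.update_self] at hy
      exact hnear x y hx (Set.mem_of_indicator_ne_zero hy)
  rw [key (Finset.univ.erase 0) (by simp)]
  congr 1
  ext i : 1
  by_cases hi : i = 0
  · subst hi; simp
  · simp [hi]

/-- The restriction of the first function to a grid cube. -/
def cut (v : Space d) (L : GridCube d) (h : Fin (m + 1) → Space d → ℂ) : Fin (m + 1) → Space d → ℂ :=
  fun i => if i = 0 then (box v 0 L).indicator (h i) else h i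

/-- The restriction of the first function to a grid cube, and of the others to its neighbours. -/
def loc (v : Space d) (L : GridCube d) (h : Fin (m + 1) → Space d → ℂ) : Fin (m + 1) → Space d → ℂ :=
  fun i => if i = 0 then (box v 0 L).indicator (h i) else (box v 1 L).indicator (h i)

lemma adm_cut {h : Fin (m + 1) → Space d → ℂ} (hh : ∀ i, Adm Ω (h i)) (L : GridCube d)
    (i : Fin (m + 1)) : Adm Ω (cut v L h i) := by
  unfold cut; split_ifs
  exacts [(hh i).indicator (measurableSet_box_zero L), hh i]

lemma adm_loc {h : Fin (m + 1) → Space d → ℂ} (hh : ∀ i, Adm Ω (h i)) (L : GridCube d)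
    (i : Fin (m + 1)) : Adm Ω (loc v L h i) := by
  unfold loc; split_ifs
  exacts [(hh i).indicator (measurableSet_box_zero L), (hh i).indicator (measurableSet_box_one L)]

lemma norm_cut_le (h : Fin (m + 1) → Space d → ℂ) (L : GridCube d) (i : Fin (m + 1)) (x : Space d) :
    ‖cut v L h i x‖ ≤ ‖h i x‖ := by
  unfold cut; split_ifs
  exacts [norm_indicator_le_norm_self _ _, le_rfl]

lemma norm_loc_le (h : Fin (m + 1) → Space d → ℂ) (L : GridCube d) (i : Fin (m + 1)) (x : Space d) :
    ‖loc v L h i x‖ ≤ ‖h i x‖ := by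
  unfold loc; split_ifs <;> exact norm_indicator_le_norm_self _ _

lemma loc_eq_zero (h : Fin (m + 1) → Space d → ℂ) (L : GridCube d) (i : Fin (m + 1)) {x : Space d}
    (hx : x ∉ box v 1 L) : loc v L h i x = 0 := by
  unfold loc; split_ifs
  · exact Set.indicator_of_notMem (fun h' => hx (box_mono (by norm_num) L h')) _
  · exact Set.indicator_of_notMem hx _

lemma cut_update (h : Fin (m + 1) → Space d → ℂ) (L : GridCube d) (j : Fin (m + 1))
    (u : Space d → ℂ) : cut v L (Function.update h j u) =
      Function.update (cut v L h) j (if j = 0 then (box v 0 L).indicator u else u) := by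
  ext i : 1
  rcases eq_or_ne i j with rfl | hij
  · simp [cut]
  · simp [cut, hij]

/-- The two restrictions serve different ends. Cutting only the first function makes the pieces at a
common level add up to the whole form, while the recursion needs every function localized near `L`.
At the level of `L` the form does not see the difference. -/
lemma FormFamily.cut_eq_loc (hΛ : FormFamily v Ω B κ Λ) {h : Fin (m + 1) → Space d → ℂ}
    (hh : ∀ i, Adm Ω (h i)) (L : GridCube d) : Λ L.1 (cut v L h) = Λ L.1 (loc v L h) := by
  rw [hΛ.restrict (adm_cut hh L) (measurableSet_box_one (v := v) L)]
  · congr 1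
    ext i : 1
    by_cases hi : i = 0 <;> simp [cut, loc, hi]
  · intro x y hx hy hxy
    have hx : x ∈ box v 0 L := by
      simp only [cut, if_true] at hx
      exact Set.mem_of_indicator_ne_zero hx
    exact hy ((mem_box_iff_near hx).2 hxy.symm)

lemma FormFamily.norm_cut_le (hΛ : FormFamily v Ω B κ Λ) {h : Fin (m + 1) → Space d → ℂ}
    (hh : ∀ i, Adm Ω (h i)) (L : GridCube d) {N : Fin (m + 1) → ℝ} (hN : ∀ i, 0 ≤ N i)
    (hb : ∀ i, ∀ᵐ x, ‖h i x‖ ≤ N i) : ‖Λ L.1 (cut v L h)‖ ≤ B * vol d L.1 * ∏ i, N i := by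
  rw [hΛ.cut_eq_loc hh]
  exact hΛ.bound _ _ L N (adm_loc hh L) (fun i x hx => loc_eq_zero h L i hx) hN
    (fun i => (hb i).mono fun x hx => (norm_loc_le h L i x).trans hx)

lemma FormFamily.map_zero_slot (hΛ : FormFamily v Ω B κ Λ) {s : ℤ} {h : Fin (m + 1) → Space d → ℂ}
    (hh : ∀ i, Adm Ω (h i)) (h0 : h 0 = 0) : Λ s h = 0 :=
  hΛ.map_local s h 0 hh fun x _ hx => absurd (by rw [h0]; rfl) hx

lemma norm_sub_le_sum_kernel (hΛ : FormFamily v Ω B κ Λ) {h : Fin (m + 1) → Space d → ℂ}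
    (hh : ∀ i, Adm Ω (h i)) (s : ℤ) (n : ℕ) :
    ‖Λ (s + n) h - Λ s h‖ ≤
      ∑ i ∈ Finset.range n, ‖∫ x : Fin (m + 1) → Space d, κ (s + i) x * ∏ l, h l (x l)‖ := by
  induction n with
  | zero => simp
  | succ n ih =>
    rw [Finset.sum_range_succ, ← hΛ.diff _ h hh, add_comm (Finset.sum _ _)]
    refine (norm_sub_le_norm_sub_add_norm_sub _ (Λ (s + n) h) _).trans (add_le_add (le_of_eq ?_) ih)
    push_cast
    rw [add_assoc]

end Form

end

section

variable {d m : ℕ} {v : Space d}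

/-! ### One step of the stopping time argument -/

/-- A collection of disjoint grid cubes of Whitney type below level `K`. -/
structure IsStopping (v : Space d) (K : ℤ) (W : Set (GridCube d)) : Prop where
  level_lt : ∀ P ∈ W, P.1 < K
  eq_of_mem : ∀ P ∈ W, ∀ P' ∈ W, ∀ x, x ∈ box v 0 P → x ∈ box v 0 P' → P = P'
  cover : ∀ P ∈ W, ∀ x y, x ∈ box v 0 P → Near v 1 P.1 x y → ∃ P' ∈ W, y ∈ box v 0 P'
  comparable : ∀ P ∈ W, ∀ P' ∈ W, ∀ x y, x ∈ box v 0 P → y ∈ box v 0 P' → Near v 1 P.1 x y →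
    P.1 ≤ P'.1 + 1
  summable : Summable fun P : W => vol d P.1.1
  tsum_le : ∑' P : W, vol d P.1.1 ≤ vol d K / 2

/-- The part of the form at the top level that is not seen by the stopping cubes. -/
def remainder (v : Space d) (Λ : ℤ → (Fin (m + 1) → Space d → ℂ) → ℂ) (K : ℤ)
    (W : Set (GridCube d)) (h : Fin (m + 1) → Space d → ℂ) : ℂ :=
  Λ K h - ∑' L : W, Λ L.1.1 (cut v L.1 h)

variable {Ω : Set (Space d)} {B ε A : ℝ} {κ : ℤ → (Fin (m + 1) → Space d) → ℂ}
  {Λ : ℤ → (Fin (m + 1) → Space d → ℂ) → ℂ} {K : ℤ} {W : Set (GridCube d)}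

lemma exists_common_bound {h : Fin (m + 1) → Space d → ℂ} (hh : ∀ i, Adm Ω (h i)) :
    ∃ M : ℝ, 0 ≤ M ∧ ∀ i x, ‖h i x‖ ≤ M := by
  choose M hM using fun i => (hh i).bdd
  refine ⟨∑ i, |M i|, Finset.sum_nonneg fun _ _ => abs_nonneg _, fun i x => ?_⟩
  exact ((hM i x).trans (le_abs_self _)).trans
    (Finset.single_le_sum (f := fun i => |M i|) (fun _ _ => abs_nonneg _) (Finset.mem_univ i))

lemma IsStopping.pairwise_disjoint (hW : IsStopping v K W) :
    Pairwise (Function.onFun Disjoint fun P : W => box v 0 P.1) := fun P P' hne =>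
  Set.disjoint_left.2 fun x hx hx' => hne (Subtype.ext (hW.eq_of_mem _ P.2 _ P'.2 x hx hx'))

lemma summable_cut (hΛ : FormFamily v Ω B κ Λ) (hW : IsStopping v K W)
    {h : Fin (m + 1) → Space d → ℂ} (hh : ∀ i, Adm Ω (h i)) :
    Summable fun L : W => Λ L.1.1 (cut v L.1 h) := by
  obtain ⟨M, hM0, hM⟩ := exists_common_bound hh
  refine Summable.of_norm_bounded (g := fun L : W => B * vol d L.1.1 * ∏ _i : Fin (m + 1), M)
    ((hW.summable.mul_left B).mul_right _) fun L => ?_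
  exact hΛ.norm_cut_le hh L.1 (fun _ => hM0) fun i => Eventually.of_forall (hM i)

lemma remainder_add (hΛ : FormFamily v Ω B κ Λ) (hW : IsStopping v K W)
    {h : Fin (m + 1) → Space d → ℂ} (hh : ∀ i, Adm Ω (h i)) (j : Fin (m + 1)) {u w : Space d → ℂ}
    (hu : Adm Ω u) (hw : Adm Ω w) :
    remainder v Λ K W (Function.update h j (u + w)) =
      remainder v Λ K W (Function.update h j u) + remainder v Λ K W (Function.update h j w) := by
  unfold remainder
  rw [hΛ.map_add K h j u w hh hu hw]
  have : ∀ L : W, Λ L.1.1 (cut v L.1 (Function.update h j (u + w))) =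
      Λ L.1.1 (cut v L.1 (Function.update h j u)) + Λ L.1.1 (cut v L.1 (Function.update h j w)) := by
    intro L
    simp_rw [cut_update]
    split_ifs
    · rw [Set.indicator_add']
      exact hΛ.map_add _ _ j _ _ (adm_cut hh _) (hu.indicator (measurableSet_box_zero _))
        (hw.indicator (measurableSet_box_zero _))
    · exact hΛ.map_add _ _ j _ _ (adm_cut hh _) hu hw
  simp_rw [this]
  rw [(summable_cut hΛ hW (adm_update hh j hu)).tsum_add (summable_cut hΛ hW (adm_update hh j hw))]
  ring

lemma tendsto_remainder (hΛ : FormFamily v Ω B κ Λ) (hW : IsStopping v K W) {ι : Type}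
    {l : Filter ι} [l.IsCountablyGenerated] {H : ι → Fin (m + 1) → Space d → ℂ}
    {h : Fin (m + 1) → Space d → ℂ} {M : ℝ} (hM0 : 0 ≤ M) (hH : ∀ n i, Adm Ω (H n i))
    (hh : ∀ i, Adm Ω (h i)) (hM : ∀ n i x, ‖H n i x‖ ≤ M)
    (hlim : ∀ i x, Tendsto (fun n => H n i x) l (𝓝 (h i x))) :
    Tendsto (fun n => remainder v Λ K W (H n)) l (𝓝 (remainder v Λ K W h)) := by
  refine (hΛ.cont K ι l H h M hH hh hM hlim).sub ?_
  refine tendsto_tsum_of_dominated_convergence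
    (bound := fun L : W => B * vol d L.1.1 * ∏ _i : Fin (m + 1), M)
    ((hW.summable.mul_left B).mul_right _) (fun L => ?_) (Eventually.of_forall fun n L => ?_)
  · refine hΛ.cont _ ι l _ _ M (fun n => adm_cut (hH n) _) (adm_cut hh _)
      (fun n i x => (norm_cut_le _ _ _ _).trans (hM n i x)) fun i x => ?_
    unfold cut
    split_ifs
    · by_cases hx : x ∈ box v 0 L.1
      · simpa [hx] using hlim i x
      · simp [hx, tendsto_const_nhds]
    · exact hlim i x
  · exact hΛ.norm_cut_le (hH n) L.1 (fun _ => hM0) fun i => Eventually.of_forall (hM n i)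

/-- The remainder for bounded functions. -/
lemma norm_remainder_le_of_bounded (hB : 0 ≤ B) (hΛ : FormFamily v Ω B κ Λ) (hW : IsStopping v K W)
    {Q : GridCube d} (hQ : Q.1 = K) {h : Fin (m + 1) → Space d → ℂ} (hh : ∀ i, Adm Ω (h i))
    (hsupp : ∀ i, ∀ x, x ∉ box v 1 Q → h i x = 0) {N : Fin (m + 1) → ℝ} (hN : ∀ i, 0 ≤ N i)
    (hb : ∀ i, ∀ᵐ x, ‖h i x‖ ≤ N i) :
    ‖remainder v Λ K W h‖ ≤ 2 * B * vol d K * ∏ i, N i := by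
  have hp : 0 ≤ ∏ i, N i := Finset.prod_nonneg fun i _ => hN i
  have h1 := hΛ.bound K h Q N hh hsupp hN hb
  have h2 : ‖∑' L : W, Λ L.1.1 (cut v L.1 h)‖ ≤ ∑' L : W, B * vol d L.1.1 * ∏ i, N i :=
    tsum_of_norm_bounded ((hW.summable.mul_left B).mul_right _).hasSum fun L =>
      hΛ.norm_cut_le hh L.1 hN hb
  rw [tsum_mul_right, tsum_mul_left] at h2
  -- The stopping cubes have total volume at most that of the top cube, so their forms obey the same
  -- bound as the top form; hence the factor 2.
  have h3 : B * (∑' L : W, vol d L.1.1) * ∏ i, N i ≤ B * vol d K * ∏ i, N i := by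
    have := hW.tsum_le
    have := vol_pos d K
    gcongr
    linarith
  rw [hQ] at h1
  calc ‖remainder v Λ K W h‖ ≤ _ := norm_sub_le _ _
    _ ≤ B * vol d K * ∏ i, N i + B * vol d K * ∏ i, N i := add_le_add h1 (h2.trans h3)
    _ = _ := by ring

/-- The product of integrals of functions one of which lives on `L'` and the others have bounded
averages. -/
lemma prod_setIntegral_le {u : Fin (m + 1) → Space d → ℂ} (hu : ∀ i, Integrable (u i))
    {j : Fin (m + 1)} {c : Fin (m + 1) → ℝ} {Z : Set (Space d)} {V : ℝ}
    (hc : ∀ i, i ≠ j → ∫ x in Z, ‖u i x‖ ≤ c i * V) :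
    ∏ i, ∫ x in Z, ‖u i x‖ ≤ V ^ m * ((∫ x, ‖u j x‖) * ∏ i ∈ Finset.univ.erase j, c i) := by
  rw [← Finset.mul_prod_erase _ _ (Finset.mem_univ j)]
  have h1 : ∫ x in Z, ‖u j x‖ ≤ ∫ x, ‖u j x‖ :=
    setIntegral_le_integral (hu j).norm (Eventually.of_forall fun _ => norm_nonneg _)
  have h2 : ∏ i ∈ Finset.univ.erase j, ∫ x in Z, ‖u i x‖ ≤ ∏ i ∈ Finset.univ.erase j, (c i * V) :=
    Finset.prod_le_prod (fun i _ => integral_nonneg fun _ => norm_nonneg _)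
      fun i hi => hc i (Finset.ne_of_mem_erase hi)
  calc _ ≤ (∫ x, ‖u j x‖) * ∏ i ∈ Finset.univ.erase j, (c i * V) := by
        refine mul_le_mul h1 h2 (Finset.prod_nonneg fun i _ => ?_) ?_ <;>
        exact integral_nonneg fun _ => norm_nonneg _
    _ = _ := by
        rw [Finset.prod_mul_distrib, Finset.prod_const, Finset.card_erase_of_mem (Finset.mem_univ j)]
        simp
        ring

/-- Truncations at nearby levels differ little on the pieces of the first function. -/
lemma norm_sub_cut_le (hΩ : volume Ω ≠ ∞) (hκ : ScaleKernel v ε A κ)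
    {u : Fin (m + 1) → Space d → ℂ} (hu : ∀ i, Adm Ω (u i)) {j : Fin (m + 1)}
    {L' : GridCube d} (huj : ∀ x, x ∉ box v 0 L' → u j x = 0) 
    {y₀ : Space d} (hy₀ : y₀ ∈ box v 0 L') (hΛ : FormFamily v Ω B κ Λ) (hW : IsStopping v K W) (hL' : L' ∈ W)
    {L : GridCube d} (hL : L ∈ W) :
    ‖Λ L'.1 (cut v L u) - Λ L.1 (cut v L u)‖ ≤ A / vol d (L'.1 - 1) ^ m *
      ∏ i, ∫ x in box v 1 (cubeAt v (L'.1 + 1) y₀), ‖cut v L u i x‖ := by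
  have hA := hκ.nonneg
  have hV := vol_pos d (L'.1 - 1)
  have hint := fun i => (adm_cut (v := v) hu L i).integrable hΩ
  have hcutj : ∀ x, x ∉ box v 0 L' → cut v L u j x = 0 := fun x hx => by
    have := norm_cut_le (v := v) u L j x
    rw [huj x hx, norm_zero] at this
    exact norm_le_zero_iff.1 this
  have hcut0 : ∀ x, cut v L u 0 x ≠ 0 → x ∈ box v 0 L := fun x hx => by
    simp only [cut, if_true] at hx
    exact Set.mem_of_indicator_ne_zero hx
  -- Only the levels of `L'` and one below occur, so the size bound is taken at the smaller scale.
  -- Kernel support confines every variable to the tripled cube one level above `L'`, the first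
  -- level at which averages will be controlled.
  have hker : ∀ s, L'.1 - 1 ≤ s → s ≤ L'.1 →
      ‖∫ x : Fin (m + 1) → Space d, κ s x * ∏ i, cut v L u i (x i)‖ ≤ A / vol d (L'.1 - 1) ^ m *
      ∏ i, ∫ x in box v 1 (cubeAt v (L'.1 + 1) y₀), ‖cut v L u i x‖ := by
    intro s hs hs'
    refine norm_integral_mul_prod_le (L := box v 0 L') (measurableSet_box_one _) hint
      (by positivity) hcutj (fun x _ => (hκ.size s x).trans ?_) fun x hx hk i => ?_
    · have := vol_mono (d := d) hs
      gcongr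
    · have h1 := (hκ.near s x hk i j).le_level hs'
      have h2 := near_zero_of_mem hx hy₀
      exact Near.le_level (k' := L'.1 + 1) ((h1.trans h2).mono (by norm_num)) (by omega)
  -- If `L` and `L'` are close at the coarser of their levels, the Whitney property leaves a level
  -- difference of at most one, so the difference of the forms is zero or plus or minus one kernel
  -- integral. Otherwise both forms vanish by locality.
  by_cases hnear : ∃ x y, x ∈ box v 0 L ∧ y ∈ box v 0 L' ∧ Near v 1 (max L.1 L'.1) x y
  · obtain ⟨x, y, hx, hy, hxy⟩ := hnear
    have hcmp : L.1 ≤ L'.1 + 1 ∧ L'.1 ≤ L.1 + 1 := by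
      rcases le_total L.1 L'.1 with hl | hl
      · rw [max_eq_right hl] at hxy
        exact ⟨by omega, hW.comparable L' hL' L hL y x hy hx hxy.symm⟩
      · rw [max_eq_left hl] at hxy
        exact ⟨hW.comparable L hL L' hL' x y hx hy hxy, by omega⟩
    have h3 : L.1 = L'.1 ∨ L'.1 = L.1 + 1 ∨ L.1 = L'.1 + 1 := by omega
    rcases h3 with h3 | h3 | h3
    · rw [h3, sub_self, norm_zero]
      exact (norm_nonneg _).trans (hker L'.1 (by omega) le_rfl)
    · rw [h3, hΛ.diff _ _ (adm_cut hu L)]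
      have := hker L.1 (by omega) (by omega)
      rwa [h3] at this
    · rw [norm_sub_rev, h3, hΛ.diff _ _ (adm_cut hu L)]
      exact hker L'.1 (by omega) le_rfl
  · push Not at hnear
    have hz : ∀ s, s ≤ max L.1 L'.1 → Λ s (cut v L u) = 0 := fun s hs =>
      hΛ.map_local s _ j (adm_cut hu L) fun x y hx hy hxy =>
        hnear x y (hcut0 x hx) (by by_contra h; exact hy (hcutj y h)) (hxy.le_level hs)
    rw [hz _ (le_max_right _ _), hz _ (le_max_left _ _), sub_zero, norm_zero]
    exact (norm_nonneg _).trans (hker L'.1 (by omega) le_rfl)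

/-- A form at the level of `L'` splits into the pieces of the first function. -/
lemma hasSum_cut {u : Fin (m + 1) → Space d → ℂ} (hu : ∀ i, Adm Ω (u i)) {j : Fin (m + 1)}
    {L' : GridCube d} (huj : ∀ x, x ∉ box v 0 L' → u j x = 0) (hΛ : FormFamily v Ω B κ Λ) (hW : IsStopping v K W) (hL' : L' ∈ W) :
    HasSum (fun L : W => Λ L'.1 (cut v L.1 u)) (Λ L'.1 u) := by
  classical
  set T : Set (Space d) := ⋃ L : W, box v 0 L.1 with hT
  have hTm : MeasurableSet T := MeasurableSet.iUnion fun L => measurableSet_box_zero _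
  -- Everything within reach of `L'` at its own level lies in some stopping cube, so the part of the
  -- first function outside the stopping cubes is invisible.
  have e1 : Λ L'.1 u = Λ L'.1 (Function.update u 0 (T.indicator (u 0))) := by
    have e2 : u = Function.update u 0 (T.indicator (u 0) + Tᶜ.indicator (u 0)) := by
      rw [Set.indicator_self_add_compl, Function.update_eq_self]
    conv_lhs => rw [e2]
    rw [hΛ.map_add _ _ _ _ _ hu ((hu 0).indicator hTm) ((hu 0).indicator hTm.compl)]
    rw [hΛ.map_local _ (Function.update u 0 (Tᶜ.indicator (u 0))) j
      (adm_update hu 0 ((hu 0).indicator hTm.compl)), add_zero]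
    intro x y hx hy hxy
    rw [Function.update_self] at hx
    have hxT := Set.mem_of_indicator_ne_zero hx
    have hy' : y ∈ box v 0 L' := by
      by_contra h
      refine hy ?_
      rcases eq_or_ne j 0 with rfl | hj
      · rw [Function.update_self]
        exact Set.indicator_apply_eq_zero.2 fun _ => huj y h
      · rw [Function.update_of_ne hj, huj y h]
    obtain ⟨P', hP', hxP'⟩ := hW.cover L' hL' y x hy' hxy.symm
    exact hxT (Set.mem_iUnion.2 ⟨⟨P', hP'⟩, hxP'⟩)
  obtain ⟨M, hM0, hM⟩ := exists_common_bound hu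
  have hcut : ∀ L, cut v L u = Function.update u 0 ((box v 0 L).indicator (u 0)) := fun L => by
    ext i : 1
    rcases eq_or_ne i 0 with rfl | hi
    · simp [cut]
    · simp [cut, hi]
  have hadm : ∀ L : W, Adm Ω ((box v 0 L.1).indicator (u 0)) := fun L =>
    (hu 0).indicator (measurableSet_box_zero _)
  have hsum : ∀ F : Finset W, ∑ L ∈ F, Λ L'.1 (cut v L.1 u) =
      Λ L'.1 (Function.update u 0 (∑ L ∈ F, (box v 0 L.1).indicator (u 0))) := by
    intro F
    rw [map_sum_of_map_add (Y := fun w => Λ L'.1 (Function.update u 0 w))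
      (fun a b ha hb => hΛ.map_add _ _ _ _ _ hu ha hb) F hadm]
    simp_rw [hcut]
  have hpt : ∀ (F : Finset W) x, (∑ L ∈ F, (box v 0 L.1).indicator (u 0)) x =
      (⋃ L ∈ F, box v 0 L.1).indicator (u 0) x := by
    intro F x
    rw [Finset.sum_apply, Finset.indicator_biUnion_apply]
    exact fun a _ b _ hab => hW.pairwise_disjoint hab
  rw [HasSum, e1]
  simp_rw [hsum]
  -- The stopping cubes form a countable set, so the filter of their finite subsets is countably
  -- generated and dominated convergence applies to the partial sums.
  refine hΛ.cont _ _ _ _ _ M (fun F => adm_update hu 0 (Adm.sum F hadm))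
    (adm_update hu 0 ((hu 0).indicator hTm)) (fun F i x => ?_) fun i x => ?_
  · rcases eq_or_ne i 0 with rfl | hi
    · rw [Function.update_self, hpt]
      exact (norm_indicator_le_norm_self _ _).trans (hM 0 x)
    · rw [Function.update_of_ne hi]; exact hM i x
  · rcases eq_or_ne i 0 with rfl | hi
    · simp only [Function.update_self, hpt]
      exact (tendsto_indicator_biUnion_finset (fun L : W => box v 0 L.1) (u 0) x).mono_right
        (pure_le_nhds _)
    · simp only [Function.update_of_ne hi]
      exact tendsto_const_nhds

/-! ### A function of mean zero on one stopping cube -/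

section Bad

variable (hΩ : volume Ω ≠ ∞) (hε : 0 < ε) (hε1 : ε ≤ 1) (hκ : ScaleKernel v ε A κ)
  {u : Fin (m + 1) → Space d → ℂ} (hu : ∀ i, Adm Ω (u i)) {j : Fin (m + 1)} {L' : GridCube d}
  (huj : ∀ x, x ∉ box v 0 L' → u j x = 0) {y₀ : Space d} (hy₀ : y₀ ∈ box v 0 L')
  {c : Fin (m + 1) → ℝ}
  (hc : ∀ i, i ≠ j → ∀ s, L'.1 + 1 ≤ s → ∫ x in box v 1 (cubeAt v s y₀), ‖u i x‖ ≤ c i * vol d s)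

include hΩ hε hε1 hκ hu huj hy₀ hc

/-- Pairing with a function of mean zero at a larger scale. -/
lemma norm_integral_kernel_le_of_mean_zero (hmean : ∫ x, u j x = 0) (n : ℕ) :
    ‖∫ x : Fin (m + 1) → Space d, κ (L'.1 + n) x * ∏ i, u i (x i)‖ ≤
      A * (d + 1) * (2 ^ d) ^ m * ((2 : ℝ) ^ (-ε)) ^ n *
        ((∫ x, ‖u j x‖) * ∏ i ∈ Finset.univ.erase j, c i) := by
  set s := L'.1 + (n : ℤ) with hs
  have hA := hκ.nonneg
  have hV := vol_pos d s
  have hint := fun i => (hu i).integrable hΩ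
  have hcont := hκ.continuous hε s
  -- Mean zero permits subtracting the kernel with its `j`-th variable frozen at `y₀`; the Hölder
  -- bound then gains a power of the ratio between the size of `L'` and `2^s`.
  have e1 : ∫ x : Fin (m + 1) → Space d, κ s x * ∏ i, u i (x i) =
      ∫ x : Fin (m + 1) → Space d, (κ s x - κ s (Function.update x j y₀)) * ∏ i, u i (x i) := by
    simp_rw [sub_mul]
    rw [integral_sub, integral_update_mul_prod_eq_zero (κ s) u j y₀ hmean, sub_zero]
    · exact integrable_mul_prod hcont.aestronglyMeasurable (hκ.size s) hint
    · refine integrable_mul_prod (Continuous.aestronglyMeasurable ?_) (fun x => hκ.size s _) hint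
      exact hcont.comp (continuous_id.update j continuous_const)
  have hsm : ∀ a b, a ∈ box v 0 L' → b ∈ box v 0 L' → Near v 0 s a b := fun a b ha hb =>
    (near_zero_of_mem ha hb).zero_le_level (by omega)
  -- The variables are already near `y₀` at level `s`, but averages are controlled only from level
  -- `L'.1 + 1` on and `n` may be 0. Going one level up costs the factor `(2^d)^m`.
  have hup : ∀ x, Near v 1 s x y₀ → x ∈ box v 1 (cubeAt v (s + 1) y₀) := fun x hx =>
    Near.le_level (k' := s + 1) hx (by omega)
  rw [e1]
  refine (norm_integral_mul_prod_le (Z := box v 1 (cubeAt v (s + 1) y₀)) (L := box v 0 L')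
    (measurableSet_box_one _) hint
    (a := A / vol d s ^ m * ((d + 1) * ((2 : ℝ) ^ (-ε)) ^ n)) (by positivity) huj
    (fun x hx => ?_) (fun x hx hk i => hup _ ?_)).trans ?_
  · refine (hκ.holder s j x y₀).trans ?_
    refine mul_le_mul_of_nonneg_left ?_ (by positivity)
    have h1 := norm_sub_le_of_near_zero (near_zero_of_mem hx hy₀)
    -- Using `d + 1` in place of `d` keeps the base at least 1, so its power with exponent `ε ≤ 1`
    -- can be replaced by the base itself.
    have h2 : ‖x j - y₀‖ / (2 : ℝ) ^ s ≤ (d + 1) * (2 : ℝ) ^ (-(n : ℤ)) := by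
      rw [div_le_iff₀ (by positivity), mul_assoc, ← zpow_add₀ (by norm_num)]
      refine h1.trans ?_
      have : -(n : ℤ) + s = L'.1 := by omega
      rw [this]
      gcongr
      linarith
    calc _ ≤ ((d + 1) * (2 : ℝ) ^ (-(n : ℤ))) ^ ε :=
          Real.rpow_le_rpow (by positivity) h2 hε.le
      _ = ((d : ℝ) + 1) ^ ε * ((2 : ℝ) ^ (-ε)) ^ n := by
          rw [Real.mul_rpow (by positivity) (by positivity), ← Real.rpow_intCast,
            ← Real.rpow_natCast, ← Real.rpow_mul (by norm_num), ← Real.rpow_mul (by norm_num)]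
          push_cast
          ring_nf
      _ ≤ (d + 1) * ((2 : ℝ) ^ (-ε)) ^ n := by
          gcongr
          exact (Real.rpow_le_rpow_of_exponent_le (by simp) hε1).trans_eq (Real.rpow_one _)
  · have hxy := hsm _ _ hx hy₀
    by_cases hk1 : κ s x = 0
    · have hk2 : κ s (Function.update x j y₀) ≠ 0 := by
        intro h0; rw [hk1, h0, sub_zero] at hk; exact hk rfl
      have := hκ.near s _ hk2 i j
      rcases eq_or_ne i j with rfl | hij
      · exact hxy.mono (by norm_num)
      · simpa [hij] using this
    · exact ((hκ.near s x hk1 i j).trans hxy).mono (by norm_num)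
  · have hprod := prod_setIntegral_le hint (j := j) (c := c)
      (Z := box v 1 (cubeAt v (s + 1) y₀)) (V := vol d (s + 1)) (fun i hi => hc i hi _ (by omega))
    refine (mul_le_mul_of_nonneg_left hprod (by positivity)).trans (le_of_eq ?_)
    have : vol d (s + 1) = 2 ^ d * vol d s := by simpa using vol_add (d := d) s 1
    rw [this, mul_pow]
    field_simp

/-- The remainder for functions one of which has mean zero and lives on a stopping cube. -/
lemma norm_remainder_le_of_mean_zero (hc0 : ∀ i, 0 ≤ c i) (hmean : ∫ x, u j x = 0)
    (hΛ : FormFamily v Ω B κ Λ) (hW : IsStopping v K W) (hL' : L' ∈ W) :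
    ‖remainder v Λ K W u‖ ≤ A * ((d + 1) * (2 ^ d) ^ m * (1 - (2 : ℝ) ^ (-ε))⁻¹ + (4 ^ d) ^ m) *
      ((∫ x, ‖u j x‖) * ∏ i ∈ Finset.univ.erase j, c i) := by
  have hA := hκ.nonneg
  have hint := fun i => (hu i).integrable hΩ
  set D := (∫ x, ‖u j x‖) * ∏ i ∈ Finset.univ.erase j, c i with hD
  have hD0 : 0 ≤ D := mul_nonneg (integral_nonneg fun _ => norm_nonneg _)
    (Finset.prod_nonneg fun i _ => hc0 i)
  have hr0 : (0 : ℝ) ≤ 2 ^ (-ε) := by positivity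
  have hr1 : (2 : ℝ) ^ (-ε) < 1 := Real.rpow_lt_one_of_one_lt_of_neg (by norm_num) (by linarith)
  obtain ⟨n, hn⟩ := Int.le.dest (hW.level_lt L' hL').le
  -- The scales between `L'` and the top: a geometric series with ratio `2^(-ε)`.
  have h1 : ‖Λ K u - Λ L'.1 u‖ ≤ A * ((d + 1) * (2 ^ d) ^ m * (1 - (2 : ℝ) ^ (-ε))⁻¹) * D := by
    rw [← hn]
    refine (norm_sub_le_sum_kernel hΛ hu L'.1 n).trans ?_
    refine (Finset.sum_le_sum fun i _ => norm_integral_kernel_le_of_mean_zero hΩ hε hε1 hκ hu huj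
      hy₀ hc hmean i).trans ?_
    rw [← Finset.sum_mul, ← Finset.mul_sum]
    have hgeo : ∑ i ∈ Finset.range n, ((2 : ℝ) ^ (-ε)) ^ i ≤ (1 - (2 : ℝ) ^ (-ε))⁻¹ := by
      rw [← tsum_geometric_of_lt_one hr0 hr1]
      exact (summable_geometric_of_lt_one hr0 hr1).sum_le_tsum _ fun i _ => by positivity
    refine mul_le_mul_of_nonneg_right ?_ hD0
    rw [mul_assoc A, mul_assoc A]
    gcongr
  -- At the level of `L'` the form splits over the pieces of the first function, and each piece is
  -- moved to the level of its own stopping cube.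
  have h2 : ‖Λ L'.1 u - ∑' L : W, Λ L.1.1 (cut v L.1 u)‖ ≤ A * (4 ^ d) ^ m * D := by
    have hs := hasSum_cut hu huj hΛ hW hL'
    rw [← hs.tsum_eq, ← hs.summable.tsum_sub (summable_cut hΛ hW hu)]
    set Z := box v 1 (cubeAt v (L'.1 + 1) y₀) with hZ
    have hZm : MeasurableSet Z := measurableSet_box_one _
    set R := ∏ i : Fin m, ∫ x in Z, ‖u i.succ x‖ with hR
    have hR0 : 0 ≤ R := Finset.prod_nonneg fun i _ => integral_nonneg fun _ => norm_nonneg _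
    have hV := vol_pos d (L'.1 - 1)
    -- Only slot 0 depends on `L`. The stopping cubes are disjoint, so summing over `L` gives back
    -- at most the integral of `u 0` over `Z`, with no loss from the number of cubes.
    have hterm : ∀ L : W, A / vol d (L'.1 - 1) ^ m * ∏ i, ∫ x in Z, ‖cut v L.1 u i x‖ =
        A / vol d (L'.1 - 1) ^ m * ((∫ x in box v 0 L.1, Z.indicator (fun x => ‖u 0 x‖) x) * R) := by
      intro L
      rw [Fin.prod_univ_succ]
      congr 2
      · simp only [cut, if_true]
        rw [setIntegral_indicator hZm, ← integral_indicator hZm, ← integral_indicator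
          ((measurableSet_box_zero L.1).inter hZm)]
        congr 1
        ext x
        by_cases hx : x ∈ Z <;> by_cases hx' : x ∈ box v 0 L.1 <;> simp [hx, hx']
    have hsumI : HasSum (fun L : W => ∫ x in box v 0 L.1, Z.indicator (fun x => ‖u 0 x‖) x)
        (∫ x in ⋃ L : W, box v 0 L.1, Z.indicator (fun x => ‖u 0 x‖) x) :=
      hasSum_integral_iUnion (fun L => measurableSet_box_zero _) hW.pairwise_disjoint
        ((hint 0).norm.indicator hZm).integrableOn
    refine (tsum_of_norm_bounded ((hsumI.mul_right R).mul_left (A / vol d (L'.1 - 1) ^ m))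
      fun L => (norm_sub_cut_le hΩ hκ hu huj hy₀ hΛ hW hL' L.2).trans_eq (hterm L)).trans ?_
    have hle : ∫ x in ⋃ L : W, box v 0 L.1, Z.indicator (fun x => ‖u 0 x‖) x ≤
        ∫ x in Z, ‖u 0 x‖ := by
      rw [← integral_indicator hZm]
      exact setIntegral_le_integral ((hint 0).norm.indicator hZm)
        (Eventually.of_forall fun x => Set.indicator_nonneg (fun _ _ => norm_nonneg _) x)
    have hprod := prod_setIntegral_le hint (j := j) (c := c)
      (Z := Z) (V := vol d (L'.1 + 1)) (fun i hi => hc i hi _ le_rfl)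
    rw [Fin.prod_univ_succ] at hprod
    calc _ ≤ A / vol d (L'.1 - 1) ^ m * (vol d (L'.1 + 1) ^ m * D) := by
          refine mul_le_mul_of_nonneg_left ?_ (by positivity)
          exact (mul_le_mul_of_nonneg_right hle hR0).trans hprod
      _ = _ := by
          have : vol d (L'.1 + 1) = 4 ^ d * vol d (L'.1 - 1) := by
            have := vol_add (d := d) (L'.1 - 1) 2
            norm_num at this
            rw [← this]; congr 1; ring
          rw [this, mul_pow]
          field_simp
  calc ‖remainder v Λ K W u‖ = ‖(Λ K u - Λ L'.1 u) + (Λ L'.1 u - ∑' L : W, Λ L.1.1 (cut v L.1 u))‖ := by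
        rw [remainder]; congr 1; ring
    _ ≤ _ := (norm_add_le _ _).trans (add_le_add h1 h2)
    _ = _ := by ring

end Bad

end

section

variable {d m : ℕ} {v : Space d}

/-! ### The Calderón–Zygmund decomposition and the sparse step -/

variable {Ω : Set (Space d)} {B ε A : ℝ} {κ : ℤ → (Fin (m + 1) → Space d) → ℂ}
  {Λ : ℤ → (Fin (m + 1) → Space d → ℂ) → ℂ} {K : ℤ} {W : Set (GridCube d)}

/-- The constant in the estimate for functions of mean zero. -/
def meanZeroConst (d m : ℕ) (ε : ℝ) : ℝ :=
  (d + 1) * (2 ^ d) ^ m * (1 - (2 : ℝ) ^ (-ε))⁻¹ + (4 ^ d) ^ m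

lemma meanZeroConst_nonneg (d m : ℕ) {ε : ℝ} (hε : 0 < ε) : 0 ≤ meanZeroConst d m ε := by
  have hr1 : (2 : ℝ) ^ (-ε) < 1 := Real.rpow_lt_one_of_one_lt_of_neg (by norm_num) (by linarith)
  have : 0 ≤ (1 - (2 : ℝ) ^ (-ε))⁻¹ := inv_nonneg.2 (by linarith)
  unfold meanZeroConst
  positivity

/-- The remainder is additive in slot `j` and continuous under bounded convergence. The estimate for
a single mean zero piece is linear in its `L^1` norm, so the pieces can be summed. -/
lemma norm_remainder_le_of_bad (hΩ : volume Ω ≠ ∞) (hε : 0 < ε) (hε1 : ε ≤ 1)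
    (hκ : ScaleKernel v ε A κ) (hΛ : FormFamily v Ω B κ Λ) (hW : IsStopping v K W)
    {u : Fin (m + 1) → Space d → ℂ} (hu : ∀ i, Adm Ω (u i)) (j : Fin (m + 1))
    {b : W → Space d → ℂ} (hb : ∀ L, Adm Ω (b L)) (hbs : ∀ L : W, ∀ x, x ∉ box v 0 L.1 → b L x = 0)
    (hmean : ∀ L, ∫ x, b L x = 0) {M : ℝ} (hM : ∀ (F : Finset W) x, ‖∑ L ∈ F, b L x‖ ≤ M)
    (hlim : ∀ x, HasSum (fun L => b L x) (u j x)) {S : ℝ}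
    (hS : ∀ F : Finset W, ∑ L ∈ F, ∫ x, ‖b L x‖ ≤ S) {c : Fin (m + 1) → ℝ} (hc0 : ∀ i, 0 ≤ c i)
    (hc : ∀ i, i ≠ j → ∀ L ∈ W, ∀ y ∈ box v 0 L, ∀ s, L.1 + 1 ≤ s →
      ∫ x in box v 1 (cubeAt v s y), ‖u i x‖ ≤ c i * vol d s) :
    ‖remainder v Λ K W u‖ ≤
      A * meanZeroConst d m ε * (S * ∏ i ∈ Finset.univ.erase j, c i) := by
  have hA := hκ.nonneg
  obtain ⟨M', hM'0, hM'⟩ := exists_common_bound hu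
  have hsum : ∀ F : Finset W, remainder v Λ K W (Function.update u j (∑ L ∈ F, b L)) =
      ∑ L ∈ F, remainder v Λ K W (Function.update u j (b L)) := fun F =>
    map_sum_of_map_add (Y := fun w => remainder v Λ K W (Function.update u j w))
      (fun a c ha hc => remainder_add hΛ hW hu j ha hc) F hb
  have hterm : ∀ L : W, ‖remainder v Λ K W (Function.update u j (b L))‖ ≤
      A * meanZeroConst d m ε * ((∫ x, ‖b L x‖) * ∏ i ∈ Finset.univ.erase j, c i) := by
    intro L
    obtain ⟨y₀, hy₀⟩ := box_zero_nonempty (v := v) L.1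
    have := norm_remainder_le_of_mean_zero hΩ hε hε1 hκ (u := Function.update u j (b L)) (j := j)
      (adm_update hu j (hb L)) (by simpa using hbs L) hy₀ (c := c)
      (fun i hi s hs => by rw [Function.update_of_ne hi]; exact hc i hi L L.2 y₀ hy₀ s hs)
      hc0 (by simpa using hmean L) hΛ hW L.2
    simpa [meanZeroConst] using this
  have htend : Tendsto (fun F : Finset W => remainder v Λ K W (Function.update u j (∑ L ∈ F, b L)))
      atTop (𝓝 (remainder v Λ K W u)) := by
    have hM0 : 0 ≤ max M M' := le_max_of_le_right hM'0
    refine tendsto_remainder hΛ hW hM0 (fun F => adm_update hu j (Adm.sum F hb)) hu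
      (fun F i x => ?_) fun i x => ?_
    · rcases eq_or_ne i j with rfl | hi
      · rw [Function.update_self, Finset.sum_apply]
        exact (hM F x).trans (le_max_left _ _)
      · rw [Function.update_of_ne hi]
        exact (hM' i x).trans (le_max_right _ _)
    · rcases eq_or_ne i j with rfl | hi
      · simp only [Function.update_self, Finset.sum_apply]
        exact hlim x
      · simp only [Function.update_of_ne hi]
        exact tendsto_const_nhds
  refine le_of_tendsto htend.norm (Eventually.of_forall fun F => ?_)
  rw [hsum]
  refine (norm_sum_le _ _).trans ((Finset.sum_le_sum fun L _ => hterm L).trans ?_)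
  rw [← Finset.mul_sum, ← Finset.sum_mul]
  have := meanZeroConst_nonneg d m hε
  have h2 : 0 ≤ ∏ i ∈ Finset.univ.erase j, c i := Finset.prod_nonneg fun i _ => hc0 i
  have := hS F
  gcongr

/-- Replacing the functions `g i + b i` by `g i` one after the other. -/
lemma norm_remainder_le_add (hΛ : FormFamily v Ω B κ Λ) (hW : IsStopping v K W)
    {h g b : Fin (m + 1) → Space d → ℂ} (hg : ∀ i, Adm Ω (g i)) (hb : ∀ i, Adm Ω (b i))
    (hgb : ∀ i, h i = g i + b i) {D : ℝ}
    (hD : ∀ (u : Fin (m + 1) → Space d → ℂ) (j : Fin (m + 1)), u j = b j →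
      (∀ i, i ≠ j → u i = g i ∨ u i = h i) → ‖remainder v Λ K W u‖ ≤ D) :
    ‖remainder v Λ K W h‖ ≤ ‖remainder v Λ K W g‖ + (m + 1) * D := by
  have hh : ∀ i, Adm Ω (h i) := fun i => by rw [hgb]; exact (hg i).add (hb i)
  -- After `n` replacements the slots below `n` hold `g` and the rest still hold `h`; the next error
  -- has `b` in slot `n`. This is why `D` must control mixed tuples.
  have key : ∀ n : ℕ, n ≤ m + 1 → ‖remainder v Λ K W h‖ ≤
      ‖remainder v Λ K W (fun i => if (i : ℕ) < n then g i else h i)‖ + n * D := by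
    intro n
    induction n with
    | zero => intro _; simp
    | succ n ih =>
      intro hn
      refine (ih (by omega)).trans ?_
      set p : Fin (m + 1) → Space d → ℂ := fun i => if (i : ℕ) < n then g i else h i with hp
      have hpa : ∀ i, Adm Ω (p i) := fun i => by
        simp only [hp]; split_ifs
        exacts [hg i, hh i]
      set j : Fin (m + 1) := ⟨n, by omega⟩ with hj
      have e1 : p = Function.update p j (g j + b j) := by
        rw [← hgb, eq_comm, Function.update_eq_self_iff]
        simp [hp, hj]
      have e2 : (fun i : Fin (m + 1) => if (i : ℕ) < n + 1 then g i else h i) =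
          Function.update p j (g j) := by
        ext i : 1
        rcases eq_or_ne i j with rfl | hi
        · simp [hj]
        · rw [Function.update_of_ne hi]
          have : (i : ℕ) ≠ n := fun h => hi (Fin.ext h)
          simp only [hp]
          congr 1
          simp only [eq_iff_iff]
          omega
      have h1 : ‖remainder v Λ K W p‖ ≤ ‖remainder v Λ K W (Function.update p j (g j))‖ + D := by
        conv_lhs => rw [e1]
        rw [remainder_add hΛ hW hpa j (hg j) (hb j)]
        refine (norm_add_le _ _).trans (add_le_add le_rfl (hD _ j (by simp) fun i hi => ?_))
        rw [Function.update_of_ne hi]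
        simp only [hp]
        split_ifs
        exacts [Or.inl rfl, Or.inr rfl]
      rw [e2]
      push_cast
      linarith
  have := key (m + 1) le_rfl
  have e : (fun i : Fin (m + 1) => if (i : ℕ) < m + 1 then g i else h i) = g := by
    ext i : 1
    rw [if_pos i.isLt]
  rw [e] at this
  push_cast at this
  exact this

/-- The average of `h` over a grid cube. -/
def cubeMean (v : Space d) (h : Space d → ℂ) (L : GridCube d) : ℂ :=
  (vol d L.1 : ℂ)⁻¹ * ∫ x in box v 0 L, h x

/-- The part of `h` on a grid cube that has mean zero. -/
def badPart (v : Space d) (h : Space d → ℂ) (L : GridCube d) : Space d → ℂ :=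
  (box v 0 L).indicator fun x => h x - cubeMean v h L

/-! ### Mean zero parts over the stopping cubes -/

section Decomposition

variable {h : Space d → ℂ}

lemma volume_real_box_zero (L : GridCube d) : volume.real (box v 0 L) = vol d L.1 := by
  rw [Measure.real, volume_box_zero, ENNReal.toReal_ofReal (vol_pos _ _).le]

lemma norm_cubeMean_le (L : GridCube d) :
    ‖cubeMean v h L‖ ≤ (vol d L.1)⁻¹ * ∫ x in box v 0 L, ‖h x‖ := by
  have := vol_pos d L.1
  rw [cubeMean, norm_mul, norm_inv, Complex.norm_real, Real.norm_of_nonneg this.le]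
  gcongr
  exact norm_integral_le_integral_norm _

lemma norm_cubeMean_le_of_bound {M : ℝ} (hM : ∀ x, ‖h x‖ ≤ M) (L : GridCube d) :
    ‖cubeMean v h L‖ ≤ M := by
  have hV := vol_pos d L.1
  rw [cubeMean, norm_mul, norm_inv, Complex.norm_real, Real.norm_of_nonneg hV.le,
    inv_mul_le_iff₀ hV]
  have := norm_setIntegral_le_of_norm_le_const (μ := volume) (s := box v 0 L) (f := h) (C := M)
    (by rw [volume_box_zero]; exact ENNReal.ofReal_lt_top) (fun x _ => hM x)
  rwa [volume_real_box_zero, mul_comm] at this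

lemma integrableOn_const_box (L : GridCube d) (c : ℂ) :
    IntegrableOn (fun _ : Space d => c) (box v 0 L) :=
  integrableOn_const (by rw [volume_box_zero]; exact ENNReal.ofReal_ne_top)

lemma integral_badPart (hi : Integrable h) (L : GridCube d) : ∫ x, badPart v h L x = 0 := by
  rw [badPart, integral_indicator (measurableSet_box_zero L),
    integral_sub hi.integrableOn (integrableOn_const_box L _), setIntegral_const,
    volume_real_box_zero, cubeMean]
  have : (vol d L.1 : ℂ) ≠ 0 := by exact_mod_cast (vol_pos d L.1).ne'
  rw [Complex.real_smul, mul_inv_cancel_left₀ this, sub_self]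

lemma integral_norm_badPart_le (hi : Integrable h) (L : GridCube d) :
    ∫ x, ‖badPart v h L x‖ ≤ 2 * ∫ x in box v 0 L, ‖h x‖ := by
  have hV := vol_pos d L.1
  have e : ∀ x, ‖badPart v h L x‖ = (box v 0 L).indicator (fun x => ‖h x - cubeMean v h L‖) x :=
    fun x => norm_indicator_eq_indicator_norm _ _
  simp_rw [e]
  rw [integral_indicator (measurableSet_box_zero L)]
  calc _ ≤ ∫ x in box v 0 L, (‖h x‖ + ‖cubeMean v h L‖) := by
        refine integral_mono_of_nonneg (Eventually.of_forall fun _ => norm_nonneg _) ?_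
          (Eventually.of_forall fun x => norm_sub_le _ _)
        exact hi.norm.integrableOn.add (integrableOn_const_box L _).norm
    _ = (∫ x in box v 0 L, ‖h x‖) + vol d L.1 * ‖cubeMean v h L‖ := by
        rw [integral_add hi.norm.integrableOn (integrableOn_const_box L _).norm, setIntegral_const,
          volume_real_box_zero, smul_eq_mul]
    _ ≤ (∫ x in box v 0 L, ‖h x‖) + vol d L.1 * ((vol d L.1)⁻¹ * ∫ x in box v 0 L, ‖h x‖) := by
        gcongr; exact norm_cubeMean_le L
    _ = _ := by rw [mul_inv_cancel_left₀ hV.ne']; ring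

lemma norm_badPart_le {M : ℝ} (hM : ∀ x, ‖h x‖ ≤ M) (L : GridCube d) (x : Space d) :
    ‖badPart v h L x‖ ≤ 2 * M := by
  refine (norm_indicator_le_norm_self _ _).trans ((norm_sub_le _ _).trans ?_)
  have := hM x
  have := norm_cubeMean_le_of_bound (v := v) hM L
  linarith

variable {Q : GridCube d}

/-- A grid cube of level at most that of `Q` lies inside the tripled cube of `Q` or misses it. In
the latter case `h` vanishes on it, and so does its mean. -/
lemma badPart_supp (hs : ∀ x, x ∉ box v 1 Q → h x = 0)
    {L : GridCube d} (hL : L.1 ≤ Q.1) {x : Space d} (hx : x ∉ box v 1 Q) :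
    badPart v h L x = 0 := by
  refine Set.indicator_apply_eq_zero.2 fun hxL => ?_
  have hz : ∀ y ∈ box v 0 L, h y = 0 := fun y hy => hs y fun hyQ => hx fun i => by
    have h1 := (near_zero_of_mem hxL hy).zero_le_level hL i
    have h2 := hyQ i
    rw [abs_le] at *
    constructor <;> omega
  have : cubeMean v h L = 0 := by
    rw [cubeMean, setIntegral_congr_fun (measurableSet_box_zero L) (g := fun _ => 0) hz]
    simp
  rw [hz x hxL, this, sub_zero]

lemma adm_badPart (hQΩ : box v 1 Q ⊆ Ω) (ha : Adm Ω h)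
    (hs : ∀ x, x ∉ box v 1 Q → h x = 0)
    {L : GridCube d} (hL : L.1 ≤ Q.1) : Adm Ω (badPart v h L) := by
  obtain ⟨M, hM⟩ := ha.bdd
  refine ⟨(ha.meas.sub measurable_const).indicator (measurableSet_box_zero L),
    ⟨2 * M, norm_badPart_le hM L⟩, fun x hx => ?_⟩
  exact badPart_supp hs hL fun h => hx (hQΩ h)

lemma hasSum_badPart_of_mem (hW : IsStopping v K W) {L : W} {x : Space d} (hx : x ∈ box v 0 L.1)
    (h : Space d → ℂ) : ∀ L' : W, L' ≠ L → badPart v h L'.1 x = 0 := fun _ hne =>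
  Set.indicator_of_notMem (fun hx' => hne (Subtype.ext (hW.eq_of_mem _ (Subtype.coe_prop _) _ L.2 x hx' hx))) _

/-- The sum of the mean zero parts over the stopping cubes. -/
def badSum (v : Space d) (W : Set (GridCube d)) (h : Space d → ℂ) (x : Space d) : ℂ :=
  ∑' L : W, badPart v h L.1 x

lemma hasSum_badSum (hW : IsStopping v K W) (h : Space d → ℂ) (x : Space d) :
    HasSum (fun L : W => badPart v h L.1 x) (badSum v W h x) := by
  by_cases hx : ∃ L : W, x ∈ box v 0 L.1
  · obtain ⟨L, hL⟩ := hx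
    have := hasSum_single L (hasSum_badPart_of_mem hW hL h)
    exact this.summable.hasSum
  · push Not at hx
    have : ∀ L : W, badPart v h L.1 x = 0 := fun L => Set.indicator_of_notMem (hx L) _
    simp_rw [badSum, this]
    simp

lemma norm_sum_badPart_le (hW : IsStopping v K W) {M : ℝ} (hM0 : 0 ≤ M) (hM : ∀ x, ‖h x‖ ≤ M)
    (F : Finset W) (x : Space d) : ‖∑ L ∈ F, badPart v h L.1 x‖ ≤ 2 * M := by
  classical
  by_cases hx : ∃ L : W, x ∈ box v 0 L.1
  · obtain ⟨L, hL⟩ := hx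
    by_cases hLF : L ∈ F
    · rw [Finset.sum_eq_single_of_mem L hLF fun L' _ hne => hasSum_badPart_of_mem hW hL h L' hne]
      exact norm_badPart_le hM L.1 x
    · rw [Finset.sum_eq_zero fun L' hL' => hasSum_badPart_of_mem hW hL h L'
        (by rintro rfl; exact hLF hL')]
      simpa using hM0
  · push Not at hx
    have h0 : ∀ L : W, badPart v h L.1 x = 0 := fun L => Set.indicator_of_notMem (hx L) _
    simpa [h0] using hM0

lemma adm_badSum (hQΩ : box v 1 Q ⊆ Ω) (ha : Adm Ω h)
    (hs : ∀ x, x ∉ box v 1 Q → h x = 0)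
    (hW : IsStopping v Q.1 W) : Adm Ω (badSum v W h) := by
  obtain ⟨M, hM⟩ := ha.bdd
  have hM0 : 0 ≤ M := (norm_nonneg _).trans (hM 0)
  refine ⟨?_, ⟨2 * M, fun x => ?_⟩, fun x hx => ?_⟩
  · refine measurable_of_tendsto_metrizable' (atTop : Filter (Finset W))
      (f := fun F x => ∑ L ∈ F, badPart v h L.1 x) (fun F => ?_) ?_
    · exact Finset.measurable_fun_sum F fun L _ =>
        (adm_badPart hQΩ ha hs (hW.level_lt _ L.2).le).meas
    · exact tendsto_pi_nhds.2 fun x => hasSum_badSum hW h x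
  · exact le_of_tendsto (hasSum_badSum hW h x).norm
      (Eventually.of_forall fun F => norm_sum_badPart_le hW hM0 hM F x)
  · rw [badSum]
    simp_rw [badPart_supp hs (hW.level_lt _ (Subtype.coe_prop _)).le fun h => hx (hQΩ h)]
    simp

lemma sub_badSum_of_mem (hW : IsStopping v K W) {L : GridCube d} (hL : L ∈ W) {x : Space d}
    (hx : x ∈ box v 0 L) : h x - badSum v W h x = cubeMean v h L := by
  rw [badSum, tsum_eq_single ⟨L, hL⟩ (hasSum_badPart_of_mem hW (L := ⟨L, hL⟩) hx h)]
  simp [badPart, hx]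

lemma sub_badSum_of_notMem {x : Space d} (hx : ∀ L ∈ W, x ∉ box v 0 L) :
    h x - badSum v W h x = h x := by
  rw [badSum]
  have : ∀ L : W, badPart v h L.1 x = 0 := fun L => Set.indicator_of_notMem (hx L L.2) _
  simp [this]

end Decomposition

/-! ### Stopping cubes adapted to the functions and the sparse step -/

/-- The stopping cubes of integrable functions. -/
lemma exists_isStopping {ι : Type} [Fintype ι] {h : ι → Space d → ℂ} (hh : ∀ i, Integrable (h i))
    {t : ι → ℝ} (ht : ∀ i, 0 < t i) (hint : ∀ i, ∫ x, ‖h i x‖ = t i * vol d K) :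
    ∃ W : Set (GridCube d), IsStopping v K W ∧
      (∀ L ∈ W, ∀ y ∈ box v 0 L, ∀ s, L.1 + 1 ≤ s → ∀ i,
        ∫ x in box v 1 (cubeAt v s y), ‖h i x‖ ≤ stopConst d (Fintype.card ι) * t i * vol d s) ∧
      (∀ i, ∀ᵐ x, (∀ L ∈ W, x ∉ box v 0 L) →
        ‖h i x‖ ≤ stopConst d (Fintype.card ι) * t i / ballVol d) := by
  set ν : ι → Measure (Space d) := fun i => volume.withDensity fun x => ‖h i x‖ₑ with hνdef
  have hνS : ∀ i (Z : Set (Space d)), MeasurableSet Z → ν i Z = ∫⁻ x in Z, ‖h i x‖ₑ :=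
    fun i Z hZ => withDensity_apply _ hZ
  have hν : ∀ i, ν i Set.univ ≤ ENNReal.ofReal (t i * vol d K) := fun i => by
    rw [hνS i _ MeasurableSet.univ, setLIntegral_univ, ← hint, ofReal_integral_norm_eq_lintegral_enorm (hh i)]
  have hC := stopConst_pos d (Fintype.card ι)
  refine ⟨stoppingCubes v ν t, ⟨?_, ?_, ?_, ?_, ?_, ?_⟩, ?_, ?_⟩
  · exact fun P hP => stoppingCubes_level_lt ht hν hP.1
  · exact fun P hP P' hP' x hx hx' => IsMaximalCube.eq (G := fun P => box v 2 P ⊆ heavySet v ν t) hP hP' hx hx'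
  · exact fun P hP x y hx hxy => stoppingCubes_cover ht hν hP hx hxy
  · exact fun P hP P' hP' x y hx hy hxy => stoppingCubes_comparable hP hP' hx hy hxy
  · have h1 := tsum_volume_stoppingCubes_le (v := v) ht hν
    simp_rw [volume_box_zero] at h1
    refine (ENNReal.summable_toReal (ne_top_of_le_ne_top ENNReal.ofReal_ne_top h1)).congr fun P => ?_
    rw [ENNReal.toReal_ofReal (vol_pos _ _).le]
  · have h1 := tsum_volume_stoppingCubes_le (v := v) ht hν
    simp_rw [volume_box_zero] at h1
    have h2 := ENNReal.toReal_le_of_le_ofReal (by have := vol_pos d K; positivity) h1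
    rw [ENNReal.tsum_toReal_eq fun _ => ENNReal.ofReal_ne_top] at h2
    refine (le_of_eq (tsum_congr fun P => ?_)).trans h2
    rw [ENNReal.toReal_ofReal (vol_pos _ _).le]
  · intro L hL y hy s hs i
    have h1 := measure_box_one_le_of_mem_stoppingCubes hL hy hs i
    rw [hνS i _ (measurableSet_box_one _)] at h1
    rw [integral_norm_eq_lintegral_enorm (hh i).1.restrict]
    refine ENNReal.toReal_le_of_le_ofReal ?_ h1
    have := ht i
    have := vol_pos d s
    positivity
  · intro i
    have := ht i
    filter_upwards [ae_norm_le_of_average_le (v := v) (hh i)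
      (c := stopConst d (Fintype.card ι) * t i) (by positivity)] with x hx hxW
    refine hx fun k => ?_
    have := measure_box_one_le_of_notMem ht hν hxW k i
    rwa [hνS i _ (measurableSet_box_one _)] at this

/-- The constant in the bound of the good parts. -/
def goodConst (d m : ℕ) : ℝ := 2 ^ d * stopConst d (m + 1) + stopConst d (m + 1) / ballVol d

/-- The constant in the averages. -/
def avgConst (d m : ℕ) : ℝ := 3 ^ d * goodConst d m

/-- The constant of the sparse step. -/
def stepConst (d m : ℕ) (ε : ℝ) : ℝ :=
  2 * goodConst d m ^ (m + 1) + (m + 1) * (meanZeroConst d m ε * (2 * avgConst d m ^ m))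

lemma goodConst_pos (d m : ℕ) : 0 < goodConst d m := by
  have := stopConst_pos d (m + 1)
  have := ballVol_pos d
  unfold goodConst; positivity

lemma avgConst_pos (d m : ℕ) : 0 < avgConst d m := by
  have := goodConst_pos d m
  unfold avgConst; positivity

lemma stepConst_nonneg (d m : ℕ) {ε : ℝ} (hε : 0 < ε) : 0 ≤ stepConst d m ε := by
  have := goodConst_pos d m
  have := avgConst_pos d m
  have := meanZeroConst_nonneg d m hε
  unfold stepConst; positivity

lemma exists_stopping_step (hΩ : volume Ω ≠ ∞) (hε : 0 < ε) (hε1 : ε ≤ 1) (hB : 0 ≤ B)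
    (hκ : ScaleKernel v ε A κ) (hΛ : FormFamily v Ω B κ Λ) {Q : GridCube d}
    (hQΩ : box v 1 Q ⊆ Ω) {h : Fin (m + 1) → Space d → ℂ} (hh : ∀ i, Adm Ω (h i))
    (hs : ∀ i x, x ∉ box v 1 Q → h i x = 0) {t : Fin (m + 1) → ℝ} (ht : ∀ i, 0 < t i)
    (hint : ∀ i, ∫ x, ‖h i x‖ = t i * vol d Q.1) :
    ∃ W : Set (GridCube d), IsStopping v Q.1 W ∧
      ‖remainder v Λ Q.1 W h‖ ≤ stepConst d m ε * (A + B) * (vol d Q.1 * ∏ i, t i) := by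
  have hI := fun i => (hh i).integrable hΩ
  obtain ⟨W, hW, havg, hgood⟩ := exists_isStopping (v := v) (K := Q.1) hI ht hint
  rw [Fintype.card_fin] at havg hgood
  refine ⟨W, hW, ?_⟩
  have hS := stopConst_pos d (m + 1)
  have hbv := ballVol_pos d
  have hA := hκ.nonneg
  have hVQ := vol_pos d Q.1
  set b : Fin (m + 1) → Space d → ℂ := fun i => badSum v W (h i) with hb
  set g : Fin (m + 1) → Space d → ℂ := fun i => h i - b i with hg
  have hba : ∀ i, Adm Ω (b i) := fun i => adm_badSum hQΩ (hh i) (hs i) hW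
  have hga : ∀ i, Adm Ω (g i) := fun i => (hh i).sub (hba i)
  have hgs : ∀ i x, x ∉ box v 1 Q → g i x = 0 := fun i x hx => by
    have : ∀ L : W, badPart v (h i) L.1 x = 0 := fun L =>
      badPart_supp (hs i) (hW.level_lt _ L.2).le hx
    simp [hg, hb, badSum, this, hs i x hx]
  -- Off the stopping cubes the good part is `h i`, bounded by differentiation. On a stopping cube
  -- `L` it is a mean, compared with the controlled mass one level up at the price of `2^d`. The two
  -- terms of `goodConst` are these two bounds.
  have hgle : ∀ i, ∀ᵐ x, ‖g i x‖ ≤ goodConst d m * t i := by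
    intro i
    have hti := ht i
    filter_upwards [hgood i] with x hx
    by_cases hxW : ∀ L ∈ W, x ∉ box v 0 L
    · have e : g i x = h i x := sub_badSum_of_notMem hxW
      rw [e]
      refine (hx hxW).trans ?_
      rw [goodConst, add_mul, div_mul_eq_mul_div]
      have : 0 ≤ 2 ^ d * stopConst d (m + 1) * t i := by positivity
      linarith
    · push Not at hxW
      obtain ⟨L, hL, hxL⟩ := hxW
      have e : g i x = cubeMean v (h i) L := sub_badSum_of_mem hW hL hxL
      rw [e]
      have hV := vol_pos d L.1
      have h1 := havg L hL x hxL (L.1 + 1) le_rfl i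
      have h2 : ∫ x in box v 0 L, ‖h i x‖ ≤ ∫ x in box v 1 (cubeAt v (L.1 + 1) x), ‖h i x‖ := by
        refine setIntegral_mono_set (hI i).norm.integrableOn
          (Eventually.of_forall fun _ => norm_nonneg _) (LE.le.eventuallyLE ?_)
        intro y hy
        exact Near.le_level (k' := L.1 + 1)
          ((near_zero_of_mem hy hxL).mono (by norm_num)) (by omega)
      have h3 : vol d (L.1 + 1) = 2 ^ d * vol d L.1 := by simpa using vol_add (d := d) L.1 1
      rw [h3] at h1
      refine (norm_cubeMean_le L).trans ?_
      rw [inv_mul_le_iff₀ hV]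
      refine (h2.trans h1).trans ?_
      rw [goodConst, add_mul, mul_add]
      have : 0 ≤ vol d L.1 * (stopConst d (m + 1) / ballVol d * t i) := by positivity
      linarith
  have hcle : stopConst d (m + 1) ≤ avgConst d m := by
    have h1 : (1 : ℝ) ≤ 3 ^ d := one_le_pow₀ (by norm_num)
    have h2 : (1 : ℝ) ≤ 2 ^ d := one_le_pow₀ (by norm_num)
    have h3 : stopConst d (m + 1) ≤ goodConst d m := by
      unfold goodConst
      have : 0 ≤ stopConst d (m + 1) / ballVol d := by positivity
      nlinarith
    unfold avgConst
    have := goodConst_pos d m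
    nlinarith
  -- Both kinds of entries appear next to a bad one in the telescoping. For `g` the sup bound is
  -- used on a tripled cube, whence the factor `3^d` in `avgConst`.
  have havg' : ∀ w i, (w = g i ∨ w = h i) → ∀ L ∈ W, ∀ y ∈ box v 0 L, ∀ s, L.1 + 1 ≤ s →
      ∫ x in box v 1 (cubeAt v s y), ‖w x‖ ≤ avgConst d m * t i * vol d s := by
    intro w i hw L hL y hy s hLs
    have hti := ht i
    have hVs := vol_pos d s
    rcases hw with rfl | rfl
    · have hfin : volume (box v 1 (cubeAt v s y)) < ∞ := by
        rw [volume_box_one]; exact ENNReal.ofReal_lt_top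
      calc ∫ x in box v 1 (cubeAt v s y), ‖g i x‖
          ≤ ∫ x in box v 1 (cubeAt v s y), goodConst d m * t i := by
            refine integral_mono_of_nonneg (Eventually.of_forall fun _ => norm_nonneg _)
              (integrableOn_const hfin.ne) (ae_restrict_of_ae (hgle i))
        _ = _ := by
            rw [setIntegral_const, Measure.real, volume_box_one,
              ENNReal.toReal_ofReal (by simp only [cubeAt]; positivity), smul_eq_mul, avgConst]
            simp only [cubeAt]
            ring
    · refine (havg L hL y hy s hLs i).trans ?_
      gcongr
  have hgood' : ‖remainder v Λ Q.1 W g‖ ≤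
      2 * B * vol d Q.1 * ∏ i, (goodConst d m * t i) :=
    norm_remainder_le_of_bounded hB hΛ hW rfl hga hgs
      (fun i => mul_nonneg (goodConst_pos d m).le (ht i).le) hgle
  have hDbound : ∀ (u : Fin (m + 1) → Space d → ℂ) (j : Fin (m + 1)), u j = b j →
      (∀ i, i ≠ j → u i = g i ∨ u i = h i) → ‖remainder v Λ Q.1 W u‖ ≤
        A * (meanZeroConst d m ε * (2 * avgConst d m ^ m)) * (vol d Q.1 * ∏ i, t i) := by
    intro u j huj hui
    have hua : ∀ i, Adm Ω (u i) := fun i => by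
      rcases eq_or_ne i j with rfl | hij
      · rw [huj]; exact hba i
      · rcases hui i hij with e | e <;> rw [e]
        exacts [hga i, hh i]
    obtain ⟨M, hM⟩ := (hh j).bdd
    have hM0 : 0 ≤ M := (norm_nonneg _).trans (hM 0)
    -- Subtracting the mean at most doubles the `L^1` norm on each cube, and the cubes are disjoint.
    have hbound : ∀ F : Finset W, ∑ L ∈ F, ∫ x, ‖badPart v (h j) L.1 x‖ ≤ 2 * (t j * vol d Q.1) := by
      intro F
      refine (Finset.sum_le_sum fun L _ => integral_norm_badPart_le (hI j) L.1).trans ?_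
      rw [← Finset.mul_sum, ← hint j]
      refine mul_le_mul_of_nonneg_left ?_ (by norm_num)
      rw [← integral_biUnion_finset F (fun L _ => measurableSet_box_zero L.1)
        (fun L _ L' _ hne => hW.pairwise_disjoint hne) fun L _ => (hI j).norm.integrableOn]
      exact setIntegral_le_integral (hI j).norm (Eventually.of_forall fun _ => norm_nonneg _)
    have := norm_remainder_le_of_bad hΩ hε hε1 hκ hΛ hW hua j
      (b := fun L => badPart v (h j) L.1)
      (fun L => adm_badPart hQΩ (hh j) (hs j) (hW.level_lt _ L.2).le)
      (fun L x hx => Set.indicator_of_notMem hx _) (fun L => integral_badPart (hI j) L.1)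
      (norm_sum_badPart_le hW hM0 hM) (fun x => by rw [huj]; exact hasSum_badSum hW (h j) x)
      hbound (c := fun i => avgConst d m * t i)
      (fun i => mul_nonneg (avgConst_pos d m).le (ht i).le)
      (fun i hij L hL y hy s hLs => havg' _ i (hui i hij) L hL y hy s hLs)
    refine this.trans (le_of_eq ?_)
    rw [Finset.prod_mul_distrib, Finset.prod_const, Finset.card_erase_of_mem (Finset.mem_univ j),
      ← Finset.mul_prod_erase Finset.univ t (Finset.mem_univ j)]
    simp
    ring
  have := norm_remainder_le_add hΛ hW (h := h) hga hba (fun i => by simp [hg]) hDbound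
  refine this.trans ((add_le_add_left hgood' _).trans ?_)
  rw [Finset.prod_mul_distrib, Finset.prod_const, Finset.card_univ, Fintype.card_fin]
  have hP : 0 ≤ vol d Q.1 * ∏ i, t i := mul_nonneg hVQ.le (Finset.prod_nonneg fun i _ => (ht i).le)
  have hc1 : 0 ≤ goodConst d m ^ (m + 1) := pow_nonneg (goodConst_pos d m).le _
  have hc2 : 0 ≤ (m + 1 : ℝ) * (meanZeroConst d m ε * (2 * avgConst d m ^ m)) := by
    have := meanZeroConst_nonneg d m hε
    have := avgConst_pos d m
    positivity
  have e : 2 * B * vol d Q.1 * (goodConst d m ^ (m + 1) * ∏ i, t i) +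
      (m + 1) * (A * (meanZeroConst d m ε * (2 * avgConst d m ^ m)) * (vol d Q.1 * ∏ i, t i)) =
      (2 * goodConst d m ^ (m + 1) * B +
        (m + 1) * (meanZeroConst d m ε * (2 * avgConst d m ^ m)) * A) * (vol d Q.1 * ∏ i, t i) := by
    ring
  rw [e]
  refine mul_le_mul_of_nonneg_right ?_ hP
  unfold stepConst
  nlinarith

end

section

variable {d m : ℕ} {v : Space d}

/-! ### Iteration of the sparse step -/

/-! ### Summation over the tree of stopping cubes -/

section Tree

variable {ch : GridCube d → Set (GridCube d)}

/-- The descendants of a grid cube. -/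
def descendants (ch : GridCube d → Set (GridCube d)) (Q : GridCube d) : Set (GridCube d) :=
  {R | Relation.ReflTransGen (fun P L => L ∈ ch P) Q R}

/-- The points of a grid cube outside its children. -/
def ownSet (v : Space d) (ch : GridCube d → Set (GridCube d)) (R : GridCube d) : Set (Space d) :=
  box v 0 R \ ⋃ L : ch R, box v 0 L.1

variable (hsub : ∀ Q, ∀ L ∈ ch Q, box v 0 L ⊆ box v 0 Q ∧ L.1 < Q.1)
  (hdisj : ∀ Q, ∀ L ∈ ch Q, ∀ L' ∈ ch Q, L ≠ L' → Disjoint (box v 0 L) (box v 0 L'))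

include hsub

lemma descendants_subset {Q R : GridCube d} (h : R ∈ descendants ch Q) :
    box v 0 R ⊆ box v 0 Q ∧ R.1 ≤ Q.1 := by
  induction h with
  | refl => exact ⟨subset_rfl, le_rfl⟩
  | tail _ h ih =>
    have := hsub _ _ h
    exact ⟨this.1.trans ih.1, (this.2.trans_le ih.2).le⟩

include hdisj

/-- Two cubes of the tree either lie below different children of a common ancestor, which are
disjoint, or one lies below a child of the other, and that child has been removed from the other's
own set. -/
lemma disjoint_ownSet {Q R R' : GridCube d} (hR : R ∈ descendants ch Q)
    (hR' : R' ∈ descendants ch Q) (hne : R ≠ R') :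
    Disjoint (ownSet v ch R) (ownSet v ch R') := by
  have key : ∀ {Q L R : GridCube d}, L ∈ ch Q → R ∈ descendants ch L →
      Disjoint (ownSet v ch Q) (ownSet v ch R) := by
    intro Q L R hL hR
    refine Set.disjoint_left.2 fun x hx hx' => hx.2 ?_
    exact Set.mem_iUnion.2 ⟨⟨L, hL⟩, (descendants_subset hsub hR).1 hx'.1⟩
  have hR0 : Relation.ReflTransGen (fun P L => L ∈ ch P) Q R := hR
  induction hR0 using Relation.ReflTransGen.head_induction_on with
  | refl =>
    rcases Relation.ReflTransGen.cases_head hR' with h | ⟨L, hL, h⟩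
    · exact absurd h hne
    · exact key hL h
  | head hL h ih =>
    rename_i P L
    rcases Relation.ReflTransGen.cases_head hR' with h' | ⟨L', hL', h'⟩
    · rw [← h']; exact (key hL h).symm
    · rcases eq_or_ne L L' with rfl | hLL
      · exact ih h h'
      · have hd := hdisj _ L hL L' hL' hLL
        exact hd.mono (Set.sdiff_subset.trans (descendants_subset hsub h).1)
          (Set.sdiff_subset.trans (descendants_subset hsub h').1)

/-- No cube is counted twice: descendants of different children are disjoint and nonempty, and
levels drop strictly, so `Q` is not a descendant of its children. -/
lemma tsum_descendants_le (a : GridCube d → ℝ≥0∞) (Q : GridCube d) :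
    a Q + ∑' L : ch Q, ∑' R : descendants ch L.1, a R ≤ ∑' R : descendants ch Q, a R := by
  classical
  have hself : ∀ P : GridCube d, P ∈ descendants ch P := fun P => Relation.ReflTransGen.refl
  have e0 : a Q = ∑' P, ({Q} : Set (GridCube d)).indicator a P := by
    rw [← tsum_subtype, tsum_singleton]
  rw [e0]
  simp_rw [tsum_subtype (descendants ch _) a]
  rw [ENNReal.tsum_comm, ← ENNReal.tsum_add]
  refine ENNReal.tsum_le_tsum fun P => ?_
  by_cases hP : ∃ L : ch Q, P ∈ descendants ch L.1
  · obtain ⟨L, hL⟩ := hP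
    have hPQ : P ≠ Q := by
      rintro rfl
      have := (descendants_subset hsub hL).2
      have := (hsub _ _ L.2).2
      omega
    rw [Set.indicator_of_notMem (by simpa using hPQ), zero_add, tsum_eq_single L,
      Set.indicator_of_mem hL, Set.indicator_of_mem]
    · exact Relation.ReflTransGen.head L.2 hL
    · intro L' hne
      refine Set.indicator_of_notMem (fun hL' => ?_) _
      have hd := hdisj _ L.1 L.2 L'.1 L'.2 (fun h => hne (Subtype.ext h.symm))
      obtain ⟨x, hx⟩ := box_zero_nonempty (v := v) P
      exact Set.disjoint_left.1 hd ((descendants_subset hsub hL).1 hx)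
        ((descendants_subset hsub hL').1 hx)
  · push Not at hP
    have : ∀ L : ch Q, (descendants ch L.1).indicator a P = 0 := fun L =>
      Set.indicator_of_notMem (hP L) _
    simp only [this, tsum_zero, add_zero]
    refine Set.indicator_le_indicator_of_subset ?_ (fun _ => zero_le) P
    rintro _ rfl
    exact hself _

/-- Iterating an estimate of `U` by the children leads to a sum over all descendants. -/
lemma le_tsum_descendants (hvol : ∀ Q, ∑' L : ch Q, volume (box v 0 L.1) ≤ volume (box v 0 Q) / 2)
    {U a : GridCube d → ℝ≥0∞} {b : ℝ≥0∞} (hb : b ≠ ∞) {Q₀ : GridCube d}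
    (hstep : ∀ Q ∈ descendants ch Q₀, U Q ≤ a Q + ∑' L : ch Q, U L)
    (hbound : ∀ Q, U Q ≤ b * volume (box v 0 Q)) : U Q₀ ≤ ∑' R : descendants ch Q₀, a R := by
  -- After `n` generations the unresolved cubes have total volume at most `2^(-n)` times that of
  -- `Q`, so the crude bound on them tends to zero.
  have key : ∀ n : ℕ, ∀ Q ∈ descendants ch Q₀,
      U Q ≤ ∑' R : descendants ch Q, a R + b * volume (box v 0 Q) * (2⁻¹) ^ n := by
    intro n
    induction n with
    | zero => exact fun Q _ => (hbound Q).trans (by simp)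
    | succ n ih =>
      intro Q hQ
      calc U Q ≤ a Q + ∑' L : ch Q, U L := hstep Q hQ
        _ ≤ a Q + ∑' L : ch Q, (∑' R : descendants ch L.1, a R +
              b * volume (box v 0 L.1) * (2⁻¹) ^ n) := by
            gcongr with L
            exact ih L (Relation.ReflTransGen.tail hQ L.2)
        _ = (a Q + ∑' L : ch Q, ∑' R : descendants ch L.1, a R) +
              b * (∑' L : ch Q, volume (box v 0 L.1)) * (2⁻¹) ^ n := by
            rw [ENNReal.tsum_add, ENNReal.tsum_mul_right, ENNReal.tsum_mul_left, add_assoc]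
        _ ≤ ∑' R : descendants ch Q, a R + b * (volume (box v 0 Q) / 2) * (2⁻¹) ^ n := by
            gcongr
            · exact tsum_descendants_le hsub hdisj a Q
            · exact hvol Q
        _ = _ := by rw [pow_succ, div_eq_mul_inv]; ring
  have hlim : Tendsto (fun n : ℕ => ∑' R : descendants ch Q₀, a R +
      b * volume (box v 0 Q₀) * (2⁻¹ : ℝ≥0∞) ^ n) atTop
      (𝓝 (∑' R : descendants ch Q₀, a R + b * volume (box v 0 Q₀) * 0)) := by
    refine Tendsto.const_add _ (ENNReal.Tendsto.const_mul ?_ (Or.inr ?_))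
    · exact ENNReal.tendsto_pow_atTop_nhds_zero_of_lt_one (by simp)
    · rw [volume_box_zero]; exact ENNReal.mul_ne_top hb ENNReal.ofReal_ne_top
  rw [mul_zero, add_zero] at hlim
  exact ge_of_tendsto' hlim fun n => key n Q₀ Relation.ReflTransGen.refl

omit hsub hdisj in
lemma half_volume_le_ownSet (hvol : ∀ Q, ∑' L : ch Q, volume (box v 0 L.1) ≤ volume (box v 0 Q) / 2)
    (Q : GridCube d) : volume (box v 0 Q) / 2 ≤ volume (ownSet v ch Q) := by
  have h1 : volume (⋃ L : ch Q, box v 0 L.1) ≤ volume (box v 0 Q) / 2 :=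
    (measure_iUnion_le _).trans (hvol Q)
  have h2 : volume (box v 0 Q) - volume (⋃ L : ch Q, box v 0 L.1) ≤ volume (ownSet v ch Q) :=
    le_measure_sdiff
  refine le_trans ?_ h2
  refine le_trans ?_ (tsub_le_tsub_left h1 _)
  rw [ENNReal.sub_half]
  rw [volume_box_zero]; exact ENNReal.ofReal_ne_top

end Tree

lemma boxCube_injective (v : Space d) (a : ℕ) : Function.Injective (boxCube v a) := by
  intro P P' h
  have h1 := congrArg Cube.side h
  have h2 := congrArg Cube.corner h
  simp only [boxCube] at h1 h2
  have h3 : P.1 = P'.1 := by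
    have : (2 : ℝ) ^ P.1 = 2 ^ P'.1 := mul_left_cancel₀ (by positivity) h1
    exact zpow_right_injective₀ (by norm_num) (by norm_num) this
  refine Prod.ext h3 (funext fun i => ?_)
  have h4 := congrArg (fun x : Space d => x i) h2
  simp only [h3] at h4
  have h5 : (0 : ℝ) < 2 ^ P'.1 := by positivity
  have h6 : ((P.2 i : ℝ) - a) = P'.2 i - a := mul_right_cancel₀ h5.ne' (add_left_cancel h4)
  have h7 : (P.2 i : ℝ) = P'.2 i := by linarith
  exact_mod_cast h7

/-- The sparsity constant. -/
def sparsity (d : ℕ) : ℝ := 1 / (2 * 3 ^ d)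

/-- The sets `E R` occupy half of the grid cubes, while the cubes of the sparse family are the
triples, larger by `3^d`. Injectivity of the passage to triples lets `E` be carried over by
`Function.extend`. -/
lemma isSparse_image_boxCube {S : Set (GridCube d)} {E : GridCube d → Set (Space d)}
    (hE : ∀ R ∈ S, MeasurableSet (E R) ∧ E R ⊆ box v 0 R ∧ volume (box v 0 R) / 2 ≤ volume (E R))
    (hdis : ∀ R ∈ S, ∀ R' ∈ S, R ≠ R' → Disjoint (E R) (E R')) :
    IsSparse (sparsity d) (boxCube v 1 '' S) := by
  have hinj := boxCube_injective v 1
  refine ⟨Function.extend (boxCube v 1) E fun _ => ∅, ?_, ?_⟩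
  · rintro _ ⟨R, hR, rfl⟩
    rw [hinj.extend_apply, boxCube_toSet]
    obtain ⟨h1, h2, h3⟩ := hE R hR
    refine ⟨h1, h2.trans (box_mono (by norm_num) R), ?_⟩
    refine le_trans (le_of_eq ?_) h3
    have hV := vol_pos d R.1
    rw [Nat.cast_one, volume_box_one, volume_box_zero, sparsity,
      ← ENNReal.ofReal_mul (by positivity), ← ENNReal.ofReal_ofNat 2,
      ← ENNReal.ofReal_div_of_pos (by norm_num)]
    congr 1
    norm_num
    field_simp
  · rintro _ ⟨R, hR, rfl⟩ _ ⟨R', hR', rfl⟩ hne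
    rw [hinj.extend_apply, hinj.extend_apply]
    exact hdis R hR R' hR' fun h => hne (by rw [h])

variable {Ω : Set (Space d)} {B ε A : ℝ} {κ : ℤ → (Fin (m + 1) → Space d) → ℂ}
  {Λ : ℤ → (Fin (m + 1) → Space d → ℂ) → ℂ}

/-! ### The stopping step for localized functions and sparse domination -/

/-- The normalized masses of the localized functions. -/
def mass (v : Space d) (f : Fin (m + 1) → Space d → ℂ) (Q : GridCube d) (i : Fin (m + 1)) : ℝ :=
  (∫ x, ‖loc v Q f i x‖) / vol d Q.1

/-- This closes the recursion: localizing to a child inside `Q` forgets the earlier localization to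
`Q`. -/
lemma loc_loc {L Q : GridCube d} (h : box v 0 L ⊆ box v 0 Q) (hl : L.1 ≤ Q.1)
    (f : Fin (m + 1) → Space d → ℂ) : loc v L (loc v Q f) = loc v L f := by
  ext i : 1
  unfold loc
  split_ifs
  · rw [Set.indicator_indicator, Set.inter_eq_left.2 h]
  · rw [Set.indicator_indicator, Set.inter_eq_left.2 (box_one_subset h hl)]

/-- The sparse step, with the children of `Q` inside `Q`. -/
lemma exists_children (hΩ : volume Ω ≠ ∞) (hε : 0 < ε) (hε1 : ε ≤ 1) (hB : 0 ≤ B)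
    (hκ : ScaleKernel v ε A κ) (hΛ : FormFamily v Ω B κ Λ) {f : Fin (m + 1) → Space d → ℂ}
    (hf : ∀ i, Adm Ω (f i)) {Q : GridCube d} (hQΩ : box v 1 Q ⊆ Ω) :
    ∃ W : Set (GridCube d), (∀ L ∈ W, box v 0 L ⊆ box v 0 Q ∧ L.1 < Q.1) ∧
      (∀ L ∈ W, ∀ L' ∈ W, L ≠ L' → Disjoint (box v 0 L) (box v 0 L')) ∧
      (∑' L : W, volume (box v 0 L.1) ≤ volume (box v 0 Q) / 2) ∧
      ‖Λ Q.1 (loc v Q f)‖ₑ ≤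
        ENNReal.ofReal (stepConst d m ε * (A + B) * (vol d Q.1 * ∏ i, mass v f Q i)) +
          ∑' L : W, ‖Λ L.1.1 (loc v L.1 f)‖ₑ := by
  classical
  have hA := hκ.nonneg
  have hV := vol_pos d Q.1
  have hloc := adm_loc (v := v) hf Q
  by_cases ht : ∀ i, 0 < mass v f Q i
  · obtain ⟨W, hW, hrem⟩ := exists_stopping_step hΩ hε hε1 hB hκ hΛ hQΩ hloc
      (fun i x hx => loc_eq_zero f Q i hx) ht
      (fun i => by rw [mass, div_mul_cancel₀ _ hV.ne'])
    -- Only stopping cubes inside `Q` are kept. The others are disjoint from `Q`, where the first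
    -- function lives, so their forms vanish.
    refine ⟨{L | L ∈ W ∧ box v 0 L ⊆ box v 0 Q}, fun L hL => ⟨hL.2, hW.level_lt L hL.1⟩,
      fun L hL L' hL' hne => Set.disjoint_left.2 fun x hx hx' =>
        hne (hW.eq_of_mem L hL.1 L' hL'.1 x hx hx'), ?_, ?_⟩
    · rw [tsum_subtype {L | L ∈ W ∧ box v 0 L ⊆ box v 0 Q} fun L => volume (box v 0 L)]
      calc _ ≤ ∑' L, W.indicator (fun L => volume (box v 0 L)) L :=
            ENNReal.tsum_le_tsum fun L => Set.indicator_le_indicator_of_subset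
              (fun L hL => hL.1) (fun _ => zero_le) L
        _ = ∑' L : W, ENNReal.ofReal (vol d L.1.1) := by
            rw [← tsum_subtype]; simp_rw [volume_box_zero]
        _ = ENNReal.ofReal (∑' L : W, vol d L.1.1) :=
            (ENNReal.ofReal_tsum_of_nonneg (fun _ => (vol_pos _ _).le) hW.summable).symm
        _ ≤ ENNReal.ofReal (vol d Q.1 / 2) := ENNReal.ofReal_le_ofReal hW.tsum_le
        _ = _ := by
            rw [volume_box_zero, ENNReal.ofReal_div_of_pos (by norm_num), ENNReal.ofReal_ofNat]
    · have e : Λ Q.1 (loc v Q f) = remainder v Λ Q.1 W (loc v Q f) +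
          ∑' L : W, Λ L.1.1 (cut v L.1 (loc v Q f)) := by rw [remainder]; ring
      rw [e]
      refine (enorm_add_le _ _).trans (add_le_add ?_ ?_)
      · rw [← ofReal_norm]
        exact ENNReal.ofReal_le_ofReal hrem
      · refine enorm_tsum_le_tsum_enorm.trans ?_
        rw [tsum_subtype {L | L ∈ W ∧ box v 0 L ⊆ box v 0 Q} fun L => ‖Λ L.1 (loc v L f)‖ₑ,
          tsum_subtype W fun L => ‖Λ L.1 (cut v L (loc v Q f))‖ₑ]
        refine ENNReal.tsum_le_tsum fun L => ?_
        by_cases hL : L ∈ W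
        · rw [Set.indicator_of_mem hL]
          have hl := hW.level_lt L hL
          by_cases hLQ : box v 0 L ⊆ box v 0 Q
          · rw [Set.indicator_of_mem (show L ∈ {L | L ∈ W ∧ box v 0 L ⊆ box v 0 Q} from ⟨hL, hLQ⟩),
              hΛ.cut_eq_loc hloc, loc_loc hLQ hl.le]
          · rw [hΛ.map_zero_slot (adm_cut hloc L)]
            · simp
            · have hdis : box v 0 L ∩ box v 0 Q = ∅ := by
                refine Set.eq_empty_of_forall_notMem fun x hx => hLQ ?_
                exact box_zero_subset hx.1 hx.2 hl.le
              ext x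
              simp [cut, loc, Set.indicator_indicator, hdis]
        · rw [Set.indicator_of_notMem hL]
          exact zero_le
  -- If one mass is zero, that function vanishes almost everywhere and so does the form; no children
  -- are needed.
  · push Not at ht
    obtain ⟨i, hi⟩ := ht
    refine ⟨∅, by simp, by simp, by simp, ?_⟩
    obtain ⟨M, hM0, hM⟩ := exists_common_bound hloc
    have hz : ∀ᵐ x, ‖loc v Q f i x‖ ≤ 0 := by
      have h0 : ∫ x, ‖loc v Q f i x‖ = 0 := by
        have h1 : 0 ≤ ∫ x, ‖loc v Q f i x‖ := integral_nonneg fun _ => norm_nonneg _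
        rw [mass, div_le_iff₀ hV, zero_mul] at hi
        exact le_antisymm hi h1
      rw [integral_eq_zero_iff_of_nonneg (fun _ => norm_nonneg _) ((hloc i).integrable hΩ).norm] at h0
      filter_upwards [h0] with x hx
      exact hx.le
    set N : Fin (m + 1) → ℝ := fun l => if l = i then 0 else M with hN
    have := hΛ.bound Q.1 (loc v Q f) Q N hloc
      (fun l x hx => loc_eq_zero f Q l hx) (fun l => by
        simp only [hN]; split_ifs
        exacts [le_rfl, hM0]) (fun l => by
        simp only [hN]; split_ifs with hl
        · rw [hl]; exact hz
        · exact Eventually.of_forall (hM l))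
    rw [Finset.prod_eq_zero (Finset.mem_univ i) (if_pos rfl : N i = 0), mul_zero] at this
    rw [norm_le_zero_iff.1 this]
    simp

/-- The mass is normalized by the volume of the grid cube, the average by that of its triple; hence
`3^d`. -/
lemma enorm_integral_loc_le (f : Fin (m + 1) → Space d → ℂ) (Q : GridCube d) (i : Fin (m + 1))
    (hf : Measurable (f i)) :
    ENNReal.ofReal (mass v f Q i) ≤ ENNReal.ofReal (3 ^ d) * cubeAverage 1 (boxCube v 1 Q) (f i) := by
  have hV := vol_pos d Q.1
  have hm : Measurable (loc v Q f i) := by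
    unfold loc; split_ifs
    exacts [hf.indicator (measurableSet_box_zero Q), hf.indicator (measurableSet_box_one Q)]
  have h1 : ENNReal.ofReal (∫ x, ‖loc v Q f i x‖) ≤ eLpNorm ((boxCube v 1 Q).toSet.indicator (f i)) 1 volume := by
    rw [eLpNorm_one_eq_lintegral_enorm]
    rw [integral_norm_eq_lintegral_enorm hm.aestronglyMeasurable]
    refine ENNReal.ofReal_toReal_le.trans (lintegral_mono fun x => ?_)
    rw [boxCube_toSet, Nat.cast_one]
    unfold loc
    split_ifs
    · rw [enorm_indicator_eq_indicator_enorm, enorm_indicator_eq_indicator_enorm]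
      exact Set.indicator_le_indicator_of_subset (box_mono (by norm_num) Q) (fun _ => zero_le) x
    · exact le_rfl
  have h2 : volume (boxCube v 1 Q).toSet = ENNReal.ofReal (3 ^ d * vol d Q.1) := by
    rw [boxCube_toSet, Nat.cast_one, volume_box_one]
  rw [mass, ENNReal.ofReal_div_of_pos hV, cubeAverage, h2,
    inv_one, ENNReal.toReal_one, ENNReal.rpow_neg_one, ← mul_assoc,
    ENNReal.ofReal_mul (by positivity), ENNReal.mul_inv (by simp) (by simp), ← mul_assoc,
    ENNReal.mul_inv_cancel (by simp) (by simp), one_mul, ENNReal.div_eq_inv_mul]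
  gcongr

/-- Families of forms are dominated by sparse forms. -/
theorem FormFamily.enorm_le_supPSF {Q₀ : GridCube d} (hε : 0 < ε) (hε1 : ε ≤ 1) (hB : 0 ≤ B)
    (hκ : ScaleKernel v ε A κ) (hΛ : FormFamily v (box v 1 Q₀) B κ Λ)
    {f : Fin (m + 1) → Space d → ℂ} (hf : ∀ i, Adm (box v 0 Q₀) (f i)) :
    ‖Λ Q₀.1 f‖ₑ ≤ ENNReal.ofReal (stepConst d m ε * (3 ^ d) ^ (m + 1) * (A + B)) *
      supPSF (sparsity d) (fun _ => 1) f := by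
  classical
  have hΩ : volume (box v 1 Q₀) ≠ ∞ := by rw [volume_box_one]; exact ENNReal.ofReal_ne_top
  have hsub01 : box v 0 Q₀ ⊆ box v 1 Q₀ := box_mono (by norm_num) Q₀
  have hf' : ∀ i, Adm (box v 1 Q₀) (f i) := fun i =>
    ⟨(hf i).meas, (hf i).bdd, fun x hx => (hf i).supp x fun h => hx (hsub01 h)⟩
  have hA := hκ.nonneg
  have hC := stepConst_nonneg d m hε
  have hloc : loc v Q₀ f = f := by
    ext i x
    have hsupp : ∀ Z : Set (Space d), box v 0 Q₀ ⊆ Z → Z.indicator (f i) x = f i x := fun Z hZ => by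
      by_cases hx : x ∈ Z
      · simp [hx]
      · simp [hx, (hf i).supp x fun h => hx (hZ h)]
    unfold loc
    split_ifs
    exacts [hsupp _ subset_rfl, hsupp _ hsub01]
  -- The step is available only for cubes whose triple stays in the ambient set. Other cubes get no
  -- children; all descendants of `Q₀` satisfy the condition.
  choose! W hW using fun Q (hQ : box v 1 Q ⊆ box v 1 Q₀) =>
    exists_children hΩ hε hε1 hB hκ hΛ hf' (Q := Q) hQ
  set ch : GridCube d → Set (GridCube d) := fun Q => if box v 1 Q ⊆ box v 1 Q₀ then W Q else ∅
    with hch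
  have hsub : ∀ Q, ∀ L ∈ ch Q, box v 0 L ⊆ box v 0 Q ∧ L.1 < Q.1 := by
    intro Q L hL
    by_cases h : box v 1 Q ⊆ box v 1 Q₀
    · rw [hch] at hL; simp only [h, if_true] at hL; exact (hW Q h).1 L hL
    · rw [hch] at hL; simp [h] at hL
  have hdisj : ∀ Q, ∀ L ∈ ch Q, ∀ L' ∈ ch Q, L ≠ L' → Disjoint (box v 0 L) (box v 0 L') := by
    intro Q L hL L' hL'
    by_cases h : box v 1 Q ⊆ box v 1 Q₀
    · rw [hch] at hL hL'; simp only [h, if_true] at hL hL'; exact (hW Q h).2.1 L hL L' hL'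
    · rw [hch] at hL; simp [h] at hL
  have hvol : ∀ Q, ∑' L : ch Q, volume (box v 0 L.1) ≤ volume (box v 0 Q) / 2 := by
    intro Q
    by_cases h : box v 1 Q ⊆ box v 1 Q₀
    · have : ch Q = W Q := if_pos h
      rw [this]; exact (hW Q h).2.2.1
    · have : ch Q = ∅ := if_neg h
      rw [this]; simp
  set a : GridCube d → ℝ≥0∞ := fun Q =>
    ENNReal.ofReal (stepConst d m ε * (A + B) * (vol d Q.1 * ∏ i, mass v f Q i)) with ha
  obtain ⟨M, hM0, hM⟩ := exists_common_bound hf'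
  -- The a priori bound with the sup norm `M` serves only to make the unresolved part of the
  -- iteration vanish; it does not enter the final constant.
  have hbd := le_tsum_descendants hsub hdisj hvol (U := fun Q => ‖Λ Q.1 (loc v Q f)‖ₑ) (a := a)
    (b := ENNReal.ofReal (B * ∏ _i : Fin (m + 1), M)) ENNReal.ofReal_ne_top (Q₀ := Q₀)
    (fun Q hQ => by
      have h1 := descendants_subset hsub hQ
      have h : box v 1 Q ⊆ box v 1 Q₀ := box_one_subset h1.1 h1.2
      have : ch Q = W Q := if_pos h
      rw [this]
      exact (hW Q h).2.2.2)
    (fun Q => by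
      have := hΛ.bound Q.1 (loc v Q f) Q (fun _ => M) (adm_loc hf' Q)
        (fun l x hx => loc_eq_zero f Q l hx) (fun _ => hM0)
        (fun i => Eventually.of_forall fun x => (norm_loc_le f Q i x).trans (hM i x))
      rw [volume_box_zero, ← ENNReal.ofReal_mul (by positivity), ← ofReal_norm]
      refine ENNReal.ofReal_le_ofReal (this.trans (le_of_eq (by ring))))
  simp only [hloc] at hbd
  refine hbd.trans ?_
  set S := descendants ch Q₀ with hS
  have hsparse : IsSparse (sparsity d) (boxCube v 1 '' S) := by
    refine isSparse_image_boxCube (E := ownSet v ch) (fun R _ => ⟨?_, Set.sdiff_subset, ?_⟩)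
      fun R hR R' hR' hne => disjoint_ownSet hsub hdisj hR hR' hne
    · exact (measurableSet_box_zero R).diff (MeasurableSet.iUnion fun L => measurableSet_box_zero _)
    · exact half_volume_le_ownSet hvol R
  have hterm : ∀ Q, a Q ≤ ENNReal.ofReal (stepConst d m ε * (3 ^ d) ^ (m + 1) * (A + B)) *
      (volume (boxCube v 1 Q).toSet * ∏ i, cubeAverage 1 (boxCube v 1 Q) (f i)) := by
    intro Q
    have hV := vol_pos d Q.1
    have hmass : ∀ i, 0 ≤ mass v f Q i := fun i =>
      div_nonneg (integral_nonneg fun _ => norm_nonneg _) hV.le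
    have h1 : ENNReal.ofReal (∏ i, mass v f Q i) ≤
        ENNReal.ofReal ((3 ^ d) ^ (m + 1)) * ∏ i, cubeAverage 1 (boxCube v 1 Q) (f i) := by
      rw [ENNReal.ofReal_prod_of_nonneg fun i _ => hmass i]
      refine (Finset.prod_le_prod' fun i _ =>
        enorm_integral_loc_le f Q i (hf i).meas).trans (le_of_eq ?_)
      rw [Finset.prod_mul_distrib, Finset.prod_const, Finset.card_univ, Fintype.card_fin,
        ENNReal.ofReal_pow (p := 3 ^ d) (by positivity)]
    have h2 : ENNReal.ofReal (vol d Q.1) ≤ volume (boxCube v 1 Q).toSet := by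
      rw [boxCube_toSet, ← volume_box_zero (v := v)]
      exact measure_mono (box_mono (by norm_num) Q)
    simp only [ha]
    rw [ENNReal.ofReal_mul (p := stepConst d m ε * (A + B)) (by positivity),
      ENNReal.ofReal_mul (p := vol d Q.1) hV.le]
    calc _ ≤ ENNReal.ofReal (stepConst d m ε * (A + B)) * (volume (boxCube v 1 Q).toSet *
          (ENNReal.ofReal ((3 ^ d) ^ (m + 1)) * ∏ i, cubeAverage 1 (boxCube v 1 Q) (f i))) := by
          gcongr
      _ = _ := by
          have : stepConst d m ε * (3 ^ d) ^ (m + 1) * (A + B) =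
            stepConst d m ε * (A + B) * (3 ^ d) ^ (m + 1) := by ring
          rw [this, ENNReal.ofReal_mul (p := stepConst d m ε * (A + B)) (by positivity)]
          ring
  calc ∑' R : S, a R ≤ ∑' R : S, ENNReal.ofReal (stepConst d m ε * (3 ^ d) ^ (m + 1) * (A + B)) *
      (volume (boxCube v 1 R.1).toSet * ∏ i, cubeAverage 1 (boxCube v 1 R.1) (f i)) :=
        ENNReal.tsum_le_tsum fun R => hterm R
    _ = ENNReal.ofReal (stepConst d m ε * (3 ^ d) ^ (m + 1) * (A + B)) *
        PSF (boxCube v 1 '' S) (fun _ => 1) f := by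
        rw [ENNReal.tsum_mul_left, PSF]
        congr 1
        exact (tsum_image (fun Q : Cube d => volume Q.toSet * ∏ i, cubeAverage 1 Q (f i))
          (boxCube_injective v 1).injOn).symm
    _ ≤ _ := by
        gcongr
        exact le_iSup₂ (f := fun S (_ : IsSparse (sparsity d) S) => PSF S (fun _ => 1) f) _ hsparse

end

section

variable {d m : ℕ}

/-! ### The pieces of a Calderón–Zygmund kernel -/

lemma norm_sub_le_spread {n : ℕ} (x : Fin n → Space d) (i j : Fin n) : ‖x i - x j‖ ≤ spread x :=
  le_ciSup (f := fun ij : Fin n × Fin n => ‖x ij.1 - x ij.2‖) (Set.finite_range _).bddAbove (i, j)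

lemma spread_le {x : Fin (m + 1) → Space d} {c : ℝ} (h : ∀ i j, ‖x i - x j‖ ≤ c) : spread x ≤ c :=
  ciSup_le fun ij => h ij.1 ij.2

lemma spread_nonneg (x : Fin (m + 1) → Space d) : 0 ≤ spread x :=
  (norm_nonneg _).trans (norm_sub_le_spread x 0 0)

lemma spread_smul {c : ℝ} (hc : 0 ≤ c) (x : Fin (m + 1) → Space d) :
    spread (c • x) = c * spread x := by
  unfold spread
  rw [Real.mul_iSup_of_nonneg hc]
  refine iSup_congr fun ij => ?_
  rw [Pi.smul_apply, Pi.smul_apply, ← smul_sub, norm_smul, Real.norm_of_nonneg hc]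

lemma spread_update_le (x : Fin (m + 1) → Space d) (j : Fin (m + 1)) (y : Space d) :
    spread (Function.update x j y) ≤ spread x + ‖x j - y‖ := by
  refine spread_le fun a b => ?_
  rcases eq_or_ne a j with rfl | ha <;> rcases eq_or_ne b a with rfl | hb
  · simp only [sub_self, norm_zero]
    have := spread_nonneg x; positivity
  · rw [Function.update_self, Function.update_of_ne hb, norm_sub_rev]
    refine (norm_sub_le_norm_sub_add_norm_sub _ (x a) _).trans (add_le_add ?_ le_rfl)
    exact norm_sub_le_spread x b a
  · simp only [sub_self, norm_zero]
    have := spread_nonneg x; positivity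
  · rw [Function.update_of_ne ha]
    rcases eq_or_ne b j with rfl | hbj
    · rw [Function.update_self]
      exact (norm_sub_le_norm_sub_add_norm_sub _ (x b) _).trans
        (add_le_add (norm_sub_le_spread x a b) le_rfl)
    · rw [Function.update_of_ne hbj]
      exact (norm_sub_le_spread x a b).trans (le_add_of_nonneg_right (norm_nonneg _))

lemma spread_le_sum (x : Fin (m + 1) → Space d) (j : Fin (m + 1)) :
    spread x ≤ ∑ k, ‖x k - x j‖ := by
  refine spread_le fun a b => ?_
  rcases eq_or_ne a b with rfl | hab
  · simpa using Finset.sum_nonneg fun k _ => norm_nonneg (x k - x j)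
  · calc ‖x a - x b‖ ≤ ‖x a - x j‖ + ‖x b - x j‖ := by
          rw [norm_sub_rev (x b)]; exact norm_sub_le_norm_sub_add_norm_sub _ _ _
      _ = ∑ k ∈ {a, b}, ‖x k - x j‖ :=
          (Finset.sum_pair (f := fun k => ‖x k - x j‖) hab).symm
      _ ≤ _ := Finset.sum_le_sum_of_subset_of_nonneg (Finset.subset_univ _)
          fun _ _ _ => norm_nonneg _

/-- Being translation invariant, the cutoff need not have compact support. Translating so that `x 0
= 0` brings every point of spread at most 1 into a compact ball, which bounds the function and its
derivative. -/
lemma IsScaleCutoff.exists_bound {φ : (Fin (m + 1) → Space d) → ℝ} (hφ : IsScaleCutoff φ) :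
    ∃ M : ℝ, 0 ≤ M ∧ (∀ x, |φ x| ≤ M) ∧
      ∀ x j y, |φ x - φ (Function.update x j y)| ≤ M * ‖x j - y‖ := by
  obtain ⟨δ, hδ, hsupp⟩ := hφ.support
  have hC : IsCompact (Metric.closedBall (0 : Fin (m + 1) → Space d) 1) := isCompact_closedBall 0 1
  have hmem : ∀ x : Fin (m + 1) → Space d, spread x ≤ 1 →
      (fun i => x i + -x 0) ∈ Metric.closedBall (0 : Fin (m + 1) → Space d) 1 := fun x hx => by
    rw [mem_closedBall_zero_iff, pi_norm_le_iff_of_nonneg zero_le_one]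
    intro i
    rw [← sub_eq_add_neg]
    exact (norm_sub_le_spread x i 0).trans hx
  have hdiff : Differentiable ℝ φ := hφ.smooth.differentiable (by simp)
  obtain ⟨M₁, hM₁⟩ := hC.exists_bound_of_continuousOn hφ.smooth.continuous.continuousOn
  obtain ⟨M₂, hM₂⟩ := hC.exists_bound_of_continuousOn
    (hφ.smooth.continuous_fderiv (by simp)).continuousOn
  have hM₁0 : 0 ≤ M₁ := (norm_nonneg _).trans (hM₁ 0 (by simp))
  have hM₂0 : 0 ≤ M₂ := (norm_nonneg _).trans (hM₂ 0 (by simp))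
  have hb : ∀ x, |φ x| ≤ M₁ := fun x => by
    by_cases hx : φ x = 0
    · simpa [hx] using hM₁0
    · rw [← hφ.translation x (-x 0)]
      exact hM₁ _ (hmem x (hsupp x hx).2)
  have hfd : ∀ x, ‖fderiv ℝ φ x‖ ≤ M₂ := fun x => by
    by_cases hx : spread x ≤ 1
    · have e : fderiv ℝ φ x = fderiv ℝ φ (x + fun _ => -x 0) := by
        rw [← fderiv_comp_add_right]
        congr 1
        ext z
        exact (hφ.translation z (-x 0)).symm
      rw [e]
      exact hM₂ _ (hmem x hx)
    -- Where the spread exceeds 1 the cutoff vanishes in a neighbourhood, hence so does its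
    -- derivative.
    · have hex : ∃ a b, 1 < ‖x a - x b‖ := by
        by_contra! h
        exact hx (spread_le h)
      obtain ⟨a, b, hab⟩ := hex
      have hev : φ =ᶠ[𝓝 x] fun _ => 0 := by
        have ho : IsOpen {z : Fin (m + 1) → Space d | 1 < ‖z a - z b‖} :=
          isOpen_lt continuous_const (by fun_prop)
        filter_upwards [ho.mem_nhds hab] with z hz
        by_contra hz'
        exact absurd ((norm_sub_le_spread z a b).trans (hsupp z hz').2) (not_le.2 hz)
      rw [hev.fderiv_eq]
      simpa using hM₂0
  refine ⟨max M₁ M₂, le_max_of_le_left hM₁0, fun x => (hb x).trans (le_max_left _ _),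
    fun x j y => ?_⟩
  have h1 := convex_univ.norm_image_sub_le_of_norm_fderiv_le (𝕜 := ℝ) (f := φ)
    (fun z _ => hdiff z) (fun z _ => hfd z) (Set.mem_univ (Function.update x j y)) (Set.mem_univ x)
  have h2 : ‖x - Function.update x j y‖ ≤ ‖x j - y‖ := by
    rw [pi_norm_le_iff_of_nonneg (norm_nonneg _)]
    intro i
    rcases eq_or_ne i j with rfl | hi
    · simp
    · simp [hi]
  calc |φ x - φ (Function.update x j y)| ≤ M₂ * ‖x - Function.update x j y‖ := h1
    _ ≤ max M₁ M₂ * ‖x j - y‖ := by gcongr; exact le_max_right _ _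

/-- The pieces of a Calderón–Zygmund kernel are kernels at scale `2^s`. -/
theorem IsScaleCutoff.exists_scaleKernel {φ : (Fin (m + 1) → Space d) → ℝ} (hφ : IsScaleCutoff φ)
    {ε : ℝ} (hε : 0 < ε) (hε1 : ε ≤ 1) :
    ∃ C : ℝ, 0 ≤ C ∧ ∀ (K : (Fin (m + 1) → Space d) → ℂ) (A : ℝ≥0), IsCZKernel ε A K →
      ∀ v : Space d, ScaleKernel v ε (C * A) (kernelPiece φ K) := by
  obtain ⟨δ, hδ, hsupp⟩ := hφ.support
  obtain ⟨M, hM0, hMb, hMl⟩ := hφ.exists_bound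
  -- Displacements of relative size at least `θ` are handled by the triangle inequality. Below `θ`
  -- the displacement is at most half the lower bound `δ` of the spread, even after multiplication
  -- by `m + 1`, so the smoothness hypothesis on the kernel applies.
  set θ : ℝ := min 1 (δ / (2 * (m + 1))) with hθ
  have hθ0 : 0 < θ := lt_min one_pos (by positivity)
  set C₁ : ℝ := M / δ ^ (m * d) with hC₁
  set C₂ : ℝ := 2 * C₁ / θ ^ ε with hC₂
  set C₃ : ℝ := M / (δ / 2) ^ (m * d) with hC₃
  set C₄ : ℝ := M / (δ / 2) ^ ((m : ℝ) * d + ε) with hC₄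
  have hC₁0 : 0 ≤ C₁ := by positivity
  have hC₂0 : 0 ≤ C₂ := by positivity
  have hC₃0 : 0 ≤ C₃ := by positivity
  have hC₄0 : 0 ≤ C₄ := by positivity
  refine ⟨C₁ + C₂ + C₃ + C₄, by positivity, fun K A hK v => ?_⟩
  have hV : ∀ s : ℤ, vol d s ^ m = ((2 : ℝ) ^ s) ^ (m * d) := fun s => by
    rw [vol, ← pow_mul, mul_comm]
  have hsp : ∀ (s : ℤ) (x : Fin (m + 1) → Space d), φ ((2 : ℝ) ^ (-s) • x) ≠ 0 →
      δ * 2 ^ s ≤ spread x ∧ spread x ≤ 2 ^ s := fun s x hx => by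
    have h := hsupp _ hx
    have h2 : (0 : ℝ) < 2 ^ s := by positivity
    rw [spread_smul (by positivity), zpow_neg, ← div_eq_inv_mul, le_div_iff₀ h2, div_le_one h2] at h
    exact h
  have hKsize : ∀ (s : ℤ) (x : Fin (m + 1) → Space d) (r : ℝ), 0 < r → r * 2 ^ s ≤ spread x →
      ‖K x‖ ≤ A / r ^ (m * d) / ((2 : ℝ) ^ s) ^ (m * d) := fun s x r hr hx => by
    have h2 : (0 : ℝ) < r * 2 ^ s := by positivity
    refine (hK.size x (h2.trans_le hx).ne').trans ?_
    rw [div_div, ← mul_pow]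
    gcongr
  have hsize : ∀ s x, ‖kernelPiece φ K s x‖ ≤ C₁ * A / ((2 : ℝ) ^ s) ^ (m * d) := fun s x => by
    rw [kernelPiece, norm_mul, Complex.norm_real, Real.norm_eq_abs]
    by_cases hx : φ ((2 : ℝ) ^ (-s) • x) = 0
    · rw [hx, abs_zero, zero_mul]; positivity
    · calc _ ≤ M * (A / δ ^ (m * d) / ((2 : ℝ) ^ s) ^ (m * d)) := by
            gcongr
            · exact hMb _
            · exact hKsize s x δ hδ (hsp s x hx).1
        _ = _ := by rw [hC₁]; ring
  refine ⟨fun s x => ?_, fun s j x y => ?_, fun s x hx i j => ?_⟩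
  · refine (hsize s x).trans ?_
    rw [hV]
    gcongr
    linarith
  · have h2 : (0 : ℝ) < 2 ^ s := by positivity
    set x' := Function.update x j y with hx'
    set t := ‖x j - y‖ with ht
    have ht0 : 0 ≤ t := norm_nonneg _
    set τ := t / (2 : ℝ) ^ s with hτ
    have hτ0 : 0 ≤ τ := by positivity
    have hτε : 0 ≤ τ ^ ε := by positivity
    have hx'j : ‖x' j - x j‖ = t := by rw [hx', Function.update_self, norm_sub_rev]
    set D := ((2 : ℝ) ^ s) ^ (m * d) with hD
    have hD0 : 0 < D := by positivity
    have hgoal : ∀ c : ℝ, c ≤ C₁ + C₂ + C₃ + C₄ →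
        ‖kernelPiece φ K s x - kernelPiece φ K s x'‖ ≤ c * A / D * τ ^ ε →
        ‖kernelPiece φ K s x - kernelPiece φ K s x'‖ ≤
          (C₁ + C₂ + C₃ + C₄) * A / vol d s ^ m * τ ^ ε := fun c hc h => by
      refine h.trans ?_
      rw [hV]
      gcongr
    by_cases hbig : θ ≤ τ
    · refine hgoal C₂ (by linarith) ?_
      have h1 : 1 ≤ τ ^ ε / θ ^ ε := by
        rw [one_le_div (by positivity)]
        exact Real.rpow_le_rpow hθ0.le hbig hε.le
      calc _ ≤ ‖kernelPiece φ K s x‖ + ‖kernelPiece φ K s x'‖ := norm_sub_le _ _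
        _ ≤ C₁ * A / D + C₁ * A / D := add_le_add (hsize s x) (hsize s x')
        _ = 2 * C₁ * A / D * 1 := by ring
        _ ≤ 2 * C₁ * A / D * (τ ^ ε / θ ^ ε) := by gcongr
        _ = _ := by rw [hC₂]; ring
    · push Not at hbig
      by_cases hzero : φ ((2 : ℝ) ^ (-s) • x) = 0 ∧ φ ((2 : ℝ) ^ (-s) • x') = 0
      · refine hgoal 0 (by positivity) ?_
        rw [kernelPiece, kernelPiece, hzero.1, hzero.2]
        simp
      · have hτ1 : τ ≤ 1 := hbig.le.trans (min_le_left _ _)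
        have hm1 : (0 : ℝ) < m + 1 := by positivity
        have htδ : t * (m + 1) ≤ δ / 2 * 2 ^ s := by
          have h3 : τ ≤ δ / (2 * (m + 1)) := hbig.le.trans (min_le_right _ _)
          rw [hτ, div_le_div_iff₀ h2 (by positivity)] at h3
          nlinarith
        have htδ' : t ≤ δ / 2 * 2 ^ s := by
          have : (0 : ℝ) ≤ m := by positivity
          nlinarith
        -- Only one of `x` and `x'` need lie where the cutoff is nonzero; the other has moved by at
        -- most half of `δ 2^s`.
        have hspread : δ / 2 * 2 ^ s ≤ spread x := by
          by_cases hx0 : φ ((2 : ℝ) ^ (-s) • x) = 0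
          · have h4 := (hsp s x' (fun h => hzero ⟨hx0, h⟩)).1
            have h5 := spread_update_le x j y
            linarith
          · have h4 := (hsp s x hx0).1
            nlinarith
        have hKdiff : ‖K x - K x'‖ ≤ A / (δ / 2) ^ ((m : ℝ) * d + ε) / D * τ ^ ε := by
          have h3 : t ≤ 1 / ((m : ℝ) + 1) * ∑ k, ‖x k - x j‖ := by
            rw [one_div, ← div_eq_inv_mul, le_div_iff₀ hm1]
            exact htδ.trans (hspread.trans (spread_le_sum x j))
          refine (hK.smooth j x y h3).trans ?_
          have h6 : (δ / 2 * 2 ^ s) ^ ((m : ℝ) * d + ε) ≤ spread x ^ ((m : ℝ) * d + ε) :=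
            Real.rpow_le_rpow (by positivity) hspread (by positivity)
          have h7 : (δ / 2 * (2 : ℝ) ^ s) ^ ((m : ℝ) * d + ε) =
              (δ / 2) ^ ((m : ℝ) * d + ε) * (D * ((2 : ℝ) ^ s) ^ ε) := by
            rw [Real.mul_rpow (by positivity) h2.le, Real.rpow_add h2 _ ε, hD]
            congr 2
            rw [← Real.rpow_natCast]
            push_cast
            rfl
          rw [h7] at h6
          calc A * t ^ ε / spread x ^ ((m : ℝ) * d + ε)
              ≤ A * t ^ ε / ((δ / 2) ^ ((m : ℝ) * d + ε) * (D * ((2 : ℝ) ^ s) ^ ε)) := by gcongr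
            _ = _ := by
                rw [hτ, Real.div_rpow ht0 h2.le]
                field_simp
        have hφdiff : |φ ((2 : ℝ) ^ (-s) • x) - φ ((2 : ℝ) ^ (-s) • x')| ≤ M * τ ^ ε := by
          have e : (2 : ℝ) ^ (-s) • x' =
              Function.update ((2 : ℝ) ^ (-s) • x) j ((2 : ℝ) ^ (-s) • y) := by
            ext i : 1
            rcases eq_or_ne i j with rfl | hi
            · simp [hx']
            · simp [hx', hi]
          rw [e]
          refine (hMl _ j _).trans ?_
          have e2 : ‖((2 : ℝ) ^ (-s) • x) j - (2 : ℝ) ^ (-s) • y‖ = τ := by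
            rw [Pi.smul_apply, ← smul_sub, norm_smul, Real.norm_of_nonneg (by positivity), hτ,
              zpow_neg, div_eq_inv_mul]
          rw [e2]
          gcongr
          calc τ = τ ^ (1 : ℝ) := (Real.rpow_one _).symm
            _ ≤ τ ^ ε := Real.rpow_le_rpow_of_exponent_ge' hτ0 hτ1 hε.le hε1
        refine hgoal (C₃ + C₄) (by linarith) ?_
        -- Product rule: smoothness of the cutoff meets the size of `K` at `x`, and boundedness of
        -- the cutoff meets the smoothness of `K`.
        have e : kernelPiece φ K s x - kernelPiece φ K s x' =
            ((φ ((2 : ℝ) ^ (-s) • x) - φ ((2 : ℝ) ^ (-s) • x') : ℝ) : ℂ) * K x +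
              (φ ((2 : ℝ) ^ (-s) • x') : ℂ) * (K x - K x') := by
          unfold kernelPiece; push_cast; ring
        rw [e]
        refine (norm_add_le _ _).trans ?_
        rw [norm_mul, norm_mul, Complex.norm_real, Complex.norm_real, Real.norm_eq_abs,
          Real.norm_eq_abs]
        calc _ ≤ M * τ ^ ε * (A / (δ / 2) ^ (m * d) / D) +
              M * (A / (δ / 2) ^ ((m : ℝ) * d + ε) / D * τ ^ ε) := by
              gcongr
              · exact hKsize s x (δ / 2) (by positivity) hspread
              · exact hMb _
          _ = _ := by rw [hC₃, hC₄]; ring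
  · refine near_of_norm_sub_le ((norm_sub_le_spread x i j).trans (hsp s x fun h => hx ?_).2)
    rw [kernelPiece, h, Complex.ofReal_zero, zero_mul]

lemma ScaleKernel.ite {v : Space d} {ε A : ℝ} {κ : ℤ → (Fin (m + 1) → Space d) → ℂ}
    (hκ : ScaleKernel v ε A κ) (p : ℤ → Prop) [DecidablePred p] :
    ScaleKernel v ε A fun s => if p s then κ s else 0 := by
  have hA := hκ.nonneg
  refine ⟨fun s x => ?_, fun s j x y => ?_, fun s x hx => ?_⟩
  · have := vol_pos d s
    split_ifs
    · exact hκ.size s x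
    · simp only [Pi.zero_apply, norm_zero]; positivity
  · have := vol_pos d s
    split_ifs
    · exact hκ.holder s j x y
    · simp only [Pi.zero_apply, sub_zero, norm_zero]; positivity
  · split_ifs at hx with h
    · exact hκ.near s x hx
    · exact absurd rfl hx

end

section

variable {d m : ℕ} {v : Space d}

/-! ### Forms given by bounded continuous kernels -/

lemma prod_update_add (h : Fin (m + 1) → Space d → ℂ) (j : Fin (m + 1)) (u w : Space d → ℂ)
    (x : Fin (m + 1) → Space d) :
    ∏ i, Function.update h j (u + w) i (x i) =
      ∏ i, Function.update h j u i (x i) + ∏ i, Function.update h j w i (x i) := by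
  have key : ∀ a : Space d → ℂ, (fun i => Function.update h j a i (x i)) =
      Function.update (fun i => h i (x i)) j (a (x j)) := fun a => by
    ext i
    exact Function.apply_update (fun i (f : Space d → ℂ) => f (x i)) h j a i
  have := (MultilinearMap.mkPiAlgebra ℂ (Fin (m + 1)) ℂ).map_update_add
    (fun i => h i (x i)) j (u (x j)) (w (x j))
  simp only [MultilinearMap.mkPiAlgebra_apply] at this
  have k := fun a => congrArg (fun f : Fin (m + 1) → ℂ => ∏ i, f i) (key a)
  simp only at k
  rw [k, k, k, ← this]
  rfl

section Bounded

variable {Ω : Set (Space d)} {G : (Fin (m + 1) → Space d) → ℂ} {a : ℝ}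

lemma integral_mul_prod_update_add (hΩ : volume Ω ≠ ∞) (hG : Continuous G) (ha : ∀ x, ‖G x‖ ≤ a)
    {h : Fin (m + 1) → Space d → ℂ} (hh : ∀ i, Adm Ω (h i)) (j : Fin (m + 1)) {u w : Space d → ℂ}
    (hu : Adm Ω u) (hw : Adm Ω w) :
    ∫ x : Fin (m + 1) → Space d, G x * ∏ i, Function.update h j (u + w) i (x i) =
      (∫ x : Fin (m + 1) → Space d, G x * ∏ i, Function.update h j u i (x i)) +
        ∫ x : Fin (m + 1) → Space d, G x * ∏ i, Function.update h j w i (x i) := by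
  rw [← integral_add]
  · exact integral_congr_ae (Eventually.of_forall fun x => by simp only [prod_update_add, mul_add])
  · exact integrable_mul_prod hG.aestronglyMeasurable ha fun i =>
      (adm_update hh j hu i).integrable hΩ
  · exact integrable_mul_prod hG.aestronglyMeasurable ha fun i =>
      (adm_update hh j hw i).integrable hΩ

lemma tendsto_integral_mul_prod (hΩ : volume Ω ≠ ∞) (hG : Continuous G) (ha : ∀ x, ‖G x‖ ≤ a)
    {ι : Type*} {l : Filter ι} [l.IsCountablyGenerated] {H : ι → Fin (m + 1) → Space d → ℂ}
    {h : Fin (m + 1) → Space d → ℂ} {M : ℝ} (hH : ∀ n i, Adm Ω (H n i))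
    (hM : ∀ n i x, ‖H n i x‖ ≤ M)
    (hlim : ∀ i x, Tendsto (fun n => H n i x) l (𝓝 (h i x))) :
    Tendsto (fun n => ∫ x : Fin (m + 1) → Space d, G x * ∏ i, H n i (x i)) l
      (𝓝 (∫ x : Fin (m + 1) → Space d, G x * ∏ i, h i (x i))) := by
  set Z := toMeasurable volume Ω with hZ
  have hZm : MeasurableSet Z := measurableSet_toMeasurable _ _
  have hZf : volume Z ≠ ∞ := by rwa [hZ, measure_toMeasurable]
  have ha0 : 0 ≤ a := (norm_nonneg _).trans (ha 0)
  refine tendsto_integral_filter_of_dominated_convergence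
    (fun x => a * ∏ i : Fin (m + 1), Z.indicator (fun _ => M) (x i)) ?_ ?_ ?_ ?_
  · exact Eventually.of_forall fun n => (integrable_mul_prod hG.aestronglyMeasurable ha fun i =>
      (hH n i).integrable hΩ).1
  · refine Eventually.of_forall fun n => Eventually.of_forall fun x => ?_
    rw [norm_mul, norm_prod]
    refine mul_le_mul (ha x) (Finset.prod_le_prod (fun _ _ => norm_nonneg _) fun i _ => ?_)
      (Finset.prod_nonneg fun _ _ => norm_nonneg _) ha0
    by_cases hx : x i ∈ Z
    · rw [Set.indicator_of_mem hx]; exact hM n i _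
    · rw [Set.indicator_of_notMem hx, (hH n i).supp _ fun hx' => hx (subset_toMeasurable _ _ hx'),
        norm_zero]
  · refine Integrable.const_mul ?_ _
    refine Integrable.fintype_prod (μ := fun _ => volume)
      (f := fun _ : Fin (m + 1) => Z.indicator fun _ => M) fun _ => ?_
    exact (integrable_indicator_iff hZm).2 (integrableOn_const hZf)
  · refine Eventually.of_forall fun x => ?_
    exact (tendsto_finsetProd _ fun i _ => hlim i (x i)).const_mul _

end Bounded

/-! ### Truncated forms -/

section Trunc

variable {Ω : Set (Space d)} {ε A : ℝ} {φ : (Fin (m + 1) → Space d) → ℝ}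
  {K : (Fin (m + 1) → Space d) → ℂ} {r : Fin m → ℝ≥0∞} {α : ℝ≥0∞}

/-- The kernel of a truncated form. -/
def truncKernel (φ : (Fin (m + 1) → Space d) → ℝ) (K : (Fin (m + 1) → Space d) → ℂ)
    (μ ν : ℤ) (x : Fin (m + 1) → Space d) : ℂ :=
  ∑ s ∈ Finset.Ioo μ ν, kernelPiece φ K s x

lemma truncForm_eq (μ ν : ℤ) (h : Fin (m + 1) → Space d → ℂ) : truncForm φ K μ ν h =
    ∫ x : Fin (m + 1) → Space d, truncKernel φ K μ ν x * ∏ i, h i (x i) := rfl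

lemma ScaleKernel.continuous_truncKernel (hκ : ScaleKernel v ε A (kernelPiece φ K)) (hε : 0 < ε)
    (μ ν : ℤ) : Continuous (truncKernel φ K μ ν) :=
  continuous_finsetSum _ fun s _ => hκ.continuous hε s

lemma ScaleKernel.exists_norm_truncKernel_le (hκ : ScaleKernel v ε A (kernelPiece φ K))
    (μ ν : ℤ) : ∃ a : ℝ, ∀ x, ‖truncKernel φ K μ ν x‖ ≤ a :=
  ⟨∑ s ∈ Finset.Ioo μ ν, A / vol d s ^ m, fun x =>
    (norm_sum_le _ _).trans (Finset.sum_le_sum fun s _ => hκ.size s x)⟩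

lemma truncForm_update_add (hκ : ScaleKernel v ε A (kernelPiece φ K)) (hε : 0 < ε) (μ ν : ℤ)
    (hΩ : volume Ω ≠ ∞) {h : Fin (m + 1) → Space d → ℂ} (hh : ∀ i, Adm Ω (h i)) (j : Fin (m + 1))
    {u w : Space d → ℂ} (hu : Adm Ω u) (hw : Adm Ω w) :
    truncForm φ K μ ν (Function.update h j (u + w)) =
      truncForm φ K μ ν (Function.update h j u) + truncForm φ K μ ν (Function.update h j w) := by
  obtain ⟨a, ha⟩ := hκ.exists_norm_truncKernel_le μ ν
  exact integral_mul_prod_update_add hΩ (hκ.continuous_truncKernel hε μ ν) ha hh j hu hw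

lemma tendsto_truncForm (hκ : ScaleKernel v ε A (kernelPiece φ K)) (hε : 0 < ε) (μ ν : ℤ)
    (hΩ : volume Ω ≠ ∞) {ι : Type*} {l : Filter ι} [l.IsCountablyGenerated]
    {H : ι → Fin (m + 1) → Space d → ℂ}
    {h : Fin (m + 1) → Space d → ℂ} {M : ℝ} (hH : ∀ n i, Adm Ω (H n i))
    (hM : ∀ n i x, ‖H n i x‖ ≤ M)
    (hlim : ∀ i x, Tendsto (fun n => H n i x) l (𝓝 (h i x))) :
    Tendsto (fun n => truncForm φ K μ ν (H n)) l (𝓝 (truncForm φ K μ ν h)) := by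
  obtain ⟨a, ha⟩ := hκ.exists_norm_truncKernel_le μ ν
  exact tendsto_integral_mul_prod hΩ (hκ.continuous_truncKernel hε μ ν) ha hH hM hlim

/-- Peeling off the largest scale. -/
lemma truncForm_succ_right (hκ : ScaleKernel v ε A (kernelPiece φ K)) (hε : 0 < ε)
    {μ ν : ℤ} (hμν : μ < ν) (hΩ : volume Ω ≠ ∞) {h : Fin (m + 1) → Space d → ℂ}
    (hh : ∀ i, Adm Ω (h i)) : truncForm φ K μ (ν + 1) h =
      truncForm φ K μ ν h + ∫ x : Fin (m + 1) → Space d, kernelPiece φ K ν x * ∏ i, h i (x i) := by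
  obtain ⟨a, ha⟩ := hκ.exists_norm_truncKernel_le μ ν
  rw [truncForm_eq, truncForm_eq, ← integral_add]
  · refine integral_congr_ae (Eventually.of_forall fun x => ?_)
    have : Finset.Ioo μ (ν + 1) = insert ν (Finset.Ioo μ ν) := by
      ext s; simp only [Finset.mem_Ioo, Finset.mem_insert]; omega
    simp only [truncKernel]
    rw [this, Finset.sum_insert (by simp)]
    ring
  · exact integrable_mul_prod (hκ.continuous_truncKernel hε μ ν).aestronglyMeasurable ha fun i =>
      (hh i).integrable hΩ
  · exact integrable_mul_prod (hκ.continuous hε ν).aestronglyMeasurable (hκ.size ν) fun i =>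
      (hh i).integrable hΩ

/-- Peeling off the smallest scale. -/
lemma truncForm_pred_left (hκ : ScaleKernel v ε A (kernelPiece φ K)) (hε : 0 < ε)
    {μ ν : ℤ} (hμν : μ < ν) (hΩ : volume Ω ≠ ∞) {h : Fin (m + 1) → Space d → ℂ}
    (hh : ∀ i, Adm Ω (h i)) : truncForm φ K (μ - 1) ν h =
      truncForm φ K μ ν h + ∫ x : Fin (m + 1) → Space d, kernelPiece φ K μ x * ∏ i, h i (x i) := by
  obtain ⟨a, ha⟩ := hκ.exists_norm_truncKernel_le μ ν
  rw [truncForm_eq, truncForm_eq, ← integral_add]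
  · refine integral_congr_ae (Eventually.of_forall fun x => ?_)
    have : Finset.Ioo (μ - 1) ν = insert μ (Finset.Ioo μ ν) := by
      ext s; simp only [Finset.mem_Ioo, Finset.mem_insert]; omega
    simp only [truncKernel]
    rw [this, Finset.sum_insert (by simp)]
    ring
  · exact integrable_mul_prod (hκ.continuous_truncKernel hε μ ν).aestronglyMeasurable ha fun i =>
      (hh i).integrable hΩ
  · exact integrable_mul_prod (hκ.continuous hε μ).aestronglyMeasurable (hκ.size μ) fun i =>
      (hh i).integrable hΩ

lemma truncForm_of_le {μ ν : ℤ} (h : ν ≤ μ + 1) (f : Fin (m + 1) → Space d → ℂ) :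
    truncForm φ K μ ν f = 0 := by
  have : Finset.Ioo μ ν = ∅ := by
    ext s; simp only [Finset.mem_Ioo, Finset.notMem_empty, iff_false]; omega
  simp [truncForm, this]

/-- A truncated form vanishes if the kernel vanishes on the support of the product. -/
lemma truncForm_eq_zero {μ ν : ℤ} {h : Fin (m + 1) → Space d → ℂ}
    (hz : ∀ x, (∀ i, h i (x i) ≠ 0) → ∀ s, μ < s → s < ν → kernelPiece φ K s x = 0) :
    truncForm φ K μ ν h = 0 := by
  rw [truncForm_eq, ← integral_zero (Fin (m + 1) → Space d) ℂ]
  refine integral_congr_ae (Eventually.of_forall fun x => ?_)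
  simp only
  by_cases hx : ∀ i, h i (x i) ≠ 0
  · rw [truncKernel, Finset.sum_eq_zero, zero_mul]
    intro s hs
    rw [Finset.mem_Ioo] at hs
    exact hz x hx s hs.1 hs.2
  · push Not at hx
    obtain ⟨i, hi⟩ := hx
    rw [Finset.prod_eq_zero (Finset.mem_univ i) hi, mul_zero]

lemma truncForm_smul (μ ν : ℤ) (c : Fin (m + 1) → ℂ) (h : Fin (m + 1) → Space d → ℂ) :
    truncForm φ K μ ν (fun i => c i • h i) = (∏ i, c i) * truncForm φ K μ ν h := by
  rw [truncForm_eq, truncForm_eq, ← integral_const_mul]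
  refine integral_congr_ae (Eventually.of_forall fun x => ?_)
  simp only [Pi.smul_apply, smul_eq_mul, Finset.prod_mul_distrib]
  ring

lemma one_le_formExponents [∀ i, Fact (1 ≤ r i)] [Fact (1 ≤ α)] (i : Fin (m + 1)) :
    1 ≤ formExponents r α i := by
  refine Fin.lastCases ?_ (fun i => ?_) i
  · rw [formExponents, Fin.snoc_last]
    have := ENNReal.HolderConjugate.conjExponent (Fact.out : 1 ≤ α)
    have h := ENNReal.HolderConjugate.inv_add_inv_eq_one α (ENNReal.conjExponent α)
    rw [← ENNReal.inv_le_one, ← h]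
    exact le_add_self
  · rw [formExponents, Fin.snoc_castSucc]
    exact Fact.out

lemma sum_inv_formExponents [Fact (1 ≤ α)] (hr : ∑ i, (r i)⁻¹ = α⁻¹) :
    ∑ i, (formExponents r α i)⁻¹ = 1 := by
  have := ENNReal.HolderConjugate.conjExponent (Fact.out : 1 ≤ α)
  rw [Fin.sum_univ_castSucc]
  simp only [formExponents, Fin.snoc_last, Fin.snoc_castSucc]
  rw [hr]
  exact ENNReal.HolderConjugate.inv_add_inv_eq_one α (ENNReal.conjExponent α)

/-- The truncation constant bounds the norms of the truncated forms. -/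
lemma enorm_truncForm_le [∀ i, Fact (1 ≤ r i)] [Fact (1 ≤ α)] (μ ν : ℤ)
    {h : Fin (m + 1) → Space d → ℂ} (hh : ∀ i, MemLp (h i) (formExponents r α i) volume) :
    ‖truncForm φ K μ ν h‖ₑ ≤
      truncConst φ K r α * ∏ i, eLpNorm (h i) (formExponents r α i) volume := by
  -- The truncation constant only tests functions of norm at most 1. Nonzero norms are scaled to 1;
  -- if some norm is zero the integrand vanishes almost everywhere.
  by_cases hz : ∃ i, eLpNorm (h i) (formExponents r α i) volume = 0
  · obtain ⟨i, hi⟩ := hz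
    rw [eLpNorm_eq_zero_iff (hh i).1 (zero_lt_one.trans_le (one_le_formExponents i)).ne'] at hi
    have : truncForm φ K μ ν h = 0 := by
      rw [truncForm_eq, ← integral_zero (Fin (m + 1) → Space d) ℂ]
      refine integral_congr_ae ?_
      filter_upwards [(Measure.quasiMeasurePreserving_eval
        (fun _ : Fin (m + 1) => (volume : Measure (Space d))) i).ae hi] with x hx
      have hx : h i (x i) = 0 := hx
      rw [Finset.prod_eq_zero (Finset.mem_univ i) hx, mul_zero]
    rw [this, enorm_zero]
    exact zero_le
  · push Not at hz
    set N : Fin (m + 1) → ℝ≥0∞ := fun i => eLpNorm (h i) (formExponents r α i) volume with hN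
    have hNt : ∀ i, N i ≠ ∞ := fun i => (hh i).eLpNorm_ne_top
    have hNr : ∀ i, ((N i).toReal : ℂ) ≠ 0 := fun i => by
      rw [Ne, Complex.ofReal_eq_zero]
      exact (ENNReal.toReal_pos (hz i) (hNt i)).ne'
    have he : ∀ i, ‖((N i).toReal : ℂ)‖ₑ = N i := fun i => by
      rw [← ofReal_norm, Complex.norm_real, Real.norm_of_nonneg ENNReal.toReal_nonneg,
        ENNReal.ofReal_toReal (hNt i)]
    set g : Fin (m + 1) → Space d → ℂ := fun i => ((N i).toReal : ℂ)⁻¹ • h i with hg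
    have hgh : h = fun i => ((N i).toReal : ℂ) • g i := by
      ext i : 1
      rw [hg]
      simp only [smul_smul]
      rw [mul_inv_cancel₀ (hNr i), one_smul]
    have hle : ‖truncForm φ K μ ν g‖ₑ ≤ truncConst φ K r α := by
      refine le_iSup_of_le μ (le_iSup_of_le ν (le_iSup₂_of_le g ?_ le_rfl))
      refine fun i => ⟨(hh i).const_smul _, ?_⟩
      rw [eLpNorm_const_smul, enorm_inv (hNr i), he]
      exact (ENNReal.inv_mul_cancel (hz i) (hNt i)).le
    rw [hgh, truncForm_smul, enorm_mul, mul_comm]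
    have : ‖∏ i, ((N i).toReal : ℂ)‖ₑ = ∏ i, N i := by
      rw [← ofReal_norm, norm_prod, ENNReal.ofReal_prod_of_nonneg fun _ _ => norm_nonneg _]
      exact Finset.prod_congr rfl fun i _ => by rw [ofReal_norm, he]
    rw [this]
    gcongr

/-- The Hölder bound of the product of the norms of functions on a tripled grid cube. -/
lemma prod_eLpNorm_le {n : ℕ} {e : Fin n → ℝ≥0∞} (he : ∑ i, (e i)⁻¹ = 1) {h : Fin n → Space d → ℂ}
    {P : GridCube d} (hP : ∀ i, ∀ x, x ∉ box v 1 P → h i x = 0) {N : Fin n → ℝ}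
    (hN : ∀ i, 0 ≤ N i) (hb : ∀ i, ∀ᵐ x, ‖h i x‖ ≤ N i) :
    ∏ i, eLpNorm (h i) (e i) volume ≤ ENNReal.ofReal (3 ^ d * vol d P.1 * ∏ i, N i) := by
  have hw : 0 < 3 ^ d * vol d P.1 := by have := vol_pos d P.1; positivity
  set w := 3 ^ d * vol d P.1 with hwdef
  have h1 : ∀ i, eLpNorm (h i) (e i) volume ≤ ENNReal.ofReal (w ^ (e i).toReal⁻¹ * N i) := by
    intro i
    rw [← eLpNorm_restrict_eq_of_support_subset (s := box v 1 P)
      fun x hx => by by_contra hx'; exact hx (hP i x hx')]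
    refine (eLpNorm_le_of_ae_bound (C := N i) (ae_restrict_of_ae (hb i))).trans ?_
    rw [Measure.restrict_apply_univ, volume_box_one, ENNReal.ofReal_rpow_of_pos hw,
      ENNReal.ofReal_mul (by positivity)]
  refine (Finset.prod_le_prod' fun i _ => h1 i).trans ?_
  rw [← ENNReal.ofReal_prod_of_nonneg fun i _ => mul_nonneg (by positivity) (hN i),
    Finset.prod_mul_distrib, ← Real.rpow_sum_of_pos hw]
  -- The powers of the volume multiply to the volume itself. An infinite exponent contributes 0,
  -- since its real value is 0 by convention and so is the inverse of 0.
  have : ∑ i, (e i).toReal⁻¹ = 1 := by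
    simp_rw [← ENNReal.toReal_inv]
    rw [← ENNReal.toReal_sum, he, ENNReal.toReal_one]
    intro i hi h'
    have := (Finset.single_le_sum (f := fun i => (e i)⁻¹) (fun _ _ => zero_le) hi).trans he.le
    simp only [h'] at this
    exact absurd this (by simp)
  rw [this, Real.rpow_one]

lemma Adm.memLp {h : Space d → ℂ} (hh : Adm Ω h) (hΩ : volume Ω ≠ ∞) (p : ℝ≥0∞) :
    MemLp h p volume := by
  obtain ⟨M, hM⟩ := hh.bdd
  have hs : ∀ x, x ∉ toMeasurable volume Ω → h x = 0 := fun x hx =>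
    hh.supp x fun hx' => hx (subset_toMeasurable _ _ hx')
  have : Fact (volume (toMeasurable volume Ω) < ∞) :=
    ⟨by rw [measure_toMeasurable]; exact hΩ.lt_top⟩
  have h1 : MemLp h p (volume.restrict (toMeasurable volume Ω)) :=
    MemLp.of_bound hh.meas.aestronglyMeasurable M (Eventually.of_forall hM)
  rw [← memLp_indicator_iff_restrict (measurableSet_toMeasurable _ _)] at h1
  rwa [Set.indicator_eq_self.2] at h1
  exact fun x hx => by by_contra hx'; exact hx (hs x hx')

lemma norm_truncForm_le [∀ i, Fact (1 ≤ r i)] [Fact (1 ≤ α)] (hr : ∑ i, (r i)⁻¹ = α⁻¹)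
    (hC : truncConst φ K r α ≠ ∞) (hΩ : volume Ω ≠ ∞) (μ ν : ℤ) {h : Fin (m + 1) → Space d → ℂ}
    (hh : ∀ i, Adm Ω (h i))
    {P : GridCube d} (hP : ∀ i, ∀ x, x ∉ box v 1 P → h i x = 0) {N : Fin (m + 1) → ℝ}
    (hN : ∀ i, 0 ≤ N i) (hb : ∀ i, ∀ᵐ x, ‖h i x‖ ≤ N i) :
    ‖truncForm φ K μ ν h‖ ≤ 3 ^ d * (truncConst φ K r α).toReal * vol d P.1 * ∏ i, N i := by
  have h1 := enorm_truncForm_le (φ := φ) (K := K) (r := r) (α := α) μ ν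
    fun i => (hh i).memLp hΩ _
  have h2 := prod_eLpNorm_le (sum_inv_formExponents hr) hP hN hb
  have hp : 0 ≤ ∏ i, N i := Finset.prod_nonneg fun i _ => hN i
  have hv := (vol_pos d P.1).le
  have h3 : ‖truncForm φ K μ ν h‖ₑ ≤
      ENNReal.ofReal ((truncConst φ K r α).toReal * (3 ^ d * vol d P.1 * ∏ i, N i)) := by
    rw [ENNReal.ofReal_mul ENNReal.toReal_nonneg, ENNReal.ofReal_toReal hC]
    exact h1.trans (by gcongr)
  rw [← ofReal_norm, ENNReal.ofReal_le_ofReal_iff (by positivity)] at h3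
  exact h3.trans (le_of_eq (by ring))

/-- The truncated forms with increasing upper truncations are a family of local forms. -/
lemma formFamily_trunc [∀ i, Fact (1 ≤ r i)] [Fact (1 ≤ α)] (hr : ∑ i, (r i)⁻¹ = α⁻¹)
    (hC : truncConst φ K r α ≠ ∞) (hΩ : volume Ω ≠ ∞) (hε : 0 < ε)
    (hκ : ScaleKernel v ε A (kernelPiece φ K)) (μ ν : ℤ) :
    FormFamily v Ω (3 ^ d * (truncConst φ K r α).toReal)
      (fun s => if μ < s ∧ s < ν then kernelPiece φ K s else 0)
      (fun s h => truncForm φ K μ (min s ν) h) where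
  map_add s h j u w hh hu hw := truncForm_update_add hκ hε _ _ hΩ hh j hu hw
  bound s h P N hh hP hN hb := norm_truncForm_le hr hC hΩ _ _ hh hP hN hb
  map_local s h j hh hloc := truncForm_eq_zero fun x hx σ _ hσ => by
    by_contra hk
    exact hloc (x 0) (x j) (hx 0) (hx j)
      ((hκ.near σ x hk 0 j).le_level (hσ.le.trans (min_le_left _ _)))
  cont s ι l _ H h M hH _ hM hlim := tendsto_truncForm hκ hε _ _ hΩ hH hM hlim
  diff s h hh := by
    by_cases hs : μ < s ∧ s < ν
    · rw [min_eq_left (by omega), min_eq_left hs.2.le, truncForm_succ_right hκ hε hs.1 hΩ hh]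
      simp [hs]
    · simp only [hs, if_false, Pi.zero_apply, zero_mul, integral_zero]
      by_cases hν : s < ν
      · rw [truncForm_of_le (by omega), truncForm_of_le (by omega), sub_zero]
      · rw [min_eq_right (by omega), min_eq_right (by omega), sub_self]

end Trunc

end

section

variable {d m : ℕ} {v : Space d}

/-! ### The form of an operator -/

/-- The class of `f` in `L^r`, or zero if `f` is not in `L^r`. -/
def lpClass (r : ℝ≥0∞) (f : Space d → ℂ) : Lp ℂ r (volume : Measure (Space d)) :=
  open Classical in if hf : MemLp f r volume then hf.toLp f else 0

lemma lpClass_eq {r : ℝ≥0∞} {f : Space d → ℂ} (hf : MemLp f r volume) :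
    lpClass r f = hf.toLp f := dif_pos hf

/-! ### Hölder duality and dominated convergence of `L^r` classes -/

section Holder

lemma enorm_integral_mul_le {α : ℝ≥0∞} (hα : 1 ≤ α) {F g : Space d → ℂ}
    (hF : AEStronglyMeasurable F volume) (hg : AEStronglyMeasurable g volume) :
    ‖∫ x, F x * g x‖ₑ ≤ eLpNorm F α volume * eLpNorm g (ENNReal.conjExponent α) volume := by
  have := ENNReal.HolderConjugate.conjExponent hα
  refine (enorm_integral_le_lintegral_enorm _).trans ?_
  have h := eLpNorm_smul_le_mul_eLpNorm (p := α) (q := ENNReal.conjExponent α) (r := 1) hg hF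
  rw [eLpNorm_one_eq_lintegral_enorm] at h
  exact h

lemma integrable_mul_of_conjExponent {α : ℝ≥0∞} (hα : 1 ≤ α) {F g : Space d → ℂ}
    (hF : MemLp F α volume) (hg : MemLp g (ENNReal.conjExponent α) volume) :
    Integrable fun x => F x * g x := by
  have := ENNReal.HolderConjugate.conjExponent hα
  exact memLp_one_iff_integrable.1 (hg.smul (r := 1) hF)

/-- Dominated convergence in `L^r`. -/
lemma tendsto_lpClass {r : ℝ≥0∞} [Fact (1 ≤ r)] (hr : r ≠ ∞) {F : ℕ → Space d → ℂ}
    {f G : Space d → ℂ} (hG : MemLp G r volume) (hF : ∀ n, AEStronglyMeasurable (F n) volume)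
    (hdom : ∀ n, ∀ᵐ x, ‖F n x‖ ≤ ‖G x‖)
    (hlim : ∀ᵐ x, Tendsto (fun n => F n x) atTop (𝓝 (f x))) :
    Tendsto (fun n => lpClass r (F n)) atTop (𝓝 (lpClass r f)) := by
  have hr0 : r ≠ 0 := (zero_lt_one.trans_le (Fact.out : 1 ≤ r)).ne'
  have hrp : 0 < r.toReal := ENNReal.toReal_pos hr0 hr
  have hFL : ∀ n, MemLp (F n) r volume := fun n => hG.mono (hF n) (hdom n)
  have hfm : AEStronglyMeasurable f volume := aestronglyMeasurable_of_tendsto_ae atTop hF hlim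
  have hfG : ∀ᵐ x, ‖f x‖ ≤ ‖G x‖ := by
    filter_upwards [ae_all_iff.2 hdom, hlim] with x h1 h2
    exact le_of_tendsto h2.norm (Eventually.of_forall h1)
  have hfL : MemLp f r volume := hG.mono hfm hfG
  simp_rw [lpClass_eq (hFL _)]
  rw [lpClass_eq hfL, Lp.tendsto_Lp_iff_tendsto_eLpNorm'']
  simp_rw [eLpNorm_eq_lintegral_rpow_enorm_toReal hr0 hr]
  have key : Tendsto (fun n => ∫⁻ x, ‖(F n - f) x‖ₑ ^ r.toReal) atTop (𝓝 (∫⁻ _x : Space d, 0)) := by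
    refine tendsto_lintegral_of_dominated_convergence'
      (fun x => ‖((2 : ℂ) • G) x‖ₑ ^ r.toReal) (fun n => ?_) (fun n => ?_) ?_ ?_
    · exact ((hF n).sub hfm).enorm.pow_const _
    · filter_upwards [hdom n, hfG] with x h1 h2
      refine ENNReal.rpow_le_rpow ?_ hrp.le
      rw [enorm_le_iff_norm_le, Pi.sub_apply, Pi.smul_apply, norm_smul]
      refine (norm_sub_le _ _).trans ?_
      rw [Complex.norm_ofNat]
      linarith
    · exact (lintegral_rpow_enorm_lt_top_of_eLpNorm_lt_top hr0 hr (hG.const_smul (2 : ℂ)).2).ne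
    · filter_upwards [hlim] with x hx
      have h1 : Tendsto (fun n => ‖(F n - f) x‖ₑ) atTop (𝓝 0) := by
        have h2 : Tendsto (fun n => F n x - f x) atTop (𝓝 0) := by
          simpa using hx.sub_const (f x)
        simpa using h2.enorm
      have := (ENNReal.continuous_rpow_const (y := r.toReal)).continuousAt.tendsto.comp h1
      simpa [ENNReal.zero_rpow_of_pos hrp, Function.comp_def] using this
  rw [lintegral_zero] at key
  have := (ENNReal.continuous_rpow_const (y := 1 / r.toReal)).continuousAt.tendsto.comp key
  simpa [ENNReal.zero_rpow_of_pos (inv_pos.2 hrp), Function.comp_def] using this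

end Holder

section Exponents

variable {r : Fin m → ℝ≥0∞} {α : ℝ≥0∞}

lemma memLp_castSucc {h : Fin (m + 1) → Space d → ℂ}
    (hh : ∀ i, MemLp (h i) (formExponents r α i) volume) (i : Fin m) :
    MemLp (h i.castSucc) (r i) volume := by
  simpa [formExponents] using hh i.castSucc

lemma memLp_last {h : Fin (m + 1) → Space d → ℂ}
    (hh : ∀ i, MemLp (h i) (formExponents r α i) volume) :
    MemLp (h (Fin.last m)) (ENNReal.conjExponent α) volume := by
  simpa [formExponents] using hh (Fin.last m)

lemma memLp_formExponents {h : Fin (m + 1) → Space d → ℂ}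
    (hh : ∀ i : Fin m, MemLp (h i.castSucc) (r i) volume)
    (hl : MemLp (h (Fin.last m)) (ENNReal.conjExponent α) volume) (i : Fin (m + 1)) :
    MemLp (h i) (formExponents r α i) volume := by
  refine Fin.lastCases ?_ (fun i => ?_) i
  · simpa [formExponents] using hl
  · simpa [formExponents] using hh i

end Exponents

/-! ### Bounds, additivity and convergence for the form of the operator -/

section OpForm

variable {r : Fin m → ℝ≥0∞} {α : ℝ≥0∞} [∀ i, Fact (1 ≤ r i)] [Fact (1 ≤ α)]
  (T : ContinuousMultilinearMap ℂ (fun i : Fin m => Lp ℂ (r i) (volume : Measure (Space d)))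
    (Lp ℂ α (volume : Measure (Space d))))

/-- The form of `T`, for arbitrary functions. -/
def opForm (h : Fin (m + 1) → Space d → ℂ) : ℂ :=
  ∫ x, T (fun i => lpClass (r i) (h i.castSucc)) x * h (Fin.last m) x

lemma form_eq_opForm {h : Fin (m + 1) → Space d → ℂ}
    (hh : ∀ i : Fin m, MemLp (h i.castSucc) (r i) volume) : form T h hh = opForm T h := by
  unfold form opForm
  simp_rw [lpClass_eq (hh _)]

lemma enorm_opForm_le {h : Fin (m + 1) → Space d → ℂ}
    (hh : ∀ i, MemLp (h i) (formExponents r α i) volume) :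
    ‖opForm T h‖ₑ ≤ ‖T‖ₑ * ∏ i, eLpNorm (h i) (formExponents r α i) volume := by
  refine (enorm_integral_mul_le (α := α) Fact.out (Lp.aestronglyMeasurable _)
    (memLp_last hh).1).trans ?_
  rw [Fin.prod_univ_castSucc, ← mul_assoc]
  have e : eLpNorm (h (Fin.last m)) (formExponents r α (Fin.last m)) volume =
      eLpNorm (h (Fin.last m)) (ENNReal.conjExponent α) volume := by simp [formExponents]
  rw [e]
  gcongr
  rw [← Lp.enorm_def]
  have h1 := ENNReal.ofReal_le_ofReal (T.le_opNorm fun i => lpClass (r i) (h i.castSucc))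
  rw [ENNReal.ofReal_mul (norm_nonneg _), ENNReal.ofReal_prod_of_nonneg fun _ _ => norm_nonneg _,
    ofReal_norm, ofReal_norm] at h1
  refine h1.trans (le_of_eq ?_)
  congr 1
  refine Finset.prod_congr rfl fun i _ => ?_
  rw [ofReal_norm, lpClass_eq (memLp_castSucc hh i), Lp.enorm_toLp]
  simp [formExponents]

lemma norm_opForm_le {Ω : Set (Space d)} (hr : ∑ i, (r i)⁻¹ = α⁻¹) (hΩ : volume Ω ≠ ∞)
    {h : Fin (m + 1) → Space d → ℂ} (hh : ∀ i, Adm Ω (h i))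
    {P : GridCube d} (hP : ∀ i, ∀ x, x ∉ box v 1 P → h i x = 0) {N : Fin (m + 1) → ℝ}
    (hN : ∀ i, 0 ≤ N i) (hb : ∀ i, ∀ᵐ x, ‖h i x‖ ≤ N i) :
    ‖opForm T h‖ ≤ 3 ^ d * ‖T‖ * vol d P.1 * ∏ i, N i := by
  have h1 := enorm_opForm_le T fun i => (hh i).memLp hΩ (formExponents r α i)
  have h2 := prod_eLpNorm_le (sum_inv_formExponents hr) hP hN hb
  have hp : 0 ≤ ∏ i, N i := Finset.prod_nonneg fun i _ => hN i
  have hv := (vol_pos d P.1).le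
  have h3 : ‖opForm T h‖ₑ ≤ ENNReal.ofReal (‖T‖ * (3 ^ d * vol d P.1 * ∏ i, N i)) := by
    rw [ENNReal.ofReal_mul (norm_nonneg _), ofReal_norm]
    exact h1.trans (by gcongr)
  rw [← ofReal_norm, ENNReal.ofReal_le_ofReal_iff (by positivity)] at h3
  exact h3.trans (le_of_eq (by ring))

/-- Dominated convergence for the form of `T`. -/
lemma tendsto_opForm (hr : ∀ i, r i ≠ ∞) {F : ℕ → Fin (m + 1) → Space d → ℂ}
    {f G : Fin (m + 1) → Space d → ℂ} (hG : ∀ i, MemLp (G i) (formExponents r α i) volume)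
    (hF : ∀ n i, AEStronglyMeasurable (F n i) volume)
    (hdom : ∀ n i, ∀ᵐ x, ‖F n i x‖ ≤ ‖G i x‖)
    (hlim : ∀ i, ∀ᵐ x, Tendsto (fun n => F n i x) atTop (𝓝 (f i x))) :
    Tendsto (fun n => opForm T (F n)) atTop (𝓝 (opForm T f)) := by
  set l := Fin.last m
  set t : ℕ → Lp ℂ α (volume : Measure (Space d)) :=
    fun n => T fun i => lpClass (r i) (F n i.castSucc) with ht
  set t₀ : Lp ℂ α (volume : Measure (Space d)) :=
    T fun i => lpClass (r i) (f i.castSucc) with ht₀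
  have htt : Tendsto t atTop (𝓝 t₀) := by
    refine (T.cont.tendsto _).comp (tendsto_pi_nhds.2 fun i => ?_)
    exact tendsto_lpClass (hr i) (memLp_castSucc hG i) (fun n => hF n _) (fun n => hdom n _) (hlim _)
  have hGl : MemLp (G l) (ENNReal.conjExponent α) volume := memLp_last hG
  have hFl : ∀ n, MemLp (F n l) (ENNReal.conjExponent α) volume := fun n =>
    hGl.mono (hF n l) (hdom n l)
  have hα : 1 ≤ α := Fact.out
  -- The last function need not converge in norm, since its exponent is infinite when `α = 1`. So
  -- the change in `T` is estimated by Hölder, and the limit of `T` is paired with the last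
  -- functions by dominated convergence.
  have hdecomp : ∀ n, opForm T (F n) =
      (∫ x, (t n - t₀ : Lp ℂ α (volume : Measure (Space d))) x * F n l x) +
        ∫ x, t₀ x * F n l x := fun n => by
    rw [← integral_add (integrable_mul_of_conjExponent hα (Lp.memLp _) (hFl n))
      (integrable_mul_of_conjExponent hα (Lp.memLp _) (hFl n))]
    refine integral_congr_ae ?_
    filter_upwards [Lp.coeFn_sub (t n) t₀] with x hx
    rw [hx, Pi.sub_apply]
    ring
  simp_rw [hdecomp]
  rw [← zero_add (opForm T f)]
  refine Tendsto.add ?_ ?_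
  · rw [tendsto_zero_iff_enorm_tendsto_zero]
    have hlim0 : Tendsto (fun n => ‖t n - t₀‖ₑ * eLpNorm (G l) (ENNReal.conjExponent α) volume)
        atTop (𝓝 0) := by
      have h1 : Tendsto (fun n => ‖t n - t₀‖ₑ) atTop (𝓝 0) := by
        rw [← tendsto_zero_iff_enorm_tendsto_zero]
        simpa using htt.sub_const t₀
      simpa using ENNReal.Tendsto.mul_const h1 (Or.inr hGl.eLpNorm_ne_top)
    refine tendsto_of_tendsto_of_tendsto_of_le_of_le tendsto_const_nhds hlim0
      (fun _ => zero_le) fun n => ?_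
    refine (enorm_integral_mul_le hα (Lp.aestronglyMeasurable _) (hF n l)).trans ?_
    rw [Lp.enorm_def]
    exact mul_le_mul_right (eLpNorm_mono_ae (hdom n l)) _
  · refine tendsto_integral_of_dominated_convergence (fun x => ‖t₀ x * G l x‖) (fun n => ?_) ?_
      (fun n => ?_) ?_
    · exact (Lp.aestronglyMeasurable _).mul (hF n l)
    · exact (integrable_mul_of_conjExponent hα (Lp.memLp _) hGl).norm
    · filter_upwards [hdom n l] with x hx
      rw [norm_mul, norm_mul]
      gcongr
    · filter_upwards [hlim l] with x hx
      exact hx.const_mul _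

lemma opForm_update_add {Ω : Set (Space d)} (hΩ : volume Ω ≠ ∞) {h : Fin (m + 1) → Space d → ℂ}
    (hh : ∀ i, Adm Ω (h i)) (j : Fin (m + 1)) {u w : Space d → ℂ} (hu : Adm Ω u) (hw : Adm Ω w) :
    opForm T (Function.update h j (u + w)) =
      opForm T (Function.update h j u) + opForm T (Function.update h j w) := by
  have hα : 1 ≤ α := Fact.out
  have hint : ∀ (t : Lp ℂ α (volume : Measure (Space d))) {g : Space d → ℂ}, Adm Ω g →
      Integrable fun x => t x * g x := fun t g hg =>
    integrable_mul_of_conjExponent hα (Lp.memLp _) (hg.memLp hΩ _)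
  refine Fin.lastCases ?_ (fun j => ?_) j
  · unfold opForm
    simp only [Function.update_self, Function.update_of_ne (Fin.castSucc_ne_last _), Pi.add_apply,
      mul_add]
    exact integral_add (hint _ hu) (hint _ hw)
  · have key : ∀ a : Space d → ℂ, (fun i => lpClass (r i) (Function.update h j.castSucc a i.castSucc)) =
        Function.update (fun i => lpClass (r i) (h i.castSucc)) j (lpClass (r j) a) := fun a => by
      ext i : 1
      rcases eq_or_ne i j with rfl | hij
      · simp
      · rw [Function.update_of_ne hij, Function.update_of_ne fun e => hij (Fin.castSucc_injective _ e)]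
    unfold opForm
    have hl : ∀ a : Space d → ℂ, Function.update h j.castSucc a (Fin.last m) = h (Fin.last m) :=
      fun a => Function.update_of_ne (Fin.castSucc_ne_last _).symm _ _
    simp only [key, hl]
    have hadd : lpClass (r j) (u + w) = lpClass (r j) u + lpClass (r j) w := by
      have h1 := hu.memLp hΩ (r j)
      have h2 := hw.memLp hΩ (r j)
      rw [lpClass_eq h1, lpClass_eq h2, lpClass_eq (h1.add h2)]
      rfl
    rw [hadd, T.map_update_add, ← integral_add (hint _ (hh _)) (hint _ (hh _))]
    refine integral_congr_ae ?_
    filter_upwards [Lp.coeFn_add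
      (T (Function.update (fun i => lpClass (r i) (h i.castSucc)) j (lpClass (r j) u)))
      (T (Function.update (fun i => lpClass (r i) (h i.castSucc)) j (lpClass (r j) w)))] with x hx
    rw [hx, Pi.add_apply, add_mul]

end OpForm

/-! ### Kernel representation away from the diagonal -/

section Kernel

variable {Ω : Set (Space d)} {ε A : ℝ} {φ : (Fin (m + 1) → Space d) → ℝ}
  {K : (Fin (m + 1) → Space d) → ℂ}

lemma truncKernel_eq (hφ : IsScaleCutoff φ) {μ ν : ℤ} {z : Fin (m + 1) → Space d}
    (hz : spread z ≠ 0) (hs : ∀ s : ℤ, φ ((2 : ℝ) ^ (-s) • z) ≠ 0 → μ < s ∧ s < ν) :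
    truncKernel φ K μ ν z = K z := by
  have h1 : HasSum (fun s : ℤ => φ ((2 : ℝ) ^ (-s) • z))
      (∑ s ∈ Finset.Ioo μ ν, φ ((2 : ℝ) ^ (-s) • z)) :=
    hasSum_sum_of_ne_finset_zero fun s hs' => by
      by_contra h
      exact hs' (Finset.mem_Ioo.2 (hs s h))
  have h2 := h1.unique (hφ.partition z hz)
  simp only [truncKernel, kernelPiece]
  rw [← Finset.sum_mul, ← Complex.ofReal_sum, h2, Complex.ofReal_one, one_mul]

lemma Adm.hasCompactSupport {h : Space d → ℂ} (hh : Adm Ω h) (hΩ : Bornology.IsBounded Ω) :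
    HasCompactSupport h := by
  refine HasCompactSupport.of_support_subset_isCompact hΩ.isCompact_closure fun x hx => ?_
  by_contra hx'
  exact hx (hh.supp x fun h' => hx' (subset_closure h'))

variable {r : Fin m → ℝ≥0∞} {α : ℝ≥0∞} [∀ i, Fact (1 ≤ r i)] [Fact (1 ≤ α)]
  {T : ContinuousMultilinearMap ℂ (fun i : Fin m => Lp ℂ (r i) (volume : Measure (Space d)))
    (Lp ℂ α (volume : Measure (Space d)))}

/-- The form of `T` is the integral against the kernel if the supports of the functions are
separated. -/
lemma opForm_eq_integral (hT : HasKernel T K) (hΩ : Bornology.IsBounded Ω)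
    {h : Fin (m + 1) → Space d → ℂ} (hh : ∀ i, Adm Ω (h i))
    (hsep : ∀ x, h (Fin.last m) x ≠ 0 → x ∉ ⋂ i : Fin m, tsupport (h i.castSucc))
    {G : (Fin (m + 1) → Space d) → ℂ} {a : ℝ} (hG : Continuous G) (ha : ∀ x, ‖G x‖ ≤ a)
    (hGK : ∀ x, (∀ i, h i (x i) ≠ 0) → G x = K x) :
    opForm T h = ∫ x : Fin (m + 1) → Space d, G x * ∏ i, h i (x i) := by
  have hΩv : volume Ω ≠ ∞ := hΩ.measure_lt_top.ne
  have hint := integrable_mul_prod hG.aestronglyMeasurable ha fun i => (hh i).integrable hΩv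
  have hmp := volume_preserving_piFinSuccAbove (fun _ : Fin (m + 1) => Space d) (Fin.last m)
  rw [← hmp.symm.integral_comp (MeasurableEquiv.measurableEmbedding _)]
  rw [← hmp.symm.integrable_comp_emb (MeasurableEquiv.measurableEmbedding _)] at hint
  simp only [Function.comp_def] at hint
  rw [Measure.volume_eq_prod, integral_prod _ hint]
  refine integral_congr_ae ?_
  have hL : ∀ i : Fin m, MemLp (h i.castSucc) (r i) volume := fun i => (hh _).memLp hΩv _
  filter_upwards [hT (fun i => h i.castSucc) hL (fun i => (hh _).memLp hΩv _)
    fun i => (hh _).hasCompactSupport hΩ] with x hx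
  simp_rw [lpClass_eq (hL _)]
  have e : ∀ y : Fin m → Space d,
      (MeasurableEquiv.piFinSuccAbove (fun _ : Fin (m + 1) => Space d) (Fin.last m)).symm (x, y) =
        Fin.snoc (α := fun _ => Space d) y x := fun y => Fin.insertNth_last' x y
  simp only [e, Fin.prod_univ_castSucc, Fin.snoc_castSucc, Fin.snoc_last]
  by_cases hx0 : h (Fin.last m) x = 0
  · simp [hx0]
  · rw [hx (hsep x hx0), ← integral_mul_const]
    refine integral_congr_ae (Eventually.of_forall fun y => ?_)
    simp only
    by_cases hy : ∀ i : Fin m, h i.castSucc (y i) ≠ 0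
    · rw [hGK]
      · ring
      · refine fun i => Fin.lastCases ?_ (fun i => ?_) i
        · simpa using hx0
        · simpa using hy i
    · push Not at hy
      obtain ⟨i, hi⟩ := hy
      rw [Finset.prod_eq_zero (f := fun i => h i.castSucc (y i)) (Finset.mem_univ i) hi]
      simp

lemma dist_of_not_near {s : ℤ} {x y : Space d} (h : ¬ Near v 1 s x y) : (2 : ℝ) ^ s < ‖x - y‖ := by
  by_contra! h'
  exact h (near_of_norm_sub_le h')

/-- If some function has support far from that of the first one then the form of `T` is a truncated
form. -/
lemma opForm_eq_truncForm (hφ : IsScaleCutoff φ) (hε : 0 < ε)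
    (hκ : ScaleKernel v ε A (kernelPiece φ K)) (hT : HasKernel T K) (hΩ : Bornology.IsBounded Ω)
    {δ : ℝ} (hδ : ∀ x, φ x ≠ 0 → δ ≤ spread x ∧ spread x ≤ 1) {s ν : ℤ}
    (hν : ∀ x ∈ Ω, ∀ y ∈ Ω, ‖x - y‖ < δ * 2 ^ ν) (hδ0 : 0 < δ)
    {h : Fin (m + 1) → Space d → ℂ} (hh : ∀ i, Adm Ω (h i)) {j : Fin (m + 1)}
    (hj : ∀ x y, h 0 x ≠ 0 → h j y ≠ 0 → (2 : ℝ) ^ s < ‖x - y‖) :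
    opForm T h = truncForm φ K (s - 1) ν h := by
  obtain ⟨a, ha⟩ := hκ.exists_norm_truncKernel_le (s - 1) ν
  have h2s : (0 : ℝ) < 2 ^ s := by positivity
  refine opForm_eq_integral hT hΩ hh ?_ (hκ.continuous_truncKernel hε _ _) ha ?_
  -- A point in all closed supports would be within `2^s/2` of points where `h 0` and `h j` are
  -- nonzero, against their separation.
  · intro x hx hx'
    rw [Set.mem_iInter] at hx'
    have hcl : ∀ i, x ∈ closure (Function.support (h i)) := fun i => by
      refine Fin.lastCases ?_ (fun i => hx' i) i
      exact subset_closure hx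
    obtain ⟨y, hy, hxy⟩ := Metric.mem_closure_iff.1 (hcl 0) (2 ^ s / 2) (by positivity)
    obtain ⟨y', hy', hxy'⟩ := Metric.mem_closure_iff.1 (hcl j) (2 ^ s / 2) (by positivity)
    have h3 := hj y y' hy hy'
    rw [← dist_eq_norm] at h3
    have := dist_triangle_left y y' x
    linarith
  · intro z hz
    -- Where the product is nonzero the spread lies strictly between `2^s` and `δ 2^ν`, so every
    -- active scale `σ` satisfies `s < σ < ν` and the truncated kernel equals `K`.
    have h1 : (2 : ℝ) ^ s < spread z := (hj _ _ (hz 0) (hz j)).trans_le (norm_sub_le_spread z 0 j)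
    have h3 : spread z < δ * 2 ^ ν := by
      obtain ⟨ab, hab⟩ := exists_eq_ciSup_of_finite
        (f := fun ij : Fin (m + 1) × Fin (m + 1) => ‖z ij.1 - z ij.2‖)
      have hmem : ∀ i, z i ∈ Ω := fun i => by
        by_contra hi
        exact hz i ((hh i).supp _ hi)
      rw [spread, ← hab]
      exact hν _ (hmem _) _ (hmem _)
    refine truncKernel_eq hφ (h2s.trans h1).ne' fun σ hσ => ?_
    have h2 : (0 : ℝ) < 2 ^ σ := by positivity
    have h4 := hδ _ hσ
    rw [spread_smul (by positivity), zpow_neg, ← div_eq_inv_mul, le_div_iff₀ h2, div_le_one h2] at h4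
    have h5 : (2 : ℝ) ^ s < 2 ^ σ := h1.trans_le h4.2
    have h6 : (2 : ℝ) ^ σ < 2 ^ ν := lt_of_mul_lt_mul_left (h4.1.trans_lt h3) hδ0.le
    rw [zpow_lt_zpow_iff_right₀ one_lt_two] at h5 h6
    omega

/-- The form of `T` minus its truncations is a family of local forms. -/
lemma formFamily_op (hr : ∀ i, r i ≠ ∞) (hrs : ∑ i, (r i)⁻¹ = α⁻¹)
    (hC : truncConst φ K r α ≠ ∞) (hφ : IsScaleCutoff φ) (hε : 0 < ε)
    (hκ : ScaleKernel v ε A (kernelPiece φ K)) (hT : HasKernel T K) (hΩ : Bornology.IsBounded Ω)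
    {δ : ℝ} (hδ : ∀ x, φ x ≠ 0 → δ ≤ spread x ∧ spread x ≤ 1) {ν : ℤ}
    (hν : ∀ x ∈ Ω, ∀ y ∈ Ω, ‖x - y‖ < δ * 2 ^ ν) (hδ0 : 0 < δ) :
    FormFamily v Ω (3 ^ d * (‖T‖ + (truncConst φ K r α).toReal))
      (fun s => if s < ν then kernelPiece φ K s else 0)
      (fun s h => opForm T h - truncForm φ K (s - 1) ν h) where
  map_add s h j u w hh hu hw := by
    have hΩv : volume Ω ≠ ∞ := hΩ.measure_lt_top.ne
    rw [truncForm_update_add hκ hε _ _ hΩv hh j hu hw, opForm_update_add T hΩv hh j hu hw]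
    ring
  bound s h P N hh hP hN hb := by
    have hΩv : volume Ω ≠ ∞ := hΩ.measure_lt_top.ne
    refine (norm_sub_le _ _).trans ((add_le_add (norm_opForm_le T hrs hΩv hh hP hN hb)
      (norm_truncForm_le hrs hC hΩv _ _ hh hP hN hb)).trans (le_of_eq (by ring)))
  -- For functions separated at level `s`, the scales from `s` up to `ν` already give the whole
  -- form, so the difference is zero.
  map_local s h j hh hloc := by
    rw [opForm_eq_truncForm hφ hε hκ hT hΩ hδ hν hδ0 hh (j := j) (s := s), sub_self]
    exact fun x y hx hy => dist_of_not_near (hloc x y hx hy)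
  cont s ι l _ H h M hH hh hM hlim := by
    have hΩv : volume Ω ≠ ∞ := hΩ.measure_lt_top.ne
    refine Tendsto.sub ?_ (tendsto_truncForm hκ hε _ _ hΩv hH hM hlim)
    refine tendsto_of_seq_tendsto fun x hx => ?_
    have hG : Adm (toMeasurable volume Ω)
        ((toMeasurable volume Ω).indicator fun _ : Space d => (M : ℂ)) :=
      ⟨measurable_const.indicator (measurableSet_toMeasurable _ _),
        ⟨‖(M : ℂ)‖, fun x => norm_indicator_le_norm_self _ _⟩,
        fun x hx => Set.indicator_of_notMem hx _⟩
    refine tendsto_opForm T hr (F := fun n => H (x n))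
      (G := fun _ => (toMeasurable volume Ω).indicator fun _ => (M : ℂ))
      (fun i => hG.memLp (by rwa [measure_toMeasurable]) _)
      (fun n i => (hH _ i).meas.aestronglyMeasurable) (fun n i => ?_)
      (fun i => Eventually.of_forall fun y => (hlim i y).comp hx)
    refine Eventually.of_forall fun y => ?_
    by_cases hy : y ∈ toMeasurable volume Ω
    · rw [Set.indicator_of_mem hy, Complex.norm_real]
      exact (hM _ i y).trans (le_abs_self _)
    · rw [(hH _ i).supp y fun hy' => hy (subset_toMeasurable _ _ hy'), norm_zero]
      exact norm_nonneg _
  diff s h hh := by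
    have hΩv : volume Ω ≠ ∞ := hΩ.measure_lt_top.ne
    rw [add_sub_cancel_right]
    by_cases hs : s < ν
    · rw [truncForm_pred_left hκ hε hs hΩv hh]
      simp only [hs, if_true]
      ring
    · simp only [hs, if_false, Pi.zero_apply, zero_mul, integral_zero]
      rw [truncForm_of_le (by omega), truncForm_of_le (by omega), sub_self]

end Kernel

end

section

variable {d m : ℕ} {v : Space d}

/-! ### Comparison of sparse forms -/

section Sparse

lemma cubeAverage_mono {p : ℝ≥0∞} {Q : Cube d} {f g : Space d → ℂ}
    (h : ∀ᵐ x, ‖f x‖ ≤ ‖g x‖) : cubeAverage p Q f ≤ cubeAverage p Q g := by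
  refine mul_le_mul_right (eLpNorm_mono_ae ?_) _
  filter_upwards [h] with x hx
  by_cases hQ : x ∈ Q.toSet
  · rwa [Set.indicator_of_mem hQ, Set.indicator_of_mem hQ]
  · rw [Set.indicator_of_notMem hQ, Set.indicator_of_notMem hQ]

lemma cubeAverage_one_le {p : ℝ≥0∞} (hp : 1 ≤ p) {Q : Cube d} {f : Space d → ℂ}
    (hf : AEStronglyMeasurable f volume) : cubeAverage 1 Q f ≤ cubeAverage p Q f := by
  have hQ := Q.measurableSet_toSet
  have hV : 0 < Q.side ^ d := pow_pos Q.side_pos d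
  have h0 : volume Q.toSet ≠ 0 := by rw [Cube.volume_toSet]; simpa using hV
  have ht : volume Q.toSet ≠ ∞ := by rw [Cube.volume_toSet]; exact ENNReal.ofReal_ne_top
  unfold cubeAverage
  rw [eLpNorm_indicator_eq_eLpNorm_restrict hQ, eLpNorm_indicator_eq_eLpNorm_restrict hQ]
  refine (mul_le_mul_right (eLpNorm_le_eLpNorm_mul_rpow_measure_univ hp hf.restrict) _).trans ?_
  rw [Measure.restrict_apply_univ, mul_comm (eLpNorm _ _ _), ← mul_assoc,
    ← ENNReal.rpow_add _ _ h0 ht]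
  refine le_of_eq ?_
  congr 2
  rw [ENNReal.toReal_inv, ENNReal.toReal_inv, ENNReal.toReal_one]
  ring

/-- Hölder on each cube raises the exponents, and domination by `g` spares `f` any integrability. -/
lemma supPSF_one_le {η : ℝ} {p : ℝ≥0∞} (hp : 1 ≤ p) {f g : Fin (m + 1) → Space d → ℂ}
    (hg : ∀ i, AEStronglyMeasurable (g i) volume) (h : ∀ i, ∀ᵐ x, ‖f i x‖ ≤ ‖g i x‖) :
    supPSF η (fun _ => 1) f ≤ supPSF η (onePExponents m p) g := by
  refine iSup₂_mono fun S _ => ENNReal.tsum_le_tsum fun Q => ?_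
  refine mul_le_mul_right (Finset.prod_le_prod' fun i _ => ?_) _
  refine (cubeAverage_mono (h i)).trans ?_
  refine cubeAverage_one_le ?_ (hg i)
  refine Fin.cases ?_ (fun i => ?_) i
  · simp [onePExponents]
  · simpa [onePExponents] using hp

lemma supPSF_mono {n : ℕ} {η : ℝ} {p : Fin n → ℝ≥0∞} {f g : Fin n → Space d → ℂ}
    (h : ∀ i, ∀ᵐ x, ‖f i x‖ ≤ ‖g i x‖) : supPSF η p f ≤ supPSF η p g :=
  iSup₂_mono fun _ _ => ENNReal.tsum_le_tsum fun _ =>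
    mul_le_mul_right (Finset.prod_le_prod' fun i _ => cubeAverage_mono (h i)) _

end Sparse

/-! ### Bounded functions with bounded support -/

section Bounded

lemma isBounded_box (a : ℕ) (P : GridCube d) : Bornology.IsBounded (box v a P) := by
  rw [← boxCube_toSet]
  set Q := boxCube v a P
  rw [Metric.isBounded_iff_subset_closedBall Q.corner]
  refine ⟨∑ _i : Fin d, Q.side, fun x hx => ?_⟩
  rw [Metric.mem_closedBall, dist_eq_norm]
  have : ‖x - Q.corner‖ ≤ ∑ i, ‖(x - Q.corner) i‖ := by
    rw [EuclideanSpace.norm_eq, Real.sqrt_le_left (Finset.sum_nonneg fun i _ => norm_nonneg _)]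
    exact Finset.sum_sq_le_sq_sum_of_nonneg fun i _ => norm_nonneg _
  refine this.trans (Finset.sum_le_sum fun i _ => ?_)
  have := hx i
  rw [PiLp.sub_apply, Real.norm_eq_abs, abs_le]
  have := Q.side_pos
  constructor <;> linarith

/-- The grid is shifted to the corner of the ball's bounding cube; no cube of the grid with origin 0
contains a ball about 0 of positive radius when `d` is positive. -/
lemma closedBall_subset_box {R : ℝ} {k : ℤ} (hk : 2 * R < 2 ^ k) :
    Metric.closedBall (0 : Space d) R ⊆
      box (WithLp.toLp 2 fun _ => -R) 0 ((k, 0) : GridCube d) := fun x hx => by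
  rw [mem_box_zero]
  ext i
  have h2 : (0 : ℝ) < 2 ^ k := by positivity
  have hi : |x i| ≤ R := by
    have := (PiLp.norm_apply_le x i).trans (mem_closedBall_zero_iff.1 hx)
    simpa [Real.norm_eq_abs] using this
  rw [abs_le] at hi
  simp only [gridIndex, Pi.zero_apply, Int.floor_eq_zero_iff, sub_neg_eq_add, Set.mem_Ico]
  exact ⟨div_nonneg (by linarith) h2.le, by rw [div_lt_one h2]; linarith⟩

lemma exists_lt_two_zpow (a : ℝ) : ∃ k : ℤ, ∀ l, k ≤ l → a < 2 ^ l := by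
  obtain ⟨n, hn⟩ := pow_unbounded_of_one_lt a one_lt_two
  refine ⟨n, fun l hl => hn.trans_le ?_⟩
  rw [← zpow_natCast]
  exact zpow_le_zpow_right₀ one_le_two hl

lemma Adm.mono {Ω Ω' : Set (Space d)} {h : Space d → ℂ} (hh : Adm Ω h) (hΩ : Ω ⊆ Ω') : Adm Ω' h :=
  ⟨hh.meas, hh.bdd, fun x hx => hh.supp x fun h' => hx (hΩ h')⟩

variable {ε A : ℝ} {φ : (Fin (m + 1) → Space d) → ℝ} {K : (Fin (m + 1) → Space d) → ℂ}
  {r : Fin m → ℝ≥0∞} {α : ℝ≥0∞} [∀ i, Fact (1 ≤ r i)] [Fact (1 ≤ α)]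

lemma enorm_truncForm_le_supPSF_of_adm (hrs : ∑ i, (r i)⁻¹ = α⁻¹)
    (hC : truncConst φ K r α ≠ ∞) (hε : 0 < ε) (hε1 : ε ≤ 1)
    (hκ : ∀ v : Space d, ScaleKernel v ε A (kernelPiece φ K)) (μ ν : ℤ) {R : ℝ}
    {f : Fin (m + 1) → Space d → ℂ} (hf : ∀ i, Adm (Metric.closedBall 0 R) (f i)) :
    ‖truncForm φ K μ ν f‖ₑ ≤ ENNReal.ofReal (stepConst d m ε * (3 ^ d) ^ (m + 1) *
      (A + 3 ^ d * (truncConst φ K r α).toReal)) * supPSF (sparsity d) (fun _ => 1) f := by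
  obtain ⟨k₀, hk₀⟩ := exists_lt_two_zpow (2 * R)
  -- The top cube must contain the supports, and its level must reach `ν`, so that the form at level
  -- `k` is the full truncation.
  set k := max k₀ ν
  set v : Space d := WithLp.toLp 2 fun _ => -R
  have hfam := formFamily_trunc (v := v) (Ω := box v 1 ((k, 0) : GridCube d)) hrs hC
    (by rw [volume_box_one]; exact ENNReal.ofReal_ne_top) hε (hκ v) μ ν
  have h := hfam.enorm_le_supPSF hε hε1 (by positivity)
    ((hκ v).ite fun s => μ < s ∧ s < ν) fun i =>
      (hf i).mono (closedBall_subset_box (hk₀ k (le_max_left _ _)))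
  rwa [min_eq_right (le_max_right _ _)] at h

lemma enorm_opForm_le_supPSF_of_adm {T : ContinuousMultilinearMap ℂ
      (fun i : Fin m => Lp ℂ (r i) (volume : Measure (Space d)))
      (Lp ℂ α (volume : Measure (Space d)))} (hr : ∀ i, r i ≠ ∞) (hrs : ∑ i, (r i)⁻¹ = α⁻¹)
    (hC : truncConst φ K r α ≠ ∞) (hφ : IsScaleCutoff φ) (hε : 0 < ε) (hε1 : ε ≤ 1)
    (hκ : ∀ v : Space d, ScaleKernel v ε A (kernelPiece φ K)) (hT : HasKernel T K) {R : ℝ}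
    {f : Fin (m + 1) → Space d → ℂ} (hf : ∀ i, Adm (Metric.closedBall 0 R) (f i)) :
    ‖opForm T f‖ₑ ≤ ENNReal.ofReal (stepConst d m ε * (3 ^ d) ^ (m + 1) *
      (A + 3 ^ d * (‖T‖ + (truncConst φ K r α).toReal))) *
        supPSF (sparsity d) (fun _ => 1) f := by
  obtain ⟨δ, hδ0, hδ⟩ := hφ.support
  obtain ⟨k₀, hk₀⟩ := exists_lt_two_zpow (2 * R)
  obtain ⟨k₁, hk₁⟩ := exists_lt_two_zpow (2 * R / δ)
  set k := max k₀ k₁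
  set v : Space d := WithLp.toLp 2 fun _ => -R
  have hΩ : Bornology.IsBounded (box v 1 ((k, 0) : GridCube d)) := isBounded_box 1 _
  -- `D` bounds the diameter of the ambient set; `ν` is taken so large that no scale from `ν` on
  -- meets it.
  obtain ⟨D, hD⟩ := Metric.isBounded_iff.1 hΩ
  obtain ⟨ν, hν⟩ := exists_lt_two_zpow (D / δ)
  have hfam := formFamily_op (v := v) hr hrs hC hφ hε (hκ v) hT hΩ hδ (ν := ν)
    (fun x hx y hy => by
      rw [← dist_eq_norm]
      refine (hD hx hy).trans_lt ?_
      rw [mul_comm, ← div_lt_iff₀ hδ0]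
      exact hν ν le_rfl) hδ0
  have h := hfam.enorm_le_supPSF hε hε1 (by positivity) ((hκ v).ite fun s => s < ν) fun i =>
      (hf i).mono (closedBall_subset_box (hk₀ k (le_max_left _ _)))
  simp only at h
  -- At the top level the subtracted truncation only involves scales at least `2^k`, where the
  -- cutoff requires a spread of at least `δ 2^k`, more than the supports allow. The form at that
  -- level is therefore that of `T`.
  rwa [truncForm_eq_zero, sub_zero] at h
  intro x hx s hs _
  have h2 : (0 : ℝ) < 2 ^ s := by positivity
  rw [kernelPiece]
  by_contra hne
  have hφx : φ ((2 : ℝ) ^ (-s) • x) ≠ 0 := fun h0 => hne (by rw [h0]; simp)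
  have h4 := (hδ _ hφx).1
  rw [spread_smul (by positivity), zpow_neg, ← div_eq_inv_mul, le_div_iff₀ h2] at h4
  have hball : ∀ i, ‖x i‖ ≤ R := fun i => by
    by_contra hi
    exact hx i ((hf i).supp _ fun h' => hi (mem_closedBall_zero_iff.1 h'))
  have h5 : spread x ≤ 2 * R := spread_le fun i j =>
    (norm_sub_le _ _).trans (by linarith [hball i, hball j])
  have h6 := hk₁ s (by have := le_max_right k₀ k₁; omega)
  rw [div_lt_iff₀ hδ0] at h6
  linarith

end Bounded

/-! ### Truncation of functions -/

section Cutoff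

/-- The restriction of `f` to the set where both the variable and the value are at most `n`. -/
def boundedPart (f : Space d → ℂ) (n : ℕ) : Space d → ℂ :=
  ({x | ‖f x‖ ≤ n} ∩ Metric.closedBall 0 n).indicator f

lemma adm_boundedPart {f : Space d → ℂ} (hf : Measurable f) (n : ℕ) :
    Adm (Metric.closedBall 0 n) (boundedPart f n) := by
  refine ⟨hf.indicator ((measurableSet_le hf.norm measurable_const).inter
    Metric.isClosed_closedBall.measurableSet), ⟨n, fun x => ?_⟩, fun x hx => ?_⟩
  · unfold boundedPart
    by_cases hx : x ∈ {x | ‖f x‖ ≤ n} ∩ Metric.closedBall 0 (n : ℝ)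
    · rw [Set.indicator_of_mem hx]; exact hx.1
    · rw [Set.indicator_of_notMem hx, norm_zero]; positivity
  · exact Set.indicator_of_notMem (fun h => hx h.2) _

lemma norm_boundedPart_le (f : Space d → ℂ) (n : ℕ) (x : Space d) :
    ‖boundedPart f n x‖ ≤ ‖f x‖ := norm_indicator_le_norm_self _ _

lemma tendsto_boundedPart (f : Space d → ℂ) (x : Space d) :
    Tendsto (fun n => boundedPart f n x) atTop (𝓝 (f x)) := by
  obtain ⟨n₀, hn₀⟩ := exists_nat_ge (max ‖f x‖ ‖x‖)
  refine tendsto_const_nhds.congr' ?_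
  filter_upwards [eventually_ge_atTop n₀] with n hn
  have h1 : max ‖f x‖ ‖x‖ ≤ n := hn₀.trans (by exact_mod_cast hn)
  unfold boundedPart
  rw [Set.indicator_of_mem]
  exact ⟨(le_max_left _ _).trans h1, mem_closedBall_zero_iff.2 ((le_max_right _ _).trans h1)⟩

/-- Approximation by bounded functions with bounded support. -/
lemma exists_adm_approx {f : Fin (m + 1) → Space d → ℂ}
    (hf : ∀ i, AEStronglyMeasurable (f i) volume) :
    ∃ F : ℕ → Fin (m + 1) → Space d → ℂ, (∀ (n : ℕ) i, Adm (Metric.closedBall 0 n) (F n i)) ∧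
      (∀ n i, ∀ᵐ x, ‖F n i x‖ ≤ ‖f i x‖) ∧
      ∀ i, ∀ᵐ x, Tendsto (fun n => F n i x) atTop (𝓝 (f i x)) := by
  refine ⟨fun n i => boundedPart ((hf i).mk (f i)) n,
    fun n i => adm_boundedPart (hf i).stronglyMeasurable_mk.measurable n, fun n i => ?_,
    fun i => ?_⟩
  · filter_upwards [(hf i).ae_eq_mk] with x hx
    rw [hx]
    exact norm_boundedPart_le _ _ _
  · filter_upwards [(hf i).ae_eq_mk] with x hx
    rw [hx]
    exact tendsto_boundedPart _ _

end Cutoff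

/-! ### Convergence of the truncated forms -/

section Integrable

lemma exists_integral_closedBall_le {p : ℝ≥0∞} (hp : 1 ≤ p) {f : Space d → ℂ}
    (hf : MemLp f p volume) (ρ : ℝ) :
    ∃ M : ℝ, 0 ≤ M ∧ ∀ x, IntegrableOn f (Metric.closedBall x ρ) ∧
      ∫ y in Metric.closedBall x ρ, ‖f y‖ ≤ M := by
  set V := volume (Metric.closedBall (0 : Space d) ρ)
  have hV : V ≠ ∞ := measure_closedBall_lt_top.ne
  set e : ℝ := 1 / (1 : ℝ≥0∞).toReal - 1 / p.toReal with he
  have he0 : 0 ≤ e := by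
    rw [he, ENNReal.toReal_one, div_one, sub_nonneg]
    rcases eq_or_ne p ∞ with rfl | hpt
    · simp
    · have : 1 ≤ p.toReal := by simpa using ENNReal.toReal_mono hpt hp
      rw [div_le_one (by linarith)]; exact this
  have hMt : eLpNorm f p volume * V ^ e ≠ ∞ :=
    ENNReal.mul_ne_top hf.eLpNorm_ne_top (ENNReal.rpow_ne_top_of_nonneg he0 hV)
  refine ⟨(eLpNorm f p volume * V ^ e).toReal, ENNReal.toReal_nonneg, fun x => ?_⟩
  have h1 : ∫⁻ y in Metric.closedBall x ρ, ‖f y‖ₑ ≤ eLpNorm f p volume * V ^ e := by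
    rw [← eLpNorm_one_eq_lintegral_enorm]
    refine (eLpNorm_le_eLpNorm_mul_rpow_measure_univ hp hf.1.restrict).trans ?_
    rw [Measure.restrict_apply_univ, Measure.addHaar_closedBall_center]
    gcongr
    exact Measure.restrict_le_self
  have h2 : IntegrableOn f (Metric.closedBall x ρ) := ⟨hf.1.restrict, h1.trans_lt hMt.lt_top⟩
  refine ⟨h2, ?_⟩
  rw [integral_norm_eq_lintegral_enorm hf.1.restrict]
  exact ENNReal.toReal_mono hMt h1

lemma aestronglyMeasurable_prod {n : ℕ} {f : Fin n → Space d → ℂ}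
    (hf : ∀ i, AEStronglyMeasurable (f i) volume) :
    AEStronglyMeasurable (fun x : Fin n → Space d => ∏ i, f i (x i)) volume :=
  Finset.aestronglyMeasurable_fun_prod _ fun i _ => (hf i).comp_quasiMeasurePreserving
    (Measure.quasiMeasurePreserving_eval (fun _ : Fin n => (volume : Measure (Space d))) i)

/-- A bounded kernel supported near the diagonal is integrable against a product of a function in
`L^1` and functions in `L^p`. -/
lemma integrable_mul_prod_of_near {G : (Fin (m + 1) → Space d) → ℂ} {a ρ : ℝ} (hG : Continuous G)
    (ha : ∀ x, ‖G x‖ ≤ a) (hρ : ∀ x, G x ≠ 0 → ∀ i, ‖x i - x 0‖ ≤ ρ) {p : ℝ≥0∞} (hp : 1 ≤ p)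
    {f : Fin (m + 1) → Space d → ℂ} (hf : ∀ i, MemLp (f i) (onePExponents m p i) volume) :
    Integrable fun x : Fin (m + 1) → Space d => G x * ∏ i, f i (x i) := by
  have ha0 : 0 ≤ a := (norm_nonneg _).trans (ha 0)
  have hf0 : Integrable (f 0) := memLp_one_iff_integrable.1 (by simpa [onePExponents] using hf 0)
  have hfp : ∀ i : Fin m, MemLp (f i.succ) p volume := fun i => by
    simpa [onePExponents] using hf i.succ
  -- The integrals over balls of radius `ρ` are bounded uniformly in the centre. Integrating out the
  -- other variables thus leaves a constant times the norm of `f 0`, which is integrable.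
  choose M hM0 hM using fun i : Fin m => exists_integral_closedBall_le hp (hfp i) ρ
  have hmeas : AEStronglyMeasurable (fun x : Fin (m + 1) → Space d => G x * ∏ i, f i (x i)) volume :=
    hG.aestronglyMeasurable.mul (aestronglyMeasurable_prod fun i => (hf i).1)
  have hmp := (volume_preserving_piFinSuccAbove (fun _ : Fin (m + 1) => Space d) 0).symm
  rw [← hmp.integrable_comp_emb (MeasurableEquiv.measurableEmbedding _)]
  have hmeas' := hmeas.comp_quasiMeasurePreserving hmp.quasiMeasurePreserving
  rw [Measure.volume_eq_prod] at hmeas' ⊢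
  set u : Space d → Fin m → Space d → ℂ :=
    fun x i => (Metric.closedBall x ρ).indicator (f i.succ) with hu
  have hui : ∀ x i, Integrable (u x i) := fun x i =>
    (integrable_indicator_iff Metric.isClosed_closedBall.measurableSet).2 (hM i x).1
  have key : ∀ x (y : Fin m → Space d),
      ((fun x : Fin (m + 1) → Space d => G x * ∏ i, f i (x i)) ∘
        (MeasurableEquiv.piFinSuccAbove (fun _ : Fin (m + 1) => Space d) 0).symm) (x, y) =
      (f 0 x * G (Fin.cons x y)) * ∏ i, u x i (y i) := fun x y => by
    have e : (MeasurableEquiv.piFinSuccAbove (fun _ : Fin (m + 1) => Space d) 0).symm (x, y) =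
        Fin.cons x y := Fin.insertNth_zero' x y
    simp only [Function.comp_apply, e, Fin.prod_univ_succ, Fin.cons_zero, Fin.cons_succ]
    by_cases hz : G (Fin.cons x y) = 0
    · simp [hz]
    · have : ∀ i, u x i (y i) = f i.succ (y i) := fun i => by
        refine Set.indicator_of_mem ?_ _
        rw [Metric.mem_closedBall, dist_eq_norm]
        simpa using hρ _ hz i.succ
      simp only [this]
      ring
  have hnorm : ∀ x, ∫ y : Fin m → Space d, ‖∏ i, u x i (y i)‖ ≤ ∏ i, M i := fun x => by
    simp_rw [norm_prod]
    rw [integral_fintype_prod_volume_eq_prod (fun i => fun y => ‖u x i y‖)]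
    refine Finset.prod_le_prod (fun i _ => integral_nonneg fun _ => norm_nonneg _) fun i _ => ?_
    refine le_trans (le_of_eq ?_) (hM i x).2
    rw [← integral_indicator Metric.isClosed_closedBall.measurableSet]
    refine integral_congr_ae (Eventually.of_forall fun y => ?_)
    simp only [hu, norm_indicator_eq_indicator_norm]
  have hpi : ∀ x, Integrable fun y : Fin m → Space d => ∏ i, u x i (y i) := fun x =>
    Integrable.fintype_prod (μ := fun _ => volume) (f := u x) (hui x)
  rw [integrable_prod_iff hmeas']
  constructor
  · refine Eventually.of_forall fun x => ?_
    simp_rw [key]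
    refine Integrable.bdd_mul (c := ‖f 0 x‖ * a) (hpi x) ?_ (Eventually.of_forall fun y => ?_)
    · refine (Continuous.aestronglyMeasurable ?_)
      exact continuous_const.mul (hG.comp (by fun_prop))
    · rw [norm_mul]
      exact mul_le_mul_of_nonneg_left (ha _) (norm_nonneg _)
  · refine Integrable.mono' (g := fun x => ‖f 0 x‖ * (a * ∏ i, M i)) (hf0.norm.mul_const _)
      hmeas'.norm.integral_prod_right' (Eventually.of_forall fun x => ?_)
    rw [Real.norm_of_nonneg (integral_nonneg fun _ => norm_nonneg _)]
    simp_rw [key]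
    calc ∫ y : Fin m → Space d, ‖f 0 x * G (Fin.cons x y) * ∏ i, u x i (y i)‖
        ≤ ∫ y : Fin m → Space d, ‖f 0 x‖ * a * ‖∏ i, u x i (y i)‖ := by
          refine integral_mono_of_nonneg (Eventually.of_forall fun _ => norm_nonneg _)
            ((hpi x).norm.const_mul _) (Eventually.of_forall fun y => ?_)
          simp only
          rw [norm_mul, norm_mul]
          gcongr
          exact ha _
      _ = ‖f 0 x‖ * (a * ∫ y : Fin m → Space d, ‖∏ i, u x i (y i)‖) := by
          rw [integral_const_mul, mul_assoc]
      _ ≤ _ := by gcongr; exact hnorm x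

variable {ε A : ℝ} {φ : (Fin (m + 1) → Space d) → ℝ} {K : (Fin (m + 1) → Space d) → ℂ}

lemma integrable_truncKernel_mul_prod (hφ : IsScaleCutoff φ) (hε : 0 < ε)
    (hκ : ScaleKernel v ε A (kernelPiece φ K)) (μ ν : ℤ) {p : ℝ≥0∞} (hp : 1 ≤ p)
    {f : Fin (m + 1) → Space d → ℂ} (hf : ∀ i, MemLp (f i) (onePExponents m p i) volume) :
    Integrable fun x : Fin (m + 1) → Space d => truncKernel φ K μ ν x * ∏ i, f i (x i) := by
  obtain ⟨a, ha⟩ := hκ.exists_norm_truncKernel_le μ ν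
  obtain ⟨δ, hδ0, hδ⟩ := hφ.support
  refine integrable_mul_prod_of_near (hκ.continuous_truncKernel hε μ ν) ha (ρ := 2 ^ ν)
    (fun x hx i => ?_) hp hf
  obtain ⟨s, hs, hsx⟩ := Finset.exists_ne_zero_of_sum_ne_zero hx
  have h2 : (0 : ℝ) < 2 ^ s := by positivity
  have hφx : φ ((2 : ℝ) ^ (-s) • x) ≠ 0 := fun h0 => hsx (by rw [kernelPiece, h0]; simp)
  have h4 := (hδ _ hφx).2
  rw [spread_smul (by positivity), zpow_neg, ← div_eq_inv_mul, div_le_one h2] at h4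
  rw [Finset.mem_Ioo] at hs
  exact (norm_sub_le_spread x i 0).trans (h4.trans (zpow_le_zpow_right₀ one_le_two hs.2.le))

lemma tendsto_truncForm_of_dominated (hφ : IsScaleCutoff φ) (hε : 0 < ε)
    (hκ : ScaleKernel v ε A (kernelPiece φ K)) (μ ν : ℤ) {p : ℝ≥0∞} (hp : 1 ≤ p)
    {f : Fin (m + 1) → Space d → ℂ} (hf : ∀ i, MemLp (f i) (onePExponents m p i) volume)
    {F : ℕ → Fin (m + 1) → Space d → ℂ} (hF : ∀ n i, AEStronglyMeasurable (F n i) volume)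
    (hdom : ∀ n i, ∀ᵐ x, ‖F n i x‖ ≤ ‖f i x‖)
    (hlim : ∀ i, ∀ᵐ x, Tendsto (fun n => F n i x) atTop (𝓝 (f i x))) :
    Tendsto (fun n => truncForm φ K μ ν (F n)) atTop (𝓝 (truncForm φ K μ ν f)) := by
  have heval : ∀ i : Fin (m + 1), Measure.QuasiMeasurePreserving
      (Function.eval i : (Fin (m + 1) → Space d) → Space d) volume volume := fun i =>
    Measure.quasiMeasurePreserving_eval (fun _ : Fin (m + 1) => (volume : Measure (Space d))) i
  simp_rw [truncForm_eq]
  refine tendsto_integral_of_dominated_convergence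
    (fun x => ‖truncKernel φ K μ ν x * ∏ i, f i (x i)‖) (fun n => ?_)
    (integrable_truncKernel_mul_prod hφ hε hκ μ ν hp hf).norm (fun n => ?_) ?_
  · exact (hκ.continuous_truncKernel hε μ ν).aestronglyMeasurable.mul
      (aestronglyMeasurable_prod (hF n))
  · filter_upwards [ae_all_iff.2 fun i => (heval i).ae (hdom n i)] with x hx
    rw [norm_mul, norm_mul, norm_prod, norm_prod]
    exact mul_le_mul_of_nonneg_left
      (Finset.prod_le_prod (fun _ _ => norm_nonneg _) fun i _ => hx i) (norm_nonneg _)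
  · filter_upwards [ae_all_iff.2 fun i => (heval i).ae (hlim i)] with x hx
    exact (tendsto_finsetProd _ fun i _ => hx i).const_mul _

end Integrable

/-! ### The estimates for general functions -/

section General

variable {ε A : ℝ} {φ : (Fin (m + 1) → Space d) → ℝ} {K : (Fin (m + 1) → Space d) → ℂ}
  {r : Fin m → ℝ≥0∞} {α : ℝ≥0∞} [∀ i, Fact (1 ≤ r i)] [Fact (1 ≤ α)]

/-- The truncated form passes to the limit along dominated approximations, and each approximant has
a sparse supremum at most that of `f`. -/
theorem enorm_truncForm_le_supPSF (hrs : ∑ i, (r i)⁻¹ = α⁻¹) (hC : truncConst φ K r α ≠ ∞)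
    (hφ : IsScaleCutoff φ) (hε : 0 < ε) (hε1 : ε ≤ 1)
    (hκ : ∀ v : Space d, ScaleKernel v ε A (kernelPiece φ K)) (μ ν : ℤ) {p : ℝ≥0∞} (hp : 1 ≤ p)
    {f : Fin (m + 1) → Space d → ℂ} (hf : ∀ i, MemLp (f i) (onePExponents m p i) volume) :
    ‖truncForm φ K μ ν f‖ₑ ≤ ENNReal.ofReal (stepConst d m ε * (3 ^ d) ^ (m + 1) *
      (A + 3 ^ d * (truncConst φ K r α).toReal)) * supPSF (sparsity d) (fun _ => 1) f := by
  obtain ⟨F, hF, hdom, hlim⟩ := exists_adm_approx fun i => (hf i).1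
  refine le_of_tendsto (tendsto_truncForm_of_dominated hφ hε (hκ 0) μ ν hp hf
    (fun n i => (hF n i).meas.aestronglyMeasurable) hdom hlim).enorm (Eventually.of_forall fun n => ?_)
  refine (enorm_truncForm_le_supPSF_of_adm hrs hC hε hε1 hκ μ ν (hF n)).trans ?_
  gcongr
  exact supPSF_mono (hdom n)

theorem enorm_opForm_le_supPSF {T : ContinuousMultilinearMap ℂ
      (fun i : Fin m => Lp ℂ (r i) (volume : Measure (Space d)))
      (Lp ℂ α (volume : Measure (Space d)))} (hr : ∀ i, r i ≠ ∞) (hrs : ∑ i, (r i)⁻¹ = α⁻¹)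
    (hC : truncConst φ K r α ≠ ∞) (hφ : IsScaleCutoff φ) (hε : 0 < ε) (hε1 : ε ≤ 1)
    (hκ : ∀ v : Space d, ScaleKernel v ε A (kernelPiece φ K)) (hT : HasKernel T K)
    {f : Fin (m + 1) → Space d → ℂ} (hf : ∀ i, MemLp (f i) (formExponents r α i) volume) :
    ‖opForm T f‖ₑ ≤ ENNReal.ofReal (stepConst d m ε * (3 ^ d) ^ (m + 1) *
      (A + 3 ^ d * (‖T‖ + (truncConst φ K r α).toReal))) *
        supPSF (sparsity d) (fun _ => 1) f := by
  obtain ⟨F, hF, hdom, hlim⟩ := exists_adm_approx fun i => (hf i).1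
  refine le_of_tendsto (tendsto_opForm T hr hf
    (fun n i => (hF n i).meas.aestronglyMeasurable) hdom hlim).enorm (Eventually.of_forall fun n => ?_)
  refine (enorm_opForm_le_supPSF_of_adm hr hrs hC hφ hε hε1 hκ hT (hF n)).trans ?_
  gcongr
  exact supPSF_mono (hdom n)

lemma ofReal_const_le {S C b t : ℝ} (hS : 0 ≤ S) (hC : 0 ≤ C) (hb : 0 ≤ b) (A : ℝ≥0) {c : ℝ≥0∞}
    (ht : ENNReal.ofReal t ≤ c) (ht0 : 0 ≤ t) :
    ENNReal.ofReal (S * (C * A + b * t)) ≤ (S * (C + b)).toNNReal * (c + A) := by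
  have h1 : S * (C * A + b * t) ≤ S * (C + b) * (t + A) := by
    rw [mul_assoc]
    have := A.2
    have : 0 ≤ C * t := by positivity
    have : 0 ≤ b * (A : ℝ) := by positivity
    gcongr
    nlinarith
  refine (ENNReal.ofReal_le_ofReal h1).trans ?_
  rw [ENNReal.ofReal_mul (by positivity), ENNReal.ofReal_add ht0 A.coe_nonneg]
  refine mul_le_mul' le_rfl (add_le_add ht (le_of_eq ?_))
  exact ENNReal.ofReal_coe_nnreal

end General

end

end MultiCZ

end

/-! ### The main theorem -/

open MultiCZ
theorem theorem3 (d m : ℕ) (hd : 0 < d) (hm : 0 < m) :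
    -- the sparsity constant depends only on `d` and `m`
    ∃ η : ℝ, 0 < η ∧ η < 1 ∧
    ∀ (ε : ℝ), 0 < ε → ε ≤ 1 →
    ∀ (φ : (Fin (m + 1) → Space d) → ℝ), IsScaleCutoff φ →
    -- the constant depends only on `d`, `m`, `ε` and the cutoff that defines the truncations
    ∃ c : ℝ≥0,
    ∀ (r : Fin m → ℝ≥0∞) (α : ℝ≥0∞) [∀ i, Fact (1 ≤ r i)] [Fact (1 ≤ α)],
    (∀ i, r i ≠ ∞) → ∑ i, (r i)⁻¹ = α⁻¹ →
    ∀ (T : ContinuousMultilinearMap ℂ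
        (fun i : Fin m => Lp ℂ (r i) (volume : Measure (Space d)))
        (Lp ℂ α (volume : Measure (Space d))))
      (K : (Fin (m + 1) → Space d) → ℂ) (A : ℝ≥0),
    IsCZKernel ε A K → HasKernel T K → truncConst φ K r α ≠ ∞ →
    ∀ (p : ℝ≥0∞), 1 < p →
    ∀ (f : Fin (m + 1) → Space d → ℂ), (∀ i, MemLp (f i) (onePExponents m p i) volume) →
      -- all finite truncations of the form
      (∀ μ ν : ℤ,
        Integrable (fun x : Fin (m + 1) → Space d =>
          (∑ s ∈ Finset.Ioo μ ν, kernelPiece φ K s x) * ∏ i, f i (x i)) volume ∧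
        ‖truncForm φ K μ ν f‖ₑ ≤
          c * (truncConst φ K r α + A) * supPSF η (onePExponents m p) f) ∧
      -- the form of `T` itself, where it is defined by the boundedness of `T`
      (∀ (hf : ∀ i : Fin m, MemLp (f i.castSucc) (r i) volume),
        MemLp (f (Fin.last m)) (ENNReal.conjExponent α) volume →
        ‖form T f hf‖ₑ ≤
          c * (truncConst φ K r α + ‖T‖ₑ + A) * supPSF η (onePExponents m p) f) ∧
      -- the form of `T` where it is defined as a limit along dominated approximations of `f`
      (∀ (F : ℕ → Fin (m + 1) → Space d → ℂ)
        (hF : ∀ n, ∀ i : Fin m, MemLp (F n i.castSucc) (r i) volume) (z : ℂ),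
        (∀ n, MemLp (F n (Fin.last m)) (ENNReal.conjExponent α) volume) →
        (∀ n i, ∀ᵐ x, ‖F n i x‖ ≤ ‖f i x‖) →
        (∀ i, ∀ᵐ x, Tendsto (fun n => F n i x) atTop (𝓝 (f i x))) →
        Tendsto (fun n => form T (F n) (hF n)) atTop (𝓝 z) →
        ‖z‖ₑ ≤ c * (truncConst φ K r α + ‖T‖ₑ + A) * supPSF η (onePExponents m p) f) := by
  refine ⟨sparsity d, ?_, ?_, fun ε hε hε1 φ hφ => ?_⟩
  · unfold sparsity; positivity
  · unfold sparsity
    rw [div_lt_one (by positivity)]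
    have : (1 : ℝ) ≤ 3 ^ d := one_le_pow₀ (by norm_num)
    linarith
  obtain ⟨C, hC0, hCκ⟩ := hφ.exists_scaleKernel hε hε1
  set S : ℝ := stepConst d m ε * (3 ^ d) ^ (m + 1) with hS
  have hS0 : 0 ≤ S := mul_nonneg (stepConst_nonneg d m hε) (by positivity)
  refine ⟨(S * (C + 3 ^ d)).toNNReal, ?_⟩
  intro r α _ _ hr hrs T K A hK hT hCT p hp f hf
  have hκ := hCκ K A hK
  have hfm : ∀ i, AEStronglyMeasurable (f i) volume := fun i => (hf i).1
  have h1 : ENNReal.ofReal (truncConst φ K r α).toReal ≤ truncConst φ K r α :=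
    ENNReal.ofReal_toReal_le
  have h2 : ENNReal.ofReal (‖T‖ + (truncConst φ K r α).toReal) ≤ truncConst φ K r α + ‖T‖ₑ := by
    rw [ENNReal.ofReal_add (norm_nonneg _) ENNReal.toReal_nonneg, ofReal_norm, add_comm]
    gcongr
  -- The bound is by the sparse forms of `f` for every `g` dominated by `f`, hence uniform along an
  -- approximating sequence; this is what makes the limiting case immediate.
  have hop : ∀ g : Fin (m + 1) → Space d → ℂ, (∀ i, MemLp (g i) (formExponents r α i) volume) →
      (∀ i, ∀ᵐ x, ‖g i x‖ ≤ ‖f i x‖) → ‖opForm T g‖ₑ ≤ (S * (C + 3 ^ d)).toNNReal *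
        (truncConst φ K r α + ‖T‖ₑ + A) * supPSF (sparsity d) (onePExponents m p) f :=
    fun g hg hgf => by
      refine (enorm_opForm_le_supPSF hr hrs hCT hφ hε hε1 hκ hT hg).trans (mul_le_mul' ?_ ?_)
      · exact ofReal_const_le hS0 hC0 (by positivity) A h2 (by positivity)
      · exact supPSF_one_le hp.le hfm hgf
  refine ⟨fun μ ν => ⟨integrable_truncKernel_mul_prod hφ hε (hκ 0) μ ν hp.le hf, ?_⟩,
    fun hfr hfl => ?_, fun F hF z hFl hdom _ hz => ?_⟩
  · refine (enorm_truncForm_le_supPSF hrs hCT hφ hε hε1 hκ μ ν hp.le hf).trans (mul_le_mul' ?_ ?_)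
    · exact ofReal_const_le hS0 hC0 (by positivity) A h1 ENNReal.toReal_nonneg
    · exact supPSF_one_le hp.le hfm fun i => Eventually.of_forall fun _ => le_rfl
  · rw [form_eq_opForm]
    exact hop f (memLp_formExponents hfr hfl) fun i => Eventually.of_forall fun _ => le_rfl
  · refine le_of_tendsto hz.enorm (Eventually.of_forall fun n => ?_)
    rw [form_eq_opForm]
    exact hop (F n) (memLp_formExponents (hF n) (hFl n)) (hdom n)
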